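/- **Proposition 6.2 (Linear profile decomposition).** Let $\sigma$ be arc length measure on the unit circle $S^1\subset\mathbb R^2$. For $z\in S^1$ and $0<r\le 1$ let $\mathcal C(z,r)$ be the set of $y\in S^1$ with $y\cdot z>0$ and $|y-(y\cdot z)z|<r$. Let $\Theta:[1,\infty)\to(0,\infty)$ satisfy $\Theta(R)\to0$ as $R\to\infty$, and let $C<\infty$. Let $z_\nu\in S^1$, let $w_\nu\in S^1$ with $w_\nu\perp z_\nu$, and let $r_\nu\in(0,1]$ with $r_\nu\to0$. Let $f_\nu\in L^2(S^1)$, $\nu\ge 0$, be nonnegative functions supported on $\mathcal C(z_\nu,r_\nu^{1/2})$, with $\|f_\nu\|_{L^2(S^1)}\to1$, which are upper normalized with respect to $\mathcal C(z_\nu,r_\nu)$ uniformly in $\nu$, that is, $\|f_\nu\|_{L^2(S^1)}\le C$ and, for all $R\ge1$, $$\int_{\{|f_\nu|>R\,r_\nu^{-1/2}\}}|f_\nu|^2\,d\sigma\le\Theta(R),\qquad \int_{\{|x-z_\nu|\ge R\,r_\nu\}}|f_\nu|^2\,d\sigma\le\Theta(R).$$ For $y\in\mathbb R$ with $r_\nu|y|<1$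 put $$g_\nu(y)=\frac{r_\nu^{1/2}\,f_\nu\big(r_\nu y\,w_\nu+\sqrt{1-r_\nu^2y^2}\,z_\nu\big)}{(1-r_\nu^2y^2)^{1/4}},\qquad h_\nu(t,y)=\exp\Big(it\Big(\frac{\sqrt{1-r_\nu^2y^2}-1}{r_\nu^2}+\frac{y^2}{2}\Big)\Big),$$ and for $r_\nu|y|\ge1$ put $g_\nu(y)=0$ and read the square root in $h_\nu$ as $0$. For a function $F$ on $\mathbb R$ write $e^{\frac{it\Delta}{2}}F(x)=\int e^{ixy-\frac{ity^2}{2}}F(y)\,dy$. Then, after passing to a subsequence in $\nu$, there exist profiles $\phi^j\in L^2(\mathbb R)$ $(j\ge1$, possibly zero$)$, parameters $(x_\nu^j,t_\nu^j)\in\mathbb R^2$, and remainders $e_\nu^l\in L^2(\mathbb R)$ $(l\ge0)$ such that for all $l$ and $\nu$ $$g_\nu(y)=\sum_{j=1}^l e^{\frac{it_\nu^jy^2}{2}}e^{-ix_\nu^jy}\,h_\nu(t_\nu^j,y)^{-1}\phi^j(y)+e_\nu^l(y),$$ with the following properties. For $k\ne j$, $$|x_\nu^k-x_\nu^j|+|t_\nu^k-t_\nu^j|\to\infty\quad\text{as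 }\nu\to\infty.$$ For each $l$, $$\lim_{\nu\to\infty}\Big(\|f_\nu\|_{L^2(S^1)}^2-\sum_{j=1}^l\|\phi^j\|_{L^2(\mathbb R)}^2-\|e_\nu^l\|_{L^2(\mathbb R)}^2\Big)=0.$$ Finally, $$\limsup_{l\to\infty}\ \limsup_{\nu\to\infty}\left\|\,r_\nu^{1/2}\,e^{\frac{itr_\nu^2\Delta}{2}}\left[\frac{h_\nu(r_\nu^2t,y)\,e_\nu^l(y)}{(1-r_\nu^2y^2)^{1/4}}\,1_{\{r_\nu|y|<1\}}\right](r_\nu x)\right\|_{L^6_{t,x}(\mathbb R^2)}=0 .$$ -/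

import Mathlib

open MeasureTheory Filter Topology

namespace CapProfile

/-- The Euclidean plane, containing the unit circle `S¹`. -/
abbrev Plane : Type := EuclideanSpace ℝ (Fin 2)

/-- Arc length measure on the unit circle, as a measure on the plane: the image of Lebesgue
measure on `(-π, π]` under the unit speed parametrization. Functions on `S¹` are represented by
functions on the plane, considered up to equality almost everywhere for this measure. -/
noncomputable def arcMeasure : Measure Plane :=
  (volume.restrict (Set.Ioc (-Real.pi) Real.pi)).map
    (fun θ : ℝ => (!₂[Real.cos θ, Real.sin θ] : Plane))

/-- The `L²` norm as a real number (only used for functions that are in `L²`). -/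
noncomputable def l2Norm {α F : Type*} [MeasurableSpace α] [NormedAddCommGroup F]
    (μ : Measure α) (f : α → F) : ℝ :=
  (eLpNorm f 2 μ).toReal

/-- The cap with center `z` (a unit vector) and radius `r`: the points of the circle which lie in
the same open hemisphere as `z` and whose orthogonal projection to the line orthogonal to `z` has
length less than `r`. -/
def cap (z : Plane) (r : ℝ) : Set Plane :=
  {y | ‖y‖ = 1 ∧ 0 < inner ℝ z y ∧ ‖y - (inner ℝ z y) • z‖ < r}

/-- `f ∈ L²(S¹)` is upper normalized with respect to the cap with center `z` and radius `r`, with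
constant `C` and control function `Θ`. -/
structure UpperNormalized (C : ℝ) (Θ : ℝ → ℝ) (z : Plane) (r : ℝ) (f : Plane → ℝ) : Prop where
  memLp : MemLp f 2 arcMeasure
  norm_le : l2Norm arcMeasure f ≤ C
  height : ∀ R : ℝ, 1 ≤ R →
    ∫ x in {x | R * r ^ (-(1 / 2) : ℝ) < |f x|}, |f x| ^ 2 ∂arcMeasure ≤ Θ R
  tail : ∀ R : ℝ, 1 ≤ R →
    ∫ x in {x | R * r ≤ ‖x - z‖}, |f x| ^ 2 ∂arcMeasure ≤ Θ R

/-- The rescaling map of a cap with center `z` and radius `r`, extended to `|y| < 1 / r`; the unit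
vector `w ⟂ z` encodes the identification of the line orthogonal to `z` with `ℝ`. For
`z = (0, 1)` and `w = (1, 0)` it is `y ↦ (r y, √(1 - r² y²))`. -/
noncomputable def capMap (z w : Plane) (r y : ℝ) : Plane :=
  (r * y) • w + √(1 - r ^ 2 * y ^ 2) • z

/-- The set `|y| < 1 / r` over which the open hemisphere around `z` is parametrized. -/
def chartDomain (r : ℝ) : Set ℝ := {y | |r * y| < 1}

/-- The rescaled function `g(y) = r^{1/2} f(φ(y)) / (1 - r² y²)^{1/4}`, `φ` the rescaling map;
it vanishes for `|y| ≥ 1 / r`. -/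
noncomputable def rescaled (z w : Plane) (r : ℝ) (f : Plane → ℝ) : ℝ → ℝ :=
  (chartDomain r).indicator fun y =>
    r ^ (1 / 2 : ℝ) * f (capMap z w r y) / (1 - r ^ 2 * y ^ 2) ^ (1 / 4 : ℝ)

/-- The unimodular factor `h(t, y) = exp (i t ((√(1 - r² y²) - 1) / r² + y² / 2))`. (For
`|y| > 1 / r` the real square root is `0`, so the factor is still unimodular there.) -/
noncomputable def hFactor (r t y : ℝ) : ℂ :=
  Complex.exp (Complex.I * ((t * ((√(1 - r ^ 2 * y ^ 2) - 1) / r ^ 2 + y ^ 2 / 2) : ℝ) : ℂ))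

/-- `e^{itΔ/2} F (x) = ∫ e^{ixy - ity²/2} F(y) dy`, where `F` is on the frequency side. -/
noncomputable def schrodinger (t : ℝ) (F : ℝ → ℂ) (x : ℝ) : ℂ :=
  ∫ y, Complex.exp (Complex.I * ((x * y - t * y ^ 2 / 2 : ℝ) : ℂ)) * F y

/-- The modified Schrödinger evolution
`(t, x) ↦ r^{1/2} e^{i t r² Δ/2} [h(r² t, y) e(y) / (1 - r² y²)^{1/4}] (r x)`,
where the function in brackets lives on `|y| < 1 / r`. -/
noncomputable def modifiedEvolution (r : ℝ) (e : ℝ → ℂ) (p : ℝ × ℝ) : ℂ :=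
  ((r ^ (1 / 2 : ℝ) : ℝ) : ℂ) *
    schrodinger (r ^ 2 * p.1)
      ((chartDomain r).indicator fun y =>
        hFactor r (r ^ 2 * p.1) y * e y / (((1 - r ^ 2 * y ^ 2) ^ (1 / 4 : ℝ) : ℝ) : ℂ))
      (r * p.2)

/-- The modulated, translated profile `e^{i t y²/2} e^{-i x y} h(t, y)⁻¹ φ(y)`. -/
noncomputable def profile (r x t : ℝ) (φ : ℝ → ℂ) (y : ℝ) : ℂ :=
  Complex.exp (Complex.I * ((t * y ^ 2 / 2 : ℝ) : ℂ)) *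
    Complex.exp (-Complex.I * ((x * y : ℝ) : ℂ)) * (hFactor r t y)⁻¹ * φ y

end CapProfile

/-! The substitution $y=\sin\theta/r$ turns $g_\nu$ into $f_\nu$ on the half circle around $z_\nu$
with the same $L^2$ norm, and the modified evolution into the Fourier extension from the circle, up
to a unimodular factor. A profile is $\phi$ multiplied by the inverse of the modulation `mult` with
phase $xy+t\psi_r(y)$, $\psi_r(y)=(\sqrt{1-r^2y^2}-1)/r^2$ (`profile_eq_mult_mul`). Two things are
needed: an extraction of profiles in a Hilbert space with a family of unitary actions, and a proof
that small weak limits force a small $L^6$ norm.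

Extraction. Along an ultrafilter every bounded sequence has a weak limit in every moving frame, so
no subsequences are taken during the construction. At each step, among the frames that diverge from
those already used, one is chosen whose weak limit is at least half as large as any other, and that
limit is subtracted. Actions with divergent parameters tend weakly to zero; for `mult` this is van
der Corput's lemma (`norm_integral_cexp_le_of_le_deriv`, `tendsto_integral_mult`). Hence earlier
frames stay empty (`weakLim_state_of_lt`), the squared norms add up (`tendsto_norm_sq_state`), and
the norms of the profiles tend to zero. It follows that the pairing of a late remainder with a fixed
vector is small uniformly over all frames (`eventually_norm_inner_le`).

From weak limits to $L^6$. For a remainder cut off to $[-N,N]$, a value of the evolution is $\sqrt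
r$ times such a pairing, against a vector that converges as $r\to0$
(`norm_modifiedEvolution_indicator`), so the supremum is small. The refined restriction inequality
`exists_lintegral_arcExt_le` converts this into $L^6$ smallness, provided the remainder has little
mass on short intervals. Its proof writes the cube of the extension as a sum over near and far pairs
of points. Near pairs gain from the mass on short arcs, since sums of three points of a quarter
circle have bounded density; far pairs gain from the supremum, since sums of two separated points
have bounded density.

The bounds for mass on short intervals and for tails hold for $g_\nu$ by upper normalization. They
pass to the remainders because restriction to a set commutes with modulations, so the norm identity
also holds after restriction (`eventually_norm_proj_sq_le`). At the end countably many statements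
valid along the ultrafilter are realized along one subsequence. -/

namespace CapProfile

open scoped ENNReal

/-! ### Profile decomposition in a Hilbert space with a family of unitary actions -/

section Hilbert

variable {H : Type*} [NormedAddCommGroup H] [InnerProductSpace ℂ H]

/-- `u` converges weakly to `w` along `U`. -/
def WeakLim (U : Filter ℕ) (u : ℕ → H) (w : H) : Prop :=
  ∀ v, Tendsto (fun ν => inner ℂ (u ν) v) U (𝓝 (inner ℂ w v))

lemma WeakLim.unique {U : Filter ℕ} [U.NeBot] {u : ℕ → H} {w w' : H} (h : WeakLim U u w)
    (h' : WeakLim U u w') : w = w' :=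
  ext_inner_right ℂ fun v => tendsto_nhds_unique (h v) (h' v)

lemma WeakLim.sub {U : Filter ℕ} {u u' : ℕ → H} {w w' : H} (h : WeakLim U u w)
    (h' : WeakLim U u' w') : WeakLim U (fun ν => u ν - u' ν) (w - w') := fun v => by
  simpa only [inner_sub_left] using (h v).sub (h' v)

lemma WeakLim.norm_le {U : Filter ℕ} [U.NeBot] {u : ℕ → H} {w : H} {B : ℝ}
    (h : WeakLim U u w) (hB : ∀ ν, ‖u ν‖ ≤ B) : ‖w‖ ≤ B := by
  have h1 : ‖inner ℂ w w‖ ≤ B * ‖w‖ :=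
    le_of_tendsto (h w).norm (Eventually.of_forall fun ν =>
      (norm_inner_le_norm _ _).trans (mul_le_mul_of_nonneg_right (hB ν) (norm_nonneg _)))
  rw [inner_self_eq_norm_sq_to_K] at h1
  have h2 : ‖w‖ * ‖w‖ ≤ B * ‖w‖ := by
    simpa [sq] using h1
  rcases eq_or_lt_of_le (norm_nonneg w) with h0 | h0
  · rw [← h0]; exact (norm_nonneg _).trans (hB 0)
  · exact le_of_mul_le_mul_right h2 h0

/-- Each pairing stays in a compact disc and so converges along the ultrafilter; the limits form a
bounded linear functional, which the Riesz theorem represents. -/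
lemma exists_weakLim [CompleteSpace H] (U : Ultrafilter ℕ) {u : ℕ → H} {B : ℝ}
    (hB : ∀ ν, ‖u ν‖ ≤ B) : ∃ w, WeakLim U u w := by
  have hex : ∀ v, ∃ c : ℂ, Tendsto (fun ν => inner ℂ (u ν) v) U (𝓝 c) ∧ ‖c‖ ≤ B * ‖v‖ := by
    intro v
    have hmem : ∀ ν, inner ℂ (u ν) v ∈ Metric.closedBall (0 : ℂ) (B * ‖v‖) := fun ν => by
      rw [mem_closedBall_zero_iff]
      exact (norm_inner_le_norm _ _).trans (mul_le_mul_of_nonneg_right (hB ν) (norm_nonneg _))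
    obtain ⟨c, hc, hlim⟩ := (isCompact_closedBall (0 : ℂ) (B * ‖v‖)).ultrafilter_le_nhds
      (U.map fun ν => inner ℂ (u ν) v)
      (by rw [le_principal_iff]; exact mem_map.2 (univ_mem' hmem))
    exact ⟨c, hlim, by simpa using hc⟩
  choose ℓ hℓ hℓB using hex
  let L : H →ₗ[ℂ] ℂ :=
    { toFun := ℓ
      map_add' := fun a b => tendsto_nhds_unique (hℓ (a + b))
        (by simpa only [inner_add_right] using (hℓ a).add (hℓ b))
      map_smul' := fun c a => tendsto_nhds_unique (hℓ (c • a))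
        (by simpa [inner_smul_right] using (hℓ a).const_mul c) }
  refine ⟨(InnerProductSpace.toDual ℂ H).symm (L.mkContinuous B hℓB), fun v => ?_⟩
  rw [InnerProductSpace.toDual_symm_apply]
  exact hℓ v

/-- A sequence of unitary actions of `ℝ × ℝ` which converges strongly on bounded sets of parameters
and tends weakly to zero as the parameters tend to infinity. -/
structure UnitaryFamily (H : Type*) [NormedAddCommGroup H] [InnerProductSpace ℂ H] where
  act : ℕ → ℝ × ℝ → H →L[ℂ] H
  act_zero : ∀ ν v, act ν 0 v = v
  act_add : ∀ ν p q v, act ν (p + q) v = act ν p (act ν q v)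
  norm_act : ∀ ν p v, ‖act ν p v‖ = ‖v‖
  lim : ℝ × ℝ → H → H
  tendsto_lim : ∀ c v, Tendsto (fun a : ℕ × (ℝ × ℝ) => act a.1 a.2 v) (atTop ×ˢ 𝓝 c) (𝓝 (lim c v))
  tendsto_zero : ∀ v w, Tendsto (fun a : ℕ × (ℝ × ℝ) => inner ℂ (act a.1 a.2 v) w)
    (atTop ×ˢ Bornology.cobounded (ℝ × ℝ)) (𝓝 0)

namespace UnitaryFamily

variable (M : UnitaryFamily H)

lemma act_act_neg (ν : ℕ) (p : ℝ × ℝ) (v : H) : M.act ν p (M.act ν (-p) v) = v := by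
  rw [← M.act_add, add_neg_cancel, M.act_zero]

lemma inner_act (ν : ℕ) (p : ℝ × ℝ) (u v : H) :
    inner ℂ (M.act ν p u) v = inner ℂ u (M.act ν (-p) v) := by
  conv_lhs => rw [← M.act_act_neg ν p v]
  exact LinearIsometry.inner_map_map (⟨(M.act ν p).toLinearMap, M.norm_act ν p⟩ : H →ₗᵢ[ℂ] H) _ _

lemma inner_act_neg (ν : ℕ) (p : ℝ × ℝ) (u v : H) :
    inner ℂ u (M.act ν (-p) v) = inner ℂ (M.act ν p u) v := (M.inner_act ν p u v).symm

/-- Divergence of two sequences of parameters. -/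
def Diverge (U : Filter ℕ) (p q : ℕ → ℝ × ℝ) : Prop :=
  Tendsto (fun ν => p ν - q ν) U (Bornology.cobounded (ℝ × ℝ))

lemma Diverge.symm {U : Filter ℕ} {p q : ℕ → ℝ × ℝ} (h : Diverge U p q) : Diverge U q p := by
  have := (tendsto_norm_atTop_iff_cobounded.2 h)
  refine tendsto_norm_atTop_iff_cobounded.1 ?_
  simpa only [norm_sub_rev] using this

lemma tendsto_of_not_diverge {U : Ultrafilter ℕ} {p q : ℕ → ℝ × ℝ} (h : ¬ Diverge U p q) :
    ∃ c, Tendsto (fun ν => p ν - q ν) U (𝓝 c) := by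
  rw [Diverge, ← tendsto_norm_atTop_iff_cobounded, tendsto_atTop] at h
  push Not at h
  obtain ⟨b, hb⟩ := h
  have hb' : ∀ᶠ ν in (U : Filter ℕ), p ν - q ν ∈ Metric.closedBall (0 : ℝ × ℝ) b := by
    filter_upwards [hb] with ν hν
    rw [mem_closedBall_zero_iff]
    exact hν.le
  obtain ⟨c, -, hc⟩ := (isCompact_closedBall (0 : ℝ × ℝ) b).ultrafilter_le_nhds
    (U.map fun ν => p ν - q ν) (by rw [le_principal_iff]; exact mem_map.2 hb')
  exact ⟨c, hc⟩

/-- Asymptotic orthogonality: a profile placed in the frame $q$ is invisible in a frame $p$ that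
diverges from it. -/
lemma weakLim_act_of_diverge {U : Filter ℕ} (hU : U ≤ atTop) {p q : ℕ → ℝ × ℝ}
    (h : Diverge U p q) (v : H) :
    WeakLim U (fun ν => M.act ν (p ν) (M.act ν (-q ν) v)) 0 := fun w => by
  have h1 : Tendsto (fun ν : ℕ => (ν, p ν - q ν)) U (atTop ×ˢ Bornology.cobounded (ℝ × ℝ)) :=
    Tendsto.prodMk hU h
  rw [inner_zero_left]
  refine ((M.tendsto_zero v w).comp h1).congr fun ν => ?_
  simp only [Function.comp, sub_eq_add_neg, M.act_add]

/-- Two frames whose difference converges see the same vanishing: the relative action can be moved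
onto the test vector, where it converges strongly. -/
lemma weakLim_act_zero_of_tendsto {U : Filter ℕ} (hU : U ≤ atTop) {p q : ℕ → ℝ × ℝ} {c : ℝ × ℝ}
    (h : Tendsto (fun ν => p ν - q ν) U (𝓝 c)) {u : ℕ → H} {B : ℝ} (hB : ∀ ν, ‖u ν‖ ≤ B)
    (hq : WeakLim U (fun ν => M.act ν (q ν) (u ν)) 0) :
    WeakLim U (fun ν => M.act ν (p ν) (u ν)) 0 := fun v => by
  have h1 : Tendsto (fun ν : ℕ => (ν, -(p ν - q ν))) U (atTop ×ˢ 𝓝 (-c)) :=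
    Tendsto.prodMk hU h.neg
  have h2 := (M.tendsto_lim (-c) v).comp h1
  have h3 := hq (M.lim (-c) v)
  rw [inner_zero_left] at h3 ⊢
  have h4 : Tendsto (fun ν => inner ℂ (M.act ν (q ν) (u ν))
      (M.act ν (-(p ν - q ν)) v - M.lim (-c) v)) U (𝓝 0) := by
    have h5 : Tendsto (fun ν => B * ‖M.act ν (-(p ν - q ν)) v - M.lim (-c) v‖) U (𝓝 (B * 0)) :=
      Tendsto.const_mul _ (tendsto_iff_norm_sub_tendsto_zero.1 h2)
    rw [mul_zero] at h5
    refine squeeze_zero_norm (fun ν => (norm_inner_le_norm _ _).trans ?_) h5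
    rw [M.norm_act]
    exact mul_le_mul_of_nonneg_right (hB ν) (norm_nonneg _)
  have h6 := h3.add h4
  rw [add_zero] at h6
  refine h6.congr fun ν => ?_
  rw [← inner_add_right, add_sub_cancel, M.inner_act_neg, ← M.act_add, sub_add_cancel]

/-- A symmetric idempotent operator commuting with all the actions. -/
structure IsCommutingProj (Q : H →L[ℂ] H) : Prop where
  symm : ∀ u v, inner ℂ (Q u) v = inner ℂ u (Q v)
  idem : ∀ u, Q (Q u) = Q u
  comm : ∀ ν p u, Q (M.act ν p u) = M.act ν p (Q u)

lemma isCommutingProj_id : M.IsCommutingProj (ContinuousLinearMap.id ℂ H) :=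
  ⟨fun _ _ => rfl, fun _ => rfl, fun _ _ _ => rfl⟩

/-- In the expanded square the cross term is the pairing of the sequence, seen in its frame, with
the fixed vector $Q\phi$, because $Q$ commutes with the action. The case $Q=\mathrm{id}$ gives the
norm identity; restrictions to sets give its localized form. -/
lemma tendsto_norm_sq_sub {U : Filter ℕ} {Q : H →L[ℂ] H} (hQ : M.IsCommutingProj Q)
    {p : ℕ → ℝ × ℝ} {u : ℕ → H} {φ : H} (h : WeakLim U (fun ν => M.act ν (p ν) (u ν)) φ) :
    Tendsto (fun ν => ‖Q (u ν - M.act ν (-p ν) φ)‖ ^ 2 - ‖Q (u ν)‖ ^ 2) U (𝓝 (-‖Q φ‖ ^ 2)) := by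
  have h1 := (Complex.continuous_re.tendsto _).comp (h (Q φ))
  have h2 : inner ℂ φ (Q φ) = ((‖Q φ‖ ^ 2 : ℝ) : ℂ) := by
    rw [← hQ.idem φ, ← hQ.symm, hQ.idem, inner_self_eq_norm_sq_to_K]; norm_cast
  rw [h2, Complex.ofReal_re] at h1
  have h3 := ((h1.const_mul 2).const_sub (‖Q φ‖ ^ 2))
  rw [show ‖Q φ‖ ^ 2 - 2 * ‖Q φ‖ ^ 2 = -‖Q φ‖ ^ 2 by ring] at h3
  refine h3.congr fun ν => ?_
  simp only [Function.comp]
  rw [map_sub, @norm_sub_sq ℂ, hQ.comm ν (-p ν) φ, M.norm_act, M.inner_act_neg,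
    ← hQ.comm, hQ.symm, hQ.idem, RCLike.re_eq_complex_re]
  ring

/-! ### Greedy extraction of profiles -/

/-- The sequence of remainders and the list of parameters used so far. -/
structure State (H : Type*) where
  seq : ℕ → H
  used : List (ℕ → ℝ × ℝ)

/-- A nearly optimal choice of the next profile. -/
def Good (U : Filter ℕ) (s : State H) (a : (ℕ → ℝ × ℝ) × H) : Prop :=
  (∀ q ∈ s.used, Diverge U a.1 q) ∧ WeakLim U (fun ν => M.act ν (a.1 ν) (s.seq ν)) a.2 ∧
    ∀ (p : ℕ → ℝ × ℝ) (φ : H), (∀ q ∈ s.used, Diverge U p q) →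
      WeakLim U (fun ν => M.act ν (p ν) (s.seq ν)) φ → ‖φ‖ ≤ 2 * ‖a.2‖

lemma exists_diverge {U : Filter ℕ} (hU : U ≤ atTop) (L : List (ℕ → ℝ × ℝ)) :
    ∃ p : ℕ → ℝ × ℝ, ∀ q ∈ L, Diverge U p q := by
  -- Adding the norms of all listed parameters keeps the distance to each of them at least $\nu$.
  refine ⟨fun ν => ((ν : ℝ) + (L.map fun q => ‖q ν‖).sum, 0), fun q hq => ?_⟩
  refine tendsto_norm_atTop_iff_cobounded.1 ?_
  refine tendsto_atTop_mono (fun ν => ?_) (tendsto_natCast_atTop_atTop.mono_left hU)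
  have h1 : ‖q ν‖ ≤ (L.map fun q => ‖q ν‖).sum :=
    List.single_le_sum (by simp) _ (List.mem_map_of_mem hq)
  have h2 : ‖(((ν : ℝ) + (L.map fun q => ‖q ν‖).sum, (0 : ℝ)) : ℝ × ℝ)‖
      ≥ (ν : ℝ) + (L.map fun q => ‖q ν‖).sum :=
    (le_abs_self _).trans (norm_fst_le ((((ν : ℝ) + (L.map fun q => ‖q ν‖).sum, (0 : ℝ)) : ℝ × ℝ)))
  have h3 := norm_sub_norm_le (((ν : ℝ) + (L.map fun q => ‖q ν‖).sum, (0 : ℝ)) : ℝ × ℝ) (q ν)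
  linarith

lemma exists_good [CompleteSpace H] {U : Ultrafilter ℕ} (hU : (U : Filter ℕ) ≤ atTop)
    (s : State H) {B : ℝ} (hB : ∀ ν, ‖s.seq ν‖ ≤ B) : ∃ a, M.Good U s a := by
  let S : Set ℝ := {b | ∃ (p : ℕ → ℝ × ℝ) (φ : H), (∀ q ∈ s.used, Diverge U p q) ∧
    WeakLim U (fun ν => M.act ν (p ν) (s.seq ν)) φ ∧ b = ‖φ‖}
  have hbdd : BddAbove S := by
    refine ⟨B, ?_⟩
    rintro b ⟨p, φ, -, h, rfl⟩
    exact h.norm_le fun ν => (M.norm_act _ _ _).trans_le (hB ν)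
  obtain ⟨p, hp⟩ := exists_diverge hU s.used
  obtain ⟨φ, hφ⟩ := exists_weakLim U (u := fun ν => M.act ν (p ν) (s.seq ν))
    fun ν => (M.norm_act _ _ _).trans_le (hB ν)
  have hne : S.Nonempty := ⟨_, p, φ, hp, hφ, rfl⟩
  have hle : ∀ (p : ℕ → ℝ × ℝ) (φ : H), (∀ q ∈ s.used, Diverge U p q) →
      WeakLim U (fun ν => M.act ν (p ν) (s.seq ν)) φ → ‖φ‖ ≤ sSup S :=
    fun p φ h1 h2 => le_csSup hbdd ⟨p, φ, h1, h2, rfl⟩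
  -- If the supremum is not positive, every admissible limit is zero and any frame will do;
  -- otherwise some limit exceeds half of the supremum, whence the factor 2.
  rcases le_or_gt (sSup S) 0 with h0 | h0
  · exact ⟨(p, φ), hp, hφ, fun p' φ' h1 h2 => ((hle p' φ' h1 h2).trans h0).trans (by positivity)⟩
  · obtain ⟨_, ⟨p', φ', h1, h2, rfl⟩, h3⟩ := exists_lt_of_lt_csSup hne (half_lt_self h0)
    exact ⟨(p', φ'), h1, h2, fun p'' φ'' h4 h5 => (hle p'' φ'' h4 h5).trans (by linarith)⟩

open Classical in
/-- The nearly optimal next profile and its parameters. -/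
noncomputable def next (U : Filter ℕ) (s : State H) : (ℕ → ℝ × ℝ) × H :=
  if h : ∃ a, M.Good U s a then h.choose else (0, 0)

/-- The greedy algorithm. -/
noncomputable def state (U : Filter ℕ) (g : ℕ → H) : ℕ → State H
  | 0 => ⟨g, []⟩
  | l + 1 =>
    let s := state U g l
    ⟨fun ν => s.seq ν - M.act ν (-(M.next U s).1 ν) (M.next U s).2, (M.next U s).1 :: s.used⟩

variable {M}

lemma state_seq_bounded {U : Filter ℕ} {g : ℕ → H} {B : ℝ} (hB : ∀ ν, ‖g ν‖ ≤ B) (l : ℕ) :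
    ∃ B', ∀ ν, ‖(M.state U g l).seq ν‖ ≤ B' := by
  induction l with
  | zero => exact ⟨B, hB⟩
  | succ l ih =>
    obtain ⟨B', hB'⟩ := ih
    exact ⟨B' + ‖(M.next U (M.state U g l)).2‖, fun ν => (norm_sub_le _ _).trans
      (add_le_add (hB' ν) (M.norm_act _ _ _).le)⟩

lemma state_good [CompleteSpace H] {U : Ultrafilter ℕ} (hU : (U : Filter ℕ) ≤ atTop) {g : ℕ → H}
    {B : ℝ} (hB : ∀ ν, ‖g ν‖ ≤ B) (l : ℕ) :
    M.Good U (M.state U g l) (M.next U (M.state U g l)) := by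
  obtain ⟨B', hB'⟩ := state_seq_bounded (M := M) (U := U) hB l
  have h := M.exists_good hU (M.state U g l) hB'
  rw [next, dif_pos h]
  exact h.choose_spec

lemma state_used {U : Filter ℕ} {g : ℕ → H} (l : ℕ) (q : ℕ → ℝ × ℝ) :
    q ∈ (M.state U g l).used ↔ ∃ j < l, q = (M.next U (M.state U g j)).1 := by
  induction l with
  | zero => simp [state]
  | succ l ih =>
    simp only [state, List.mem_cons, ih, Nat.lt_succ_iff_lt_or_eq]
    constructor
    · rintro (h | ⟨j, hj, h⟩)
      · exact ⟨l, Or.inr rfl, h⟩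
      · exact ⟨j, Or.inl hj, h⟩
    · rintro ⟨j, hj | rfl, h⟩
      · exact Or.inr ⟨j, hj, h⟩
      · exact Or.inl h

lemma state_diverge [CompleteSpace H] {U : Ultrafilter ℕ} (hU : (U : Filter ℕ) ≤ atTop) {g : ℕ → H}
    {B : ℝ} (hB : ∀ ν, ‖g ν‖ ≤ B) {j k : ℕ} (hjk : j < k) :
    Diverge U (M.next U (M.state U g k)).1 (M.next U (M.state U g j)).1 :=
  (state_good hU hB k).1 _ ((state_used k _).2 ⟨j, hjk, rfl⟩)

/-- Subtracting the profile $j$ empties its frame, and every later subtraction happens in a frame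
divergent from it, hence contributes nothing in the weak limit. -/
lemma weakLim_state_of_lt [CompleteSpace H] {U : Ultrafilter ℕ} (hU : (U : Filter ℕ) ≤ atTop)
    {g : ℕ → H} {B : ℝ} (hB : ∀ ν, ‖g ν‖ ≤ B) {j l : ℕ} (hjl : j < l) :
    WeakLim U (fun ν => M.act ν ((M.next U (M.state U g j)).1 ν) ((M.state U g l).seq ν)) 0 := by
  induction l, hjl using Nat.le_induction with
  | base =>
    have h := (state_good (M := M) hU hB j).2.1
    have h2 := h.sub (w' := (M.next U (M.state U g j)).2)
      (u' := fun _ => (M.next U (M.state U g j)).2) fun v => tendsto_const_nhds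
    rw [sub_self] at h2
    refine fun v => (h2 v).congr fun ν => ?_
    simp only [state, map_sub, M.act_act_neg]
  | succ l hl ih =>
    have h2 := ih.sub (M.weakLim_act_of_diverge hU (state_diverge (M := M) hU hB hl).symm
      (M.next U (M.state U g l)).2)
    rw [sub_self] at h2
    refine fun v => (h2 v).congr fun ν => ?_
    simp only [state, map_sub]

/-- Near-optimality was only demanded over frames divergent from the used ones. In any other frame
the parameters stay, along the ultrafilter, at a convergent distance from a used frame, and there
the weak limit is zero. -/
lemma norm_weakLim_state_le [CompleteSpace H] {U : Ultrafilter ℕ} (hU : (U : Filter ℕ) ≤ atTop)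
    {g : ℕ → H} {B : ℝ} (hB : ∀ ν, ‖g ν‖ ≤ B) (l : ℕ) {p : ℕ → ℝ × ℝ} {φ : H}
    (h : WeakLim U (fun ν => M.act ν (p ν) ((M.state U g l).seq ν)) φ) :
    ‖φ‖ ≤ 2 * ‖(M.next U (M.state U g l)).2‖ := by
  by_cases hp : ∀ q ∈ (M.state U g l).used, Diverge U p q
  · exact (state_good hU hB l).2.2 p φ hp h
  · push Not at hp
    obtain ⟨q, hq, hpq⟩ := hp
    obtain ⟨j, hj, rfl⟩ := (state_used l q).1 hq
    obtain ⟨c, hc⟩ := tendsto_of_not_diverge hpq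
    obtain ⟨B', hB'⟩ := state_seq_bounded (M := M) (U := U) hB l
    rw [h.unique (M.weakLim_act_zero_of_tendsto hU hc hB' (weakLim_state_of_lt hU hB hj)),
      norm_zero]
    positivity

/-- Uniformity in the parameter comes by contradiction: since $U$ is an ultrafilter, failure gives
offending parameters for $U$-almost all $\nu$. A weak limit along them would pair too strongly with
`k`. -/
lemma eventually_norm_inner_le [CompleteSpace H] {U : Ultrafilter ℕ} (hU : (U : Filter ℕ) ≤ atTop)
    {g : ℕ → H} {B : ℝ} (hB : ∀ ν, ‖g ν‖ ≤ B) (l : ℕ) (k : H) {ε : ℝ} (hε : 0 < ε) :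
    ∀ᶠ ν in (U : Filter ℕ), ∀ p, ‖inner ℂ (M.act ν p ((M.state U g l).seq ν)) k‖
      ≤ 2 * ‖(M.next U (M.state U g l)).2‖ * ‖k‖ + ε := by
  by_contra hcon
  have h1 := Ultrafilter.eventually_not.2 hcon
  have h2 : ∃ p : ℕ → ℝ × ℝ, ∀ᶠ ν in (U : Filter ℕ),
      2 * ‖(M.next U (M.state U g l)).2‖ * ‖k‖ + ε <
        ‖inner ℂ (M.act ν (p ν) ((M.state U g l).seq ν)) k‖ := by
    -- A parameter is selected for every $\nu$, with the dummy value 0 where the bound does not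
    -- fail.
    have h3 : ∀ ν, ∃ p, (¬ ∀ p, ‖inner ℂ (M.act ν p ((M.state U g l).seq ν)) k‖
      ≤ 2 * ‖(M.next U (M.state U g l)).2‖ * ‖k‖ + ε) →
        2 * ‖(M.next U (M.state U g l)).2‖ * ‖k‖ + ε <
        ‖inner ℂ (M.act ν p ((M.state U g l).seq ν)) k‖ := fun ν => by
      by_cases h : ∀ p, ‖inner ℂ (M.act ν p ((M.state U g l).seq ν)) k‖
          ≤ 2 * ‖(M.next U (M.state U g l)).2‖ * ‖k‖ + ε
      · exact ⟨0, fun h' => absurd h h'⟩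
      · push Not at h
        obtain ⟨p, hp⟩ := h
        exact ⟨p, fun _ => hp⟩
    choose p hp using h3
    exact ⟨p, h1.mono hp⟩
  obtain ⟨p, hp⟩ := h2
  obtain ⟨B', hB'⟩ := state_seq_bounded (M := M) (U := U) hB l
  obtain ⟨φ, hφ⟩ := exists_weakLim U (u := fun ν => M.act ν (p ν) ((M.state U g l).seq ν))
    fun ν => (M.norm_act _ _ _).trans_le (hB' ν)
  have h4 := ge_of_tendsto (hφ k).norm (hp.mono fun ν hν => hν.le)
  have h5 := norm_inner_le_norm (𝕜 := ℂ) φ k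
  have h6 := mul_le_mul_of_nonneg_right (norm_weakLim_state_le hU hB l hφ) (norm_nonneg k)
  linarith

lemma tendsto_norm_sq_state [CompleteSpace H] {U : Ultrafilter ℕ} (hU : (U : Filter ℕ) ≤ atTop)
    {g : ℕ → H} {B : ℝ} (hB : ∀ ν, ‖g ν‖ ≤ B) {Q : H →L[ℂ] H} (hQ : M.IsCommutingProj Q) (l : ℕ) :
    Tendsto (fun ν => ‖Q (g ν)‖ ^ 2 - ((∑ j ∈ Finset.range l,
      ‖Q (M.next U (M.state U g j)).2‖ ^ 2) + ‖Q ((M.state U g l).seq ν)‖ ^ 2)) U (𝓝 0) := by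
  induction l with
  | zero => simp [state]
  | succ l ih =>
    have h := M.tendsto_norm_sq_sub hQ (state_good (M := M) hU hB l).2.1
    have h2 := ih.sub (h.add_const (‖Q (M.next U (M.state U g l)).2‖ ^ 2))
    rw [neg_add_cancel, sub_zero] at h2
    refine h2.congr fun ν => ?_
    rw [Finset.sum_range_succ]
    simp only [state]
    ring

/-- The norm identity bounds the partial sums of the squared norms of the profiles by $B^2$, so
these norms tend to zero. -/
lemma tendsto_norm_next [CompleteSpace H] {U : Ultrafilter ℕ} (hU : (U : Filter ℕ) ≤ atTop)
    {g : ℕ → H} {B : ℝ} (hB : ∀ ν, ‖g ν‖ ≤ B) :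
    Tendsto (fun l => ‖(M.next U (M.state U g l)).2‖) atTop (𝓝 0) := by
  have hsum : ∀ l, ∑ j ∈ Finset.range l, ‖(M.next U (M.state U g j)).2‖ ^ 2 ≤ B ^ 2 := fun l => by
    have h := (tendsto_norm_sq_state (M := M) hU hB M.isCommutingProj_id l).const_sub (B ^ 2)
    rw [sub_zero] at h
    refine ge_of_tendsto h (Eventually.of_forall fun ν => ?_)
    have h1 : ‖g ν‖ ^ 2 ≤ B ^ 2 := pow_le_pow_left₀ (norm_nonneg _) (hB ν) 2
    have h2 := sq_nonneg ‖(M.state U g l).seq ν‖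
    simp only [ContinuousLinearMap.id_apply]
    linarith
  have hs : Summable fun j => ‖(M.next U (M.state U g j)).2‖ ^ 2 :=
    summable_of_sum_range_le (fun _ => sq_nonneg _) hsum
  have h := hs.tendsto_atTop_zero
  have h2 := h.sqrt
  simpa using h2

/-- Dropping the profiles from the localized norm identity: the part of a remainder in the range of
$Q$ is asymptotically no larger than that of the original sequence. -/
lemma eventually_norm_proj_sq_le [CompleteSpace H] {U : Ultrafilter ℕ}
    (hU : (U : Filter ℕ) ≤ atTop) {g : ℕ → H} {B : ℝ} (hB : ∀ ν, ‖g ν‖ ≤ B) {Q : H →L[ℂ] H}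
    (hQ : M.IsCommutingProj Q) (l : ℕ) {ε : ℝ} (hε : 0 < ε) :
    ∀ᶠ ν in (U : Filter ℕ), ‖Q ((M.state U g l).seq ν)‖ ^ 2 ≤ ‖Q (g ν)‖ ^ 2 + ε := by
  filter_upwards [(tendsto_order.1 (tendsto_norm_sq_state (M := M) hU hB hQ l)).1 (-ε)
    (by linarith)] with ν hν
  have : 0 ≤ ∑ j ∈ Finset.range l, ‖Q (M.next U (M.state U g j)).2‖ ^ 2 :=
    Finset.sum_nonneg fun _ _ => sq_nonneg _
  linarith

end UnitaryFamily

end Hilbert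

/-! ### From an ultrafilter to a subsequence -/

/-- A countable family of properties that hold eventually along an ultrafilter finer than `atTop`
hold eventually along a common subsequence. -/
lemma exists_strictMono_of_eventually {U : Filter ℕ} [U.NeBot] (hU : U ≤ atTop)
    {ι : Type*} [Countable ι] (P : ι → ℕ → Prop) (hP : ∀ i, ∀ᶠ ν in U, P i ν) :
    ∃ n : ℕ → ℕ, StrictMono n ∧ ∀ i, ∀ᶠ k in atTop, P i (n k) := by
  rcases isEmpty_or_nonempty ι with h | h
  · exact ⟨id, strictMono_id, fun i => (IsEmpty.false i).elim⟩
  obtain ⟨a, ha⟩ := exists_surjective_nat ι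
  -- Diagonal choice: the $k$-th index is taken where the properties numbered up to $k$ hold
  -- simultaneously.
  have h1 : ∀ N k : ℕ, ∃ ν, N < ν ∧ ∀ i ≤ k, P (a i) ν := fun N k => by
    have h2 : ∀ᶠ ν in U, ∀ i ∈ Finset.range (k + 1), P (a i) ν :=
      (Filter.eventually_all_finset _).2 fun i _ => hP _
    obtain ⟨ν, h3, h4⟩ := (((eventually_gt_atTop N).filter_mono hU).and h2).exists
    exact ⟨ν, h3, fun i hi => h4 i (Finset.mem_range.2 (Nat.lt_succ_of_le hi))⟩
  choose F hF1 hF2 using h1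
  let n : ℕ → ℕ := fun k => Nat.rec (F 0 0) (fun k m => F m (k + 1)) k
  refine ⟨n, strictMono_nat_of_lt_succ fun k => hF1 _ _, fun i => ?_⟩
  obtain ⟨j, rfl⟩ := ha i
  filter_upwards [eventually_ge_atTop j] with k hk
  cases k with
  | zero => exact hF2 0 0 j hk
  | succ k => exact hF2 _ (k + 1) j hk

/-! ### Van der Corput's lemma -/

lemma abs_div_one_add_sq_le {s b : ℝ} (hs : 0 ≤ s) : |s * b / (1 + s * b ^ 2)| ≤ √s / 2 := by
  have h1 : 0 < 1 + s * b ^ 2 := by positivity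
  rw [abs_div, abs_of_pos h1, div_le_iff₀ h1, abs_mul, abs_of_nonneg hs]
  have h2 : s = √s * √s := (Real.mul_self_sqrt hs).symm
  have h3 := sq_nonneg (√s * |b| - 1)
  have h4 : b ^ 2 = |b| ^ 2 := (sq_abs b).symm
  have h5 : s * |b| = √s * (√s * |b|) := by rw [← mul_assoc, ← h2]
  have h6 : s * b ^ 2 = (√s * |b|) ^ 2 := by rw [h4, mul_pow, Real.sq_sqrt hs]
  rw [h5, h6]
  have := Real.sqrt_nonneg s
  nlinarith

lemma norm_cexp_I_mul_ofReal (a : ℝ) : ‖Complex.exp (Complex.I * (a : ℂ))‖ = 1 := by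
  rw [mul_comm]; exact Complex.norm_exp_ofReal_mul_I a

/-- With $a=\varphi'$, the division by $a$ in the usual integration by parts is replaced by the
regularized quotient $q=sa/(1+sa^2)$, so no neighbourhood of the stationary point has to be cut out.
Adding $iqe^{i\varphi}$ to the primitive leaves the derivative $(1/(1+sa^2)+iq')e^{i\varphi}$, both
terms of which are controlled by $sa'/(1+sa^2)$, the derivative of $\sqrt s\arctan(\sqrt s\,a)$. -/
lemma norm_integral_cexp_le_of_le_deriv {φ a a' : ℝ → ℝ} {u v lam : ℝ} (huv : u ≤ v)
    (hlam : 0 < lam) (hφc : Continuous φ) (hφ : ∀ y ∈ Set.Icc u v, HasDerivAt φ (a y) y)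
    (ha : ∀ y ∈ Set.Icc u v, HasDerivAt a (a' y) y) (hlow : ∀ y ∈ Set.Icc u v, lam ≤ a' y) :
    ‖∫ y in u..v, Complex.exp (Complex.I * (φ y : ℂ))‖ ≤ 8 / √lam := by
  -- The scale $s=1/\lambda$ is the one for which $1\le s\,a'$.
  obtain ⟨s, hs, hsl⟩ : ∃ s : ℝ, 0 < s ∧ s = 1 / lam := ⟨_, by positivity, rfl⟩
  let q : ℝ → ℝ := fun y => s * a y / (1 + s * a y ^ 2)
  let q' : ℝ → ℝ := fun y => s * a' y * (1 - s * a y ^ 2) / (1 + s * a y ^ 2) ^ 2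
  let E : ℝ → ℂ := fun y => Complex.exp (Complex.I * (φ y : ℂ))
  have hE : Continuous E := by fun_prop
  have hpos : ∀ y, 0 < 1 + s * a y ^ 2 := fun y => by positivity
  have hq : ∀ y ∈ Set.Icc u v, HasDerivAt q (q' y) y := fun y hy => by
    have h := ((ha y hy).const_mul s).div (((ha y hy).pow 2).const_mul s |>.const_add 1)
      (hpos y).ne'
    refine h.congr_deriv ?_
    simp only [q']
    congr 1
    simp
    ring
  have hEd : ∀ y ∈ Set.Icc u v, HasDerivAt E (E y * (Complex.I * a y)) y := fun y hy => by
    exact ((hφ y hy).ofReal_comp.const_mul Complex.I).cexp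
  let F : ℝ → ℂ := fun y => (∫ z in u..y, E z) + Complex.I * ((q y : ℂ) * E y - (q u : ℂ) * E u)
  let F' : ℝ → ℂ := fun y => E y +
    Complex.I * ((q' y : ℂ) * E y + (q y : ℂ) * (E y * (Complex.I * a y)))
  have hF : ∀ y ∈ Set.Icc u v, HasDerivAt F (F' y) y := fun y hy => by
    have h1 : HasDerivAt (fun y => ∫ z in u..y, E z) (E y) y :=
      intervalIntegral.integral_hasDerivAt_right (hE.intervalIntegrable _ _)
        (hE.stronglyMeasurableAtFilter _ _) hE.continuousAt
    exact h1.add ((((hq y hy).ofReal_comp.mul (hEd y hy)).sub_const _).const_mul Complex.I)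
  -- The majorant is bounded by $2\pi\sqrt s$ whatever the interval; the two boundary terms add at
  -- most $\sqrt s$, and $2\pi+1<8$.
  let B : ℝ → ℝ := fun y => 2 * √s * (Real.arctan (√s * a y) - Real.arctan (√s * a u))
  let B' : ℝ → ℝ := fun y => 2 * (s * a' y / (1 + s * a y ^ 2))
  have hB : ∀ y ∈ Set.Icc u v, HasDerivAt B (B' y) y := fun y hy => by
    have h := ((((ha y hy).const_mul (√s)).arctan.sub_const (Real.arctan (√s * a u))).const_mul
      (2 * √s))
    refine h.congr_deriv ?_
    have h2 : (√s * a y) ^ 2 = s * a y ^ 2 := by rw [mul_pow, Real.sq_sqrt hs.le]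
    simp only [B']
    rw [h2]
    have h3 : s = √s * √s := (Real.mul_self_sqrt hs.le).symm
    have h4 : s * a' y = √s * √s * a' y := by rw [← h3]
    rw [h4]
    ring
  have hbound : ∀ y ∈ Set.Ico u v, ‖F' y‖ ≤ B' y := fun y hy => by
    have hy' := Set.Ico_subset_Icc_self hy
    have h1 : F' y = (((1 / (1 + s * a y ^ 2) : ℝ) : ℂ) + Complex.I * (q' y : ℂ)) * E y := by
      have h2 : ((1 / (1 + s * a y ^ 2) : ℝ) : ℂ) = 1 - (q y : ℂ) * a y := by
        have : (1 / (1 + s * a y ^ 2) : ℝ) = 1 - q y * a y := by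
          simp only [q]
          have := (hpos y).ne'
          field_simp
          ring
        rw [this]; push_cast; ring
      rw [h2]
      simp only [F']
      linear_combination (q y : ℂ) * E y * a y * Complex.I_mul_I
    have h3 : 0 ≤ a' y := hlam.le.trans (hlow y hy')
    have h4 : 1 / (1 + s * a y ^ 2) ≤ s * a' y / (1 + s * a y ^ 2) := by
      refine div_le_div_of_nonneg_right ?_ (hpos y).le
      calc (1 : ℝ) = s * lam := by rw [hsl]; field_simp
        _ ≤ s * a' y := mul_le_mul_of_nonneg_left (hlow y hy') hs.le
    have h5 : |q' y| ≤ s * a' y / (1 + s * a y ^ 2) := by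
      simp only [q']
      rw [abs_div, abs_of_pos (pow_pos (hpos y) 2), div_le_div_iff₀ (pow_pos (hpos y) 2) (hpos y),
        abs_mul, abs_of_nonneg (mul_nonneg hs.le h3)]
      have h6 : |1 - s * a y ^ 2| ≤ 1 + s * a y ^ 2 := by
        have : 0 ≤ s * a y ^ 2 := by positivity
        rw [abs_le]; constructor <;> linarith
      have h7 := mul_le_mul_of_nonneg_left h6 (mul_nonneg hs.le h3)
      have h8 := mul_le_mul_of_nonneg_right h7 (hpos y).le
      linarith [h8]
    rw [h1, norm_mul, norm_cexp_I_mul_ofReal, mul_one]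
    refine (norm_add_le _ _).trans ?_
    rw [norm_mul, Complex.norm_I, one_mul, Complex.norm_real, Complex.norm_real, Real.norm_eq_abs,
      Real.norm_eq_abs, abs_of_pos (div_pos one_pos (hpos y))]
    simp only [B']
    linarith
  have key := image_norm_le_of_norm_deriv_right_le_deriv_boundary' (f := F) (f' := F')
    (B := B) (B' := B') (a := u) (b := v)
    (fun y hy => (hF y hy).continuousAt.continuousWithinAt)
    (fun y hy => (hF y (Set.Ico_subset_Icc_self hy)).hasDerivWithinAt)
    (by simp [F, B])
    (fun y hy => (hB y hy).continuousAt.continuousWithinAt)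
    (fun y hy => (hB y (Set.Ico_subset_Icc_self hy)).hasDerivWithinAt) hbound
    (Set.right_mem_Icc.2 huv)
  have hBv : B v ≤ 2 * √s * Real.pi := by
    refine mul_le_mul_of_nonneg_left ?_ (by positivity)
    have h1 := Real.arctan_lt_pi_div_two (√s * a v)
    have h2 := Real.neg_pi_div_two_lt_arctan (√s * a u)
    linarith
  have hW : ∀ y, ‖(q y : ℂ) * E y‖ ≤ √s / 2 := fun y => by
    rw [norm_mul, norm_cexp_I_mul_ofReal, mul_one, Complex.norm_real]
    exact abs_div_one_add_sq_le hs.le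
  have hint : (∫ z in u..v, E z) = F v - Complex.I * ((q v : ℂ) * E v - (q u : ℂ) * E u) := by
    simp only [F]; ring
  have h1 : ‖∫ z in u..v, E z‖ ≤ 2 * √s * Real.pi + (√s / 2 + √s / 2) := by
    rw [hint]
    refine (norm_sub_le _ _).trans (add_le_add (key.trans hBv) ?_)
    rw [norm_mul, Complex.norm_I, one_mul]
    exact (norm_sub_le _ _).trans (add_le_add (hW v) (hW u))
  have h2 : 8 / √lam = 8 * √s := by rw [hsl, Real.sqrt_div zero_le_one, Real.sqrt_one]; ring
  rw [h2]
  have h3 := Real.pi_lt_d2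
  have h4 := Real.sqrt_nonneg s
  refine h1.trans ?_
  nlinarith

lemma norm_integral_cexp_neg (φ : ℝ → ℝ) (u v : ℝ) :
    ‖∫ y in u..v, Complex.exp (Complex.I * ((-φ y : ℝ) : ℂ))‖ =
      ‖∫ y in u..v, Complex.exp (Complex.I * (φ y : ℂ))‖ := by
  have : ∀ y, Complex.exp (Complex.I * ((-φ y : ℝ) : ℂ)) =
      (starRingEnd ℂ) (Complex.exp (Complex.I * (φ y : ℂ))) := fun y => by
    rw [← Complex.exp_conj]; simp
  simp_rw [this]
  rw [intervalIntegral.intervalIntegral_eq_integral_uIoc,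
    intervalIntegral.intervalIntegral_eq_integral_uIoc, integral_conj, norm_smul, norm_smul,
    RCLike.norm_conj]

/-- Integration by parts, with the oscillating factor integrated; boundary terms vanish with the
amplitude. -/
lemma norm_integral_mul_le_of_primitive {k k' V v : ℝ → ℂ} {N B : ℝ} (hN : 0 ≤ N)
    (hk : ∀ y ∈ Set.Icc (-N) N, HasDerivAt k (k' y) y)
    (hk' : ContinuousOn k' (Set.Icc (-N) N)) (hV : ∀ y, HasDerivAt V (v y) y) (hv : Continuous v)
    (h0 : k (-N) = 0) (h1 : k N = 0) (hB : ∀ y ∈ Set.Icc (-N) N, ‖V y‖ ≤ B) :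
    ‖∫ y in (-N)..N, v y * k y‖ ≤ B * ∫ y in (-N)..N, ‖k' y‖ := by
  have hNN : -N ≤ N := by linarith
  have hu : Set.uIcc (-N) N = Set.Icc (-N) N := Set.uIcc_of_le hNN
  have hki : IntervalIntegrable k' volume (-N) N := (hu ▸ hk').intervalIntegrable
  have h := intervalIntegral.integral_deriv_mul_eq_sub (u := V) (v := k) (u' := v)
    (v' := k') (a := -N) (b := N) (fun y _ => hV y) (fun y hy => hk y (hu ▸ hy))
    (hv.intervalIntegrable _ _) hki
  have hVc : Continuous V := continuous_iff_continuousAt.2 fun y => (hV y).continuousAt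
  have hkc : ContinuousOn k (Set.uIcc (-N) N) := fun y hy =>
    (hk y (hu ▸ hy)).continuousAt.continuousWithinAt
  rw [h0, h1, mul_zero, mul_zero, sub_zero, intervalIntegral.integral_add] at h
  · rw [eq_neg_of_add_eq_zero_left h, norm_neg]
    refine (intervalIntegral.norm_integral_le_integral_norm hNN).trans ?_
    rw [← intervalIntegral.integral_const_mul]
    refine intervalIntegral.integral_mono_on hNN ?_ ?_ fun y hy => ?_
    · exact ((hVc.continuousOn.mul (hu ▸ hk')).norm).intervalIntegrable
    · exact hki.norm.const_mul B
    · rw [norm_mul]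
      exact mul_le_mul_of_nonneg_right (hB y hy) (norm_nonneg _)
  · exact (hv.continuousOn.mul hkc).intervalIntegrable
  · exact (hVc.continuousOn.mul (hu ▸ hk')).intervalIntegrable

/-! ### The multipliers -/

/-- The phase function of the circle, rescaled. -/
noncomputable def phase (r y : ℝ) : ℝ := (√(1 - r ^ 2 * y ^ 2) - 1) / r ^ 2

/-- The unimodular multiplier with phase `x y + t ψ(y)`. -/
noncomputable def mult (r : ℝ) (p : ℝ × ℝ) (y : ℝ) : ℂ :=
  Complex.exp (Complex.I * ((p.1 * y + p.2 * phase r y : ℝ) : ℂ))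

/-- The limiting multiplier with phase `x y - t y² / 2`. -/
noncomputable def limMult (p : ℝ × ℝ) (y : ℝ) : ℂ :=
  Complex.exp (Complex.I * ((p.1 * y + p.2 * (-(y ^ 2 / 2)) : ℝ) : ℂ))

lemma continuous_phase (r : ℝ) : Continuous (phase r) := by unfold phase; fun_prop

lemma continuous_mult (r : ℝ) (p : ℝ × ℝ) : Continuous (mult r p) := by
  have := continuous_phase r
  unfold mult; fun_prop

lemma continuous_limMult (p : ℝ × ℝ) : Continuous (limMult p) := by unfold limMult; fun_prop

lemma norm_mult (r : ℝ) (p : ℝ × ℝ) (y : ℝ) : ‖mult r p y‖ = 1 := norm_cexp_I_mul_ofReal _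

lemma norm_limMult (p : ℝ × ℝ) (y : ℝ) : ‖limMult p y‖ = 1 := norm_cexp_I_mul_ofReal _

lemma mult_add (r : ℝ) (p q : ℝ × ℝ) (y : ℝ) : mult r (p + q) y = mult r p y * mult r q y := by
  unfold mult
  rw [← Complex.exp_add]
  congr 1
  push_cast [Prod.fst_add, Prod.snd_add]
  ring

lemma mult_zero (r y : ℝ) : mult r 0 y = 1 := by simp [mult]

lemma conj_mult (r : ℝ) (p : ℝ × ℝ) (y : ℝ) : (starRingEnd ℂ) (mult r p y) = mult r (-p) y := by
  unfold mult
  rw [← Complex.exp_conj]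
  congr 1
  simp
  ring

/-! ### Derivatives and oscillation of the circle phase -/

lemma one_sub_pos {r y N : ℝ} (hy : y ∈ Set.Icc (-N) N) (hr : 0 < r) (hrN : r * N ≤ 1 / 2) :
    3 / 4 ≤ 1 - r ^ 2 * y ^ 2 := by
  have h1 : |y| ≤ N := abs_le.2 hy
  have h2 : r * |y| ≤ 1 / 2 := (mul_le_mul_of_nonneg_left h1 hr.le).trans hrN
  have h3 : r ^ 2 * y ^ 2 = (r * |y|) ^ 2 := by rw [mul_pow, sq_abs]
  have h4 : 0 ≤ r * |y| := by positivity
  rw [h3]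
  nlinarith

lemma hasDerivAt_sqrt_chart {r y : ℝ} (h : 0 < 1 - r ^ 2 * y ^ 2) :
    HasDerivAt (fun y => √(1 - r ^ 2 * y ^ 2)) (-(r ^ 2 * y) / √(1 - r ^ 2 * y ^ 2)) y := by
  have h1 := ((((hasDerivAt_id y).pow 2).const_mul (r ^ 2)).const_sub 1).sqrt h.ne'
  refine h1.congr_deriv ?_
  have := (Real.sqrt_pos.2 h).ne'
  simp
  field_simp

lemma hasDerivAt_phase {r y : ℝ} (hr : 0 < r) (h : 0 < 1 - r ^ 2 * y ^ 2) :
    HasDerivAt (phase r) (-y / √(1 - r ^ 2 * y ^ 2)) y := by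
  refine (((hasDerivAt_sqrt_chart h).sub_const 1).div_const (r ^ 2)).congr_deriv ?_
  have := (Real.sqrt_pos.2 h).ne'
  field_simp

lemma hasDerivAt_deriv_phase {r y : ℝ} (h : 0 < 1 - r ^ 2 * y ^ 2) :
    HasDerivAt (fun y => -y / √(1 - r ^ 2 * y ^ 2))
      (-(1 / ((1 - r ^ 2 * y ^ 2) * √(1 - r ^ 2 * y ^ 2)))) y := by
  have h0 := (Real.sqrt_pos.2 h).ne'
  refine ((hasDerivAt_id y).neg.div (hasDerivAt_sqrt_chart h) h0).congr_deriv ?_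
  have h1 : √(1 - r ^ 2 * y ^ 2) ^ 2 = 1 - r ^ 2 * y ^ 2 := Real.sq_sqrt h.le
  rw [h1]
  field_simp
  rw [h1]
  simp only [Pi.neg_apply, id]
  ring

/-- The second derivative of the phase is $-t(1-r^2y^2)^{-3/2}$, of modulus at least $|t|$ for every
$r$, so van der Corput's lemma gives a bound uniform in $r$. The sign of $t$ is adjusted by complex
conjugation. -/
lemma norm_integral_mult_le {r N u v : ℝ} {p : ℝ × ℝ} (hr : 0 < r) (hrN : r * N ≤ 1 / 2)
    (huv : u ≤ v) (hu : -N ≤ u) (hv : v ≤ N) (hp : p.2 ≠ 0) :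
    ‖∫ y in u..v, mult r p y‖ ≤ 8 / √|p.2| := by
  have hc := continuous_phase r
  have hmem : ∀ y ∈ Set.Icc u v, 3 / 4 ≤ 1 - r ^ 2 * y ^ 2 := fun y hy =>
    one_sub_pos ⟨hu.trans hy.1, hy.2.trans hv⟩ hr hrN
  have hge : ∀ y ∈ Set.Icc u v, 1 ≤ 1 / ((1 - r ^ 2 * y ^ 2) * √(1 - r ^ 2 * y ^ 2)) :=
    fun y hy => by
    have h := hmem y hy
    have h1 : 1 - r ^ 2 * y ^ 2 ≤ 1 := by
      have : 0 ≤ r ^ 2 * y ^ 2 := by positivity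
      linarith
    have h2 : √(1 - r ^ 2 * y ^ 2) ≤ 1 := Real.sqrt_le_one.2 h1
    have h3 : 0 < √(1 - r ^ 2 * y ^ 2) := Real.sqrt_pos.2 (by linarith)
    rw [le_div_iff₀ (by nlinarith)]
    nlinarith
  have hφ : ∀ (q : ℝ × ℝ), ∀ y ∈ Set.Icc u v, HasDerivAt (fun y => q.1 * y + q.2 * phase r y)
      (q.1 + q.2 * (-y / √(1 - r ^ 2 * y ^ 2))) y := fun q y hy => by
    have h := hmem y hy
    have h1 := ((hasDerivAt_id y).const_mul q.1).add
      ((hasDerivAt_phase hr (by linarith : 0 < 1 - r ^ 2 * y ^ 2)).const_mul q.2)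
    rw [mul_one] at h1
    exact h1
  have ha : ∀ (q : ℝ × ℝ), ∀ y ∈ Set.Icc u v,
      HasDerivAt (fun y => q.1 + q.2 * (-y / √(1 - r ^ 2 * y ^ 2)))
      (q.2 * (-(1 / ((1 - r ^ 2 * y ^ 2) * √(1 - r ^ 2 * y ^ 2))))) y := fun q y hy => by
    have h := hmem y hy
    exact ((hasDerivAt_deriv_phase (by linarith : 0 < 1 - r ^ 2 * y ^ 2)).const_mul q.2).const_add _
  rcases lt_or_gt_of_ne hp with h | h
  · rw [abs_of_neg h]
    refine norm_integral_cexp_le_of_le_deriv huv (by linarith) (by fun_prop) (hφ p) (ha p)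
      fun y hy => ?_
    have := hge y hy
    nlinarith
  · rw [abs_of_pos h]
    have hneg : ∀ y, mult r p y =
        Complex.exp (Complex.I * ((-((-p).1 * y + (-p).2 * phase r y) : ℝ) : ℂ)) := fun y => by
      unfold mult; congr 3; simp; ring
    simp_rw [hneg]
    rw [norm_integral_cexp_neg fun y => (-p).1 * y + (-p).2 * phase r y]
    refine norm_integral_cexp_le_of_le_deriv huv h (by fun_prop) (hφ (-p)) (ha (-p))
      fun y hy => ?_
    have := hge y hy
    simp only [Prod.snd_neg]
    nlinarith

/-- When $|t|$ is large the decay comes from the curvature of the phase. When $|t|\le T$ the factor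
$e^{it\psi_r}$ has bounded derivative on the support and joins the amplitude, and one integration by
parts against $e^{ixy}$ gains $1/|x|$. -/
lemma tendsto_integral_mult_smooth {r : ℕ → ℝ} (hr : ∀ ν, 0 < r ν) (hr0 : Tendsto r atTop (𝓝 0))
    {k : ℝ → ℂ} (hk : ContDiff ℝ 1 k) (hks : HasCompactSupport k) :
    Tendsto (fun a : ℕ × (ℝ × ℝ) => ∫ y, mult (r a.1) a.2 y * k y)
      (atTop ×ˢ Bornology.cobounded (ℝ × ℝ)) (𝓝 0) := by
  obtain ⟨N, hN, hkN⟩ : ∃ N : ℝ, 0 < N ∧ ∀ y, N ≤ |y| → k y = 0 := by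
    obtain ⟨N, hN⟩ := hks.isCompact.isBounded.subset_closedBall (0 : ℝ)
    -- Enlarging by one makes `k` vanish at the endpoints $\pm N$ themselves, as the integrations by
    -- parts require.
    refine ⟨|N| + 1, by positivity, fun y hy => image_eq_zero_of_notMem_tsupport fun h => ?_⟩
    have h1 := hN h
    rw [mem_closedBall_zero_iff, Real.norm_eq_abs] at h1
    linarith [le_abs_self N]
  have hint : ∀ a : ℕ × (ℝ × ℝ), ∫ y, mult (r a.1) a.2 y * k y =
      ∫ y in (-N)..N, mult (r a.1) a.2 y * k y := fun a => by
    rw [intervalIntegral.integral_of_le (by linarith), setIntegral_eq_integral_of_forall_compl_eq_zero]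
    intro y hy
    rw [hkN y, mul_zero]
    by_contra h
    rw [not_le, abs_lt] at h
    exact hy ⟨h.1, h.2.le⟩
  have hd : ∀ y, HasDerivAt k (deriv k y) y := fun y =>
    (hk.differentiable one_ne_zero y).hasDerivAt
  have hdc : Continuous (deriv k) := hk.continuous_deriv le_rfl
  have hk0 : k (-N) = 0 := hkN _ (by rw [abs_neg, abs_of_pos hN])
  have hk1 : k N = 0 := hkN _ (by rw [abs_of_pos hN])
  obtain ⟨K, hK⟩ : ∃ K, ∀ y ∈ Set.Icc (-N) N, ‖k y‖ ≤ K :=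
    (isCompact_Icc.exists_bound_of_continuousOn hk.continuous.continuousOn)
  obtain ⟨K', hK'⟩ : ∃ K, ∀ y ∈ Set.Icc (-N) N, ‖deriv k y‖ ≤ K :=
    (isCompact_Icc.exists_bound_of_continuousOn hdc.continuousOn)
  have hK0 : 0 ≤ K := (norm_nonneg _).trans (hK N ⟨by linarith, le_rfl⟩)
  have hK0' : 0 ≤ K' := (norm_nonneg _).trans (hK' N ⟨by linarith, le_rfl⟩)
  have hD : ∫ y in (-N)..N, ‖deriv k y‖ ≤ 2 * N * K' := by
    have h := intervalIntegral.integral_mono_on (by linarith : -N ≤ N)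
      (hdc.norm.intervalIntegrable (μ := volume) _ _) (intervalIntegrable_const (c := K')) hK'
    rw [intervalIntegral.integral_const, smul_eq_mul] at h
    linarith
  -- large times
  have hlarge : ∀ (r' : ℝ) (p : ℝ × ℝ), 0 < r' → r' * N ≤ 1 / 2 → p.2 ≠ 0 →
      ‖∫ y in (-N)..N, mult r' p y * k y‖ ≤ 8 / √|p.2| * (2 * N * K') := fun r' p h1 h2 h3 => by
    have hm := continuous_mult r' p
    refine (norm_integral_mul_le_of_primitive hN.le (fun y _ => hd y) hdc.continuousOn
      (V := fun y => ∫ z in (-N)..y, mult r' p z) (fun y => ?_) hm hk0 hk1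
      (B := 8 / √|p.2|) fun y hy => ?_).trans (mul_le_mul_of_nonneg_left hD (by positivity))
    · exact intervalIntegral.integral_hasDerivAt_right (hm.intervalIntegrable _ _)
        (hm.stronglyMeasurableAtFilter _ _) hm.continuousAt
    · exact norm_integral_mult_le h1 h2 hy.1 le_rfl hy.2 h3
  -- bounded times
  have hsmall : ∀ (r' T : ℝ) (p : ℝ × ℝ), 0 < r' → r' * N ≤ 1 / 2 → p.1 ≠ 0 → |p.2| ≤ T →
      ‖∫ y in (-N)..N, mult r' p y * k y‖ ≤ 1 / |p.1| * (2 * N * (K' + T * (2 * N) * K)) := by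
    intro r' T p h1 h2 h3 hT
    let E : ℝ → ℂ := fun y => Complex.exp (Complex.I * ((p.1 * y : ℝ) : ℂ))
    let G : ℝ → ℂ := fun y => Complex.exp (Complex.I * ((p.2 * phase r' y : ℝ) : ℂ))
    let a : ℝ → ℝ := fun y => p.2 * (-y / √(1 - r' ^ 2 * y ^ 2))
    have hG : ∀ y ∈ Set.Icc (-N) N, HasDerivAt G (G y * (Complex.I * (a y : ℂ))) y := by
      intro y hy
      have h := one_sub_pos hy h1 h2
      exact (((hasDerivAt_phase h1 (by linarith : 0 < 1 - r' ^ 2 * y ^ 2)).const_mul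
        p.2).ofReal_comp.const_mul Complex.I).cexp
    have hGc : Continuous G := by
      have := continuous_phase r'
      fun_prop
    have hac : ContinuousOn a (Set.Icc (-N) N) := by
      intro y hy
      have h := one_sub_pos hy h1 h2
      exact ((hasDerivAt_deriv_phase (by linarith : 0 < 1 - r' ^ 2 * y ^ 2)).const_mul
        p.2).continuousAt.continuousWithinAt
    have hEd : ∀ y, HasDerivAt (fun y => E y / (Complex.I * p.1)) (E y) y := fun y => by
      have h := ((((hasDerivAt_id y).const_mul p.1).ofReal_comp.const_mul
        Complex.I).cexp).div_const (Complex.I * p.1)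
      refine h.congr_deriv ?_
      have : (Complex.I * (p.1 : ℂ)) ≠ 0 := by simp [h3]
      simp only [id, mul_one]
      rw [mul_div_assoc, div_self this, mul_one]
    have heq : ∀ y, mult r' p y * k y = E y * (G y * k y) := fun y => by
      simp only [mult, E, G]
      rw [← mul_assoc, ← Complex.exp_add]
      congr 2
      push_cast
      ring
    simp_rw [heq]
    have hkd : ContinuousOn (fun y => G y * (Complex.I * (a y : ℂ)) * k y + G y * deriv k y)
        (Set.Icc (-N) N) := by
      refine ContinuousOn.add (ContinuousOn.mul (hGc.continuousOn.mul (continuousOn_const.mul ?_))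
        hk.continuous.continuousOn) (hGc.mul hdc).continuousOn
      exact Complex.continuous_ofReal.comp_continuousOn hac
    refine (norm_integral_mul_le_of_primitive hN.le (fun y hy => (hG y hy).mul (hd y)) hkd hEd
      (by fun_prop) (by simp [hk0]) (by simp [hk1]) (B := 1 / |p.1|) fun y _ => ?_).trans
      (mul_le_mul_of_nonneg_left ?_ (by positivity))
    · rw [norm_div, norm_cexp_I_mul_ofReal, norm_mul, Complex.norm_I, one_mul, Complex.norm_real,
        Real.norm_eq_abs]
    · have hb : ∀ y ∈ Set.Icc (-N) N, ‖G y * (Complex.I * (a y : ℂ)) * k y + G y * deriv k y‖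
          ≤ K' + T * (2 * N) * K := by
        intro y hy
        have hg1 : ‖G y‖ = 1 := norm_cexp_I_mul_ofReal _
        have h := one_sub_pos hy h1 h2
        have h4 : 1 / 2 ≤ √(1 - r' ^ 2 * y ^ 2) := Real.le_sqrt_of_sq_le (by linarith)
        have h5 : |a y| ≤ T * (2 * N) := by
          simp only [a]
          rw [abs_mul, abs_div, abs_neg, abs_of_pos (by linarith : 0 < √(1 - r' ^ 2 * y ^ 2))]
          refine mul_le_mul hT ?_ (by positivity) ((abs_nonneg _).trans hT)
          rw [div_le_iff₀ (by linarith)]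
          have := abs_le.2 hy
          nlinarith
        refine (norm_add_le _ _).trans ?_
        rw [norm_mul, norm_mul, norm_mul, norm_mul, hg1, Complex.norm_I, one_mul, one_mul, one_mul,
          Complex.norm_real, Real.norm_eq_abs]
        have h6 := mul_le_mul h5 (hK y hy) (norm_nonneg _)
          (mul_nonneg ((abs_nonneg _).trans hT) (by positivity))
        linarith [hK' y hy]
      have h := intervalIntegral.integral_mono_on (by linarith : -N ≤ N)
        (ContinuousOn.intervalIntegrable (μ := volume) (by rw [Set.uIcc_of_le (by linarith)]; exact hkd.norm))
        (intervalIntegrable_const (c := K' + T * (2 * N) * K)) hb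
      rw [intervalIntegral.integral_const, smul_eq_mul] at h
      refine h.trans (le_of_eq (by ring))
  simp_rw [hint]
  rw [Metric.tendsto_nhds]
  intro ε hε
  obtain ⟨T, hT0, hT⟩ : ∃ T : ℝ, 0 < T ∧ ∀ t : ℝ, T ≤ |t| → 8 / √|t| * (2 * N * K') < ε := by
    have h1 : Tendsto (fun t : ℝ => 8 / √t * (2 * N * K')) atTop (𝓝 (0 * (2 * N * K'))) :=
      ((tendsto_const_nhds.div_atTop Real.tendsto_sqrt_atTop)).mul_const _
    rw [zero_mul] at h1
    obtain ⟨T, hT⟩ := eventually_atTop.1 ((tendsto_order.1 h1).2 ε hε)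
    exact ⟨max T 1, by positivity, fun t ht => hT _ ((le_max_left _ _).trans ht)⟩
  -- The threshold for $|x|$ is chosen after $T$, since the bounded-time estimate grows with $T$.
  obtain ⟨X, hX0, hX⟩ : ∃ X : ℝ, 0 < X ∧
      ∀ x : ℝ, X ≤ |x| → 1 / |x| * (2 * N * (K' + T * (2 * N) * K)) < ε := by
    have h1 : Tendsto (fun t : ℝ => 1 / t * (2 * N * (K' + T * (2 * N) * K))) atTop
        (𝓝 (0 * (2 * N * (K' + T * (2 * N) * K)))) :=
      ((tendsto_const_nhds.div_atTop tendsto_id)).mul_const _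
    rw [zero_mul] at h1
    obtain ⟨X, hX⟩ := eventually_atTop.1 ((tendsto_order.1 h1).2 ε hε)
    exact ⟨max X 1, by positivity, fun t ht => hX _ ((le_max_left _ _).trans ht)⟩
  have hrN : ∀ᶠ ν in atTop, r ν * N ≤ 1 / 2 := by
    have h1 := hr0.mul_const N
    rw [zero_mul] at h1
    exact ((tendsto_order.1 h1).2 (1 / 2) (by norm_num)).mono fun ν h => h.le
  have hp : ∀ᶠ p in Bornology.cobounded (ℝ × ℝ), max T X ≤ ‖p‖ :=
    tendsto_norm_cobounded_atTop.eventually_ge_atTop _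
  filter_upwards [hrN.prod_mk hp] with a ha
  rw [dist_zero_right]
  by_cases h : T ≤ |a.2.2|
  · exact (hlarge _ _ (hr _) ha.1 (abs_pos.1 (hT0.trans_le h))).trans_lt (hT _ h)
  · have h1 : X ≤ |a.2.1| := by
      have h2 := ha.2
      rw [Prod.norm_def, le_max_iff, max_le_iff, max_le_iff] at h2
      rcases h2 with h2 | h2
      · exact h2.2
      · exact absurd h2.1 h
    exact (hsmall _ T _ (hr _) ha.1 (abs_pos.1 (hX0.trans_le h1)) (not_le.1 h).le).trans_lt (hX _ h1)

/-! ### Multiplication operators on `L²(ℝ)` -/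

/-- Smooth compactly supported functions are dense in $L^1$, and the multipliers are unimodular, so
the approximation error is uniform in the parameters. -/
lemma tendsto_integral_mult {r : ℕ → ℝ} (hr : ∀ ν, 0 < r ν) (hr0 : Tendsto r atTop (𝓝 0))
    {k : ℝ → ℂ} (hk : Integrable k) :
    Tendsto (fun a : ℕ × (ℝ × ℝ) => ∫ y, mult (r a.1) a.2 y * k y)
      (atTop ×ˢ Bornology.cobounded (ℝ × ℝ)) (𝓝 0) := by
  rw [Metric.tendsto_nhds]
  intro ε hε
  obtain ⟨k₁, hs, hc, hle⟩ := (memLp_one_iff_integrable.2 hk).exist_eLpNorm_sub_le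
    ENNReal.one_ne_top le_rfl (half_pos hε)
  have hk₁ : Integrable k₁ := hc.continuous.integrable_of_hasCompactSupport hs
  have h1 : ∫ y, ‖k y - k₁ y‖ ≤ ε / 2 := by
    rw [eLpNorm_one_eq_lintegral_enorm] at hle
    have h := integral_norm_eq_lintegral_enorm (hk.sub hk₁).aestronglyMeasurable
    simp only [Pi.sub_apply] at h hle
    rw [h]
    exact ENNReal.toReal_le_of_le_ofReal (half_pos hε).le hle
  have hmul : ∀ (a : ℕ × (ℝ × ℝ)) {f : ℝ → ℂ}, Integrable f →
      Integrable fun y => mult (r a.1) a.2 y * f y := fun a f hf => by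
    exact hf.bdd_mul (c := 1) (continuous_mult _ _).aestronglyMeasurable
      (Eventually.of_forall fun y => (norm_mult _ _ _).le)
  filter_upwards [(Metric.tendsto_nhds.1 (tendsto_integral_mult_smooth hr hr0
    (hc.of_le (by exact_mod_cast le_top)) hs)) (ε / 2) (half_pos hε)] with a ha
  rw [dist_zero_right] at ha ⊢
  have h2 : ∫ y, mult (r a.1) a.2 y * k y = (∫ y, mult (r a.1) a.2 y * k₁ y) +
      ∫ y, mult (r a.1) a.2 y * (k y - k₁ y) := by
    have hsub : Integrable fun y => mult (r a.1) a.2 y * (k y - k₁ y) := hmul a (hk.sub hk₁)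
    rw [← integral_add (hmul a hk₁) hsub]
    refine integral_congr_ae (Eventually.of_forall fun y => ?_)
    simp only
    ring
  rw [h2]
  refine (norm_add_le _ _).trans_lt ?_
  have h3 : ‖∫ y, mult (r a.1) a.2 y * (k y - k₁ y)‖ ≤ ε / 2 := by
    refine (norm_integral_le_integral_norm _).trans (le_of_eq_of_le ?_ h1)
    refine integral_congr_ae (Eventually.of_forall fun y => ?_)
    simp only
    rw [norm_mul, norm_mult, one_mul]
  linarith

/-- The Hilbert space `L²(ℝ; ℂ)`. -/
abbrev L2 : Type := Lp ℂ 2 (volume : Measure ℝ)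

lemma memLp_mul {m : ℝ → ℂ} (hm : Measurable m) (hb : ∀ y, ‖m y‖ ≤ 1) {f : ℝ → ℂ}
    (hf : MemLp f 2 volume) : MemLp (fun y => m y * f y) 2 volume :=
  hf.of_le (hm.aestronglyMeasurable.mul hf.aestronglyMeasurable) (Eventually.of_forall fun y => by
    rw [norm_mul]; exact mul_le_of_le_one_left (norm_nonneg _) (hb y))

/-- Multiplication by a function bounded by one. -/
noncomputable def mulOp (m : ℝ → ℂ) (hm : Measurable m) (hb : ∀ y, ‖m y‖ ≤ 1) : L2 →L[ℂ] L2 :=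
  LinearMap.mkContinuous
    { toFun := fun f => (memLp_mul hm hb (Lp.memLp f)).toLp _
      map_add' := fun f g => by
        rw [← MemLp.toLp_add]
        refine MemLp.toLp_congr _ _ ?_
        filter_upwards [Lp.coeFn_add f g] with y hy
        rw [hy]
        simp only [Pi.add_apply]
        ring
      map_smul' := fun c f => by
        rw [RingHom.id_apply, ← MemLp.toLp_const_smul]
        refine MemLp.toLp_congr _ _ ?_
        filter_upwards [Lp.coeFn_smul c f] with y hy
        rw [hy]
        simp only [Pi.smul_apply, smul_eq_mul]
        ring } 1 fun f => by
    rw [one_mul]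
    refine Lp.norm_le_norm_of_ae_le ?_
    filter_upwards [(memLp_mul hm hb (Lp.memLp f)).coeFn_toLp] with y hy
    change ‖((memLp_mul hm hb (Lp.memLp f)).toLp _ : ℝ → ℂ) y‖ ≤ _
    rw [hy, norm_mul]
    exact mul_le_of_le_one_left (norm_nonneg _) (hb y)

lemma coeFn_mulOp {m : ℝ → ℂ} (hm : Measurable m) (hb : ∀ y, ‖m y‖ ≤ 1) (f : L2) :
    mulOp m hm hb f =ᵐ[volume] fun y => m y * f y :=
  (memLp_mul hm hb (Lp.memLp f)).coeFn_toLp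

lemma mulOp_mulOp {m m' : ℝ → ℂ} (hm : Measurable m) (hb : ∀ y, ‖m y‖ ≤ 1)
    (hm' : Measurable m') (hb' : ∀ y, ‖m' y‖ ≤ 1) (f : L2) {g : L2}
    (hg : g =ᵐ[volume] fun y => m y * (m' y * f y)) :
    mulOp m hm hb (mulOp m' hm' hb' f) = g := by
  refine Lp.ext ?_
  filter_upwards [coeFn_mulOp hm hb (mulOp m' hm' hb' f), coeFn_mulOp hm' hb' f, hg] with y h1 h2 h3
  rw [h1, h2, h3]

lemma norm_sq_eq_integral (f : L2) : ‖f‖ ^ 2 = ∫ y, ‖f y‖ ^ 2 := by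
  have h1 : ((‖f‖ ^ 2 : ℝ) : ℂ) = inner ℂ f f := by
    rw [inner_self_eq_norm_sq_to_K]; norm_cast
  rw [L2.inner_def] at h1
  have h2 : ∀ y, inner ℂ (f y) (f y) = ((‖f y‖ ^ 2 : ℝ) : ℂ) := fun y => by
    rw [inner_self_eq_norm_sq_to_K]; norm_cast
  simp_rw [h2] at h1
  exact Complex.ofReal_injective (h1.trans integral_ofReal)

lemma integrable_norm_sq (f : L2) : Integrable fun y => ‖f y‖ ^ 2 := by
  simpa using (Lp.memLp f).integrable_norm_pow (by norm_num)

lemma norm_mulOp_of_norm_one {m : ℝ → ℂ} (hm : Measurable m) (hb : ∀ y, ‖m y‖ = 1) (f : L2) :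
    ‖mulOp m hm (fun y => (hb y).le) f‖ = ‖f‖ := by
  rw [← sq_eq_sq₀ (norm_nonneg _) (norm_nonneg _), norm_sq_eq_integral, norm_sq_eq_integral]
  refine integral_congr_ae ?_
  filter_upwards [coeFn_mulOp hm (fun y => (hb y).le) f] with y hy
  rw [hy, norm_mul, hb, one_mul]

lemma inner_mulOp {m : ℝ → ℂ} (hm : Measurable m) (hb : ∀ y, ‖m y‖ ≤ 1) (f g : L2) :
    inner ℂ (mulOp m hm hb f) g = ∫ y, (starRingEnd ℂ) (m y) * inner ℂ (f y) (g y) := by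
  rw [L2.inner_def]
  refine integral_congr_ae ?_
  filter_upwards [coeFn_mulOp hm hb f] with y hy
  rw [hy, RCLike.inner_apply, RCLike.inner_apply, map_mul]
  ring

lemma tendsto_phase {r : ℕ → ℝ} (hr : ∀ ν, 0 < r ν) (hr0 : Tendsto r atTop (𝓝 0)) (y : ℝ) :
    Tendsto (fun ν => phase (r ν) y) atTop (𝓝 (-(y ^ 2 / 2))) := by
  -- Rationalizing the numerator removes the division by $r_\nu^2$.
  have h1 : Tendsto (fun ν => -(y ^ 2 / (√(1 - r ν ^ 2 * y ^ 2) + 1))) atTop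
      (𝓝 (-(y ^ 2 / (√(1 - 0 ^ 2 * y ^ 2) + 1)))) := by
    refine (tendsto_const_nhds.div ?_ ?_).neg
    · exact ((((hr0.pow 2).mul_const _).const_sub 1).sqrt).add_const 1
    · positivity
  have h2 : -(y ^ 2 / (√(1 - 0 ^ 2 * y ^ 2) + 1)) = -(y ^ 2 / 2) := by norm_num
  rw [h2] at h1
  refine h1.congr' ?_
  have h3 : ∀ᶠ ν in atTop, r ν ^ 2 * y ^ 2 < 1 := by
    have := (hr0.pow 2).mul_const (y ^ 2)
    rw [zero_pow two_ne_zero, zero_mul] at this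
    exact (tendsto_order.1 this).2 1 one_pos
  filter_upwards [h3] with ν hν
  unfold phase
  have h4 : √(1 - r ν ^ 2 * y ^ 2) ^ 2 = 1 - r ν ^ 2 * y ^ 2 := Real.sq_sqrt (by linarith)
  have h5 := (hr ν).ne'
  have h6 : √(1 - r ν ^ 2 * y ^ 2) + 1 ≠ 0 := by positivity
  rw [eq_comm, div_eq_iff (pow_ne_zero 2 h5), ← neg_div, div_mul_eq_mul_div, eq_div_iff h6]
  linear_combination h4

/-- Dominated convergence, with majorant $4|f|^2$, along the joint filter in the index and the
parameters. -/
lemma tendsto_mulOp_mult {r : ℕ → ℝ} (hr : ∀ ν, 0 < r ν) (hr0 : Tendsto r atTop (𝓝 0))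
    (c : ℝ × ℝ) (f : L2) :
    Tendsto (fun a : ℕ × (ℝ × ℝ) => mulOp (mult (r a.1) a.2) (continuous_mult _ _).measurable
      (fun y => (norm_mult _ _ y).le) f) (atTop ×ˢ 𝓝 c)
      (𝓝 (mulOp (limMult c) (continuous_limMult c).measurable (fun y => (norm_limMult c y).le) f)) := by
  rw [tendsto_iff_norm_sub_tendsto_zero]
  have key : Tendsto (fun a : ℕ × (ℝ × ℝ) => ∫ y, ‖(mult (r a.1) a.2 y - limMult c y) * f y‖ ^ 2)
      (atTop ×ˢ 𝓝 c) (𝓝 (∫ _ : ℝ, (0 : ℝ))) := by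
    refine tendsto_integral_filter_of_dominated_convergence (fun y => 4 * ‖f y‖ ^ 2) ?_ ?_ ?_ ?_
    · refine Eventually.of_forall fun a => ?_
      have h1 := (continuous_mult (r a.1) a.2).sub (continuous_limMult c)
      exact ((h1.aestronglyMeasurable.mul (Lp.aestronglyMeasurable f)).norm.pow 2)
    · refine Eventually.of_forall fun a => Eventually.of_forall fun y => ?_
      have h1 : ‖mult (r a.1) a.2 y - limMult c y‖ ≤ 2 := by
        refine (norm_sub_le _ _).trans ?_
        rw [norm_mult, norm_limMult]; norm_num
      rw [norm_pow, norm_norm, norm_mul, mul_pow]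
      have h2 : ‖mult (r a.1) a.2 y - limMult c y‖ ^ 2 ≤ 4 := by
        have := norm_nonneg (mult (r a.1) a.2 y - limMult c y)
        nlinarith
      exact mul_le_mul_of_nonneg_right h2 (sq_nonneg _)
    · exact (integrable_norm_sq f).const_mul 4
    · refine Eventually.of_forall fun y => ?_
      have h1 : Tendsto (fun a : ℕ × (ℝ × ℝ) => a.2.1 * y + a.2.2 * phase (r a.1) y)
          (atTop ×ˢ 𝓝 c) (𝓝 (c.1 * y + c.2 * (-(y ^ 2 / 2)))) := by
        have hf : Tendsto (fun a : ℕ × (ℝ × ℝ) => a.2) (atTop ×ˢ 𝓝 c) (𝓝 c) := tendsto_snd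
        exact (((continuous_fst.tendsto c).comp hf).mul_const y).add
          (((continuous_snd.tendsto c).comp hf).mul ((tendsto_phase hr hr0 y).comp tendsto_fst))
      have h2 : Tendsto (fun a : ℕ × (ℝ × ℝ) => mult (r a.1) a.2 y) (atTop ×ˢ 𝓝 c)
          (𝓝 (limMult c y)) :=
        ((by fun_prop : Continuous fun s : ℝ => Complex.exp (Complex.I * (s : ℂ))).tendsto _).comp h1
      have h3 := (((h2.sub_const (limMult c y)).mul_const (f y)).norm).pow 2
      simpa using h3
  rw [integral_zero] at key
  have key2 := key.sqrt
  rw [Real.sqrt_zero] at key2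
  refine key2.congr fun a => ?_
  rw [← Real.sqrt_sq (norm_nonneg _), norm_sq_eq_integral]
  congr 1
  refine integral_congr_ae ?_
  filter_upwards [Lp.coeFn_sub (mulOp (mult (r a.1) a.2) (continuous_mult _ _).measurable
      (fun y => (norm_mult _ _ y).le) f) (mulOp (limMult c) (continuous_limMult c).measurable
      (fun y => (norm_limMult c y).le) f), coeFn_mulOp (continuous_mult (r a.1) a.2).measurable
      (fun y => (norm_mult _ _ y).le) f, coeFn_mulOp (continuous_limMult c).measurable
      (fun y => (norm_limMult c y).le) f] with y h1 h2 h3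
  rw [h1, Pi.sub_apply, h2, h3, sub_mul]

/-- The modulation operators of the rescaled circle form a unitary family. -/
noncomputable def modulations (r : ℕ → ℝ) (hr : ∀ ν, 0 < r ν) (hr0 : Tendsto r atTop (𝓝 0)) :
    UnitaryFamily L2 where
  act ν p := mulOp (mult (r ν) p) (continuous_mult _ _).measurable (fun y => (norm_mult _ _ y).le)
  act_zero ν f := by
    refine Lp.ext ?_
    filter_upwards [coeFn_mulOp (continuous_mult (r ν) 0).measurable
      (fun y => (norm_mult _ _ y).le) f] with y hy
    rw [hy, mult_zero, one_mul]
  act_add ν p q f := by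
    refine (mulOp_mulOp _ _ _ _ f ?_).symm
    filter_upwards [coeFn_mulOp (continuous_mult (r ν) (p + q)).measurable
      (fun y => (norm_mult _ _ y).le) f] with y hy
    rw [hy, mult_add, mul_assoc]
  norm_act ν p f := norm_mulOp_of_norm_one _ (norm_mult _ _) f
  lim c f := mulOp (limMult c) (continuous_limMult c).measurable (fun y => (norm_limMult c y).le) f
  tendsto_lim c f := tendsto_mulOp_mult hr hr0 c f
  tendsto_zero f g := by
    -- The inner product conjugates its first argument, which reverses the sign of the parameters;
    -- reflection preserves divergence to infinity.
    have h1 : Tendsto (fun a : ℕ × (ℝ × ℝ) => (a.1, -a.2))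
        (atTop ×ˢ Bornology.cobounded (ℝ × ℝ)) (atTop ×ˢ Bornology.cobounded (ℝ × ℝ)) := by
      refine Tendsto.prodMk tendsto_fst ?_
      refine tendsto_norm_atTop_iff_cobounded.1 ?_
      simp only [norm_neg]
      exact tendsto_norm_cobounded_atTop.comp tendsto_snd
    refine ((tendsto_integral_mult hr hr0 (L2.integrable_inner (𝕜 := ℂ) f g)).comp h1).congr
      fun a => ?_
    rw [inner_mulOp]
    simp only [Function.comp, conj_mult]

/-- Restriction to a measurable set. -/
noncomputable def restrictOp (A : Set ℝ) (hA : MeasurableSet A) : L2 →L[ℂ] L2 :=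
  mulOp (A.indicator fun _ => 1) (measurable_const.indicator hA) fun y => by
    by_cases h : y ∈ A <;> simp [h]

lemma coeFn_restrictOp {A : Set ℝ} (hA : MeasurableSet A) (f : L2) :
    restrictOp A hA f =ᵐ[volume] A.indicator f := by
  filter_upwards [coeFn_mulOp (m := A.indicator fun _ => 1) (measurable_const.indicator hA)
    (fun y => by by_cases h : y ∈ A <;> simp [h]) f] with y hy
  rw [restrictOp, hy]
  by_cases h : y ∈ A <;> simp [h]

/-- Modulation and restriction are both multiplication operators. This is what transfers tail and
short-interval bounds from $g_\nu$ to the remainders. -/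
lemma isCommutingProj_restrictOp {r : ℕ → ℝ} (hr : ∀ ν, 0 < r ν) (hr0 : Tendsto r atTop (𝓝 0))
    {A : Set ℝ} (hA : MeasurableSet A) :
    (modulations r hr hr0).IsCommutingProj (restrictOp A hA) where
  symm f g := by
    rw [L2.inner_def, L2.inner_def]
    refine integral_congr_ae ?_
    filter_upwards [coeFn_restrictOp hA f, coeFn_restrictOp hA g] with y h1 h2
    rw [h1, h2]
    by_cases h : y ∈ A <;> simp [h]
  idem f := by
    refine Lp.ext ?_
    filter_upwards [coeFn_restrictOp hA f, coeFn_restrictOp hA (restrictOp A hA f)] with y h1 h2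
    rw [h2]
    by_cases h : y ∈ A <;> simp [h, h1]
  comm ν p f := by
    refine Lp.ext ?_
    filter_upwards [coeFn_restrictOp hA f,
      coeFn_restrictOp hA ((modulations r hr hr0).act ν p f),
      coeFn_mulOp (continuous_mult (r ν) p).measurable (fun y => (norm_mult _ _ y).le) f,
      coeFn_mulOp (continuous_mult (r ν) p).measurable (fun y => (norm_mult _ _ y).le)
        (restrictOp A hA f)] with y h1 h2 h3 h4
    rw [h2]
    refine Eq.trans ?_ h4.symm
    rw [h1]
    by_cases h : y ∈ A
    · simp only [Set.indicator_of_mem h]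
      exact h3
    · simp [h]

/-! ### Oscillatory integrals with respect to measures of bounded density -/

/-- The oscillatory integral of `H` with phases `p · Φ`. -/
noncomputable def oscInt {Y : Type*} [MeasurableSpace Y] (μ : Measure Y) (Φ : Y → ℝ × ℝ)
    (H : Y → ℂ) (p : ℝ × ℝ) : ℂ :=
  ∫ y, Complex.exp (Complex.I * ((p.1 * (Φ y).1 + p.2 * (Φ y).2 : ℝ) : ℂ)) * H y ∂μ

/-- The Fourier transform of a Gaussian. -/
noncomputable def gaussKernel (ε a : ℝ) : ℝ := √(Real.pi / ε) * Real.exp (-(a ^ 2 / (4 * ε)))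

lemma integral_cexp_gauss {ε : ℝ} (hε : 0 < ε) (a : ℝ) :
    ∫ x : ℝ, Complex.exp (Complex.I * ((x * a : ℝ) : ℂ)) * ((Real.exp (-ε * x ^ 2) : ℝ) : ℂ) =
      (gaussKernel ε a : ℂ) := by
  have h := fourierIntegral_gaussian (b := (ε : ℂ)) (by simpa using hε) (a : ℂ)
  have h1 : ∀ x : ℝ, Complex.exp (Complex.I * ((x * a : ℝ) : ℂ)) *
      ((Real.exp (-ε * x ^ 2) : ℝ) : ℂ) =
      Complex.exp (Complex.I * (a : ℂ) * (x : ℂ)) * Complex.exp (-(ε : ℂ) * (x : ℂ) ^ 2) :=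
    fun x => by push_cast; congr 2; ring
  simp_rw [h1]
  rw [h, gaussKernel]
  push_cast
  have h2 : ((Real.pi : ℂ) / (ε : ℂ)) ^ (1 / 2 : ℂ) = ((√(Real.pi / ε) : ℝ) : ℂ) := by
    rw [Real.sqrt_eq_rpow, Complex.ofReal_cpow (by positivity)]
    push_cast
    rfl
  rw [h2]
  congr 2
  ring

lemma gaussKernel_nonneg (ε a : ℝ) : 0 ≤ gaussKernel ε a := by unfold gaussKernel; positivity

lemma continuous_gaussKernel (ε : ℝ) : Continuous (gaussKernel ε) := by
  unfold gaussKernel; fun_prop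

/-- The mass is independent of $\varepsilon$, which keeps the later bounds uniform as
$\varepsilon\to0$. -/
lemma lintegral_gaussKernel {ε : ℝ} (hε : 0 < ε) :
    ∫⁻ a, ENNReal.ofReal (gaussKernel ε a) = ENNReal.ofReal (2 * Real.pi) := by
  have h1 : ∀ a, gaussKernel ε a = √(Real.pi / ε) * Real.exp (-(1 / (4 * ε)) * a ^ 2) := fun a => by
    unfold gaussKernel; congr 2; ring
  have hi : Integrable (gaussKernel ε) := by
    simp_rw [funext h1]
    exact (integrable_exp_neg_mul_sq (by positivity)).const_mul _
  rw [← ofReal_integral_eq_lintegral_ofReal hi (Eventually.of_forall (gaussKernel_nonneg ε))]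
  congr 1
  simp_rw [h1]
  rw [integral_const_mul, integral_gaussian, ← Real.sqrt_mul (by positivity)]
  rw [show Real.pi / ε * (Real.pi / (1 / (4 * ε))) = (2 * Real.pi) ^ 2 by field_simp; ring]
  exact Real.sqrt_sq (by positivity)

lemma ENNReal_mul_le_sq_add_sq (a b : ℝ≥0∞) : a * b ≤ a ^ 2 + b ^ 2 := by
  rcases le_total a b with h | h
  · calc a * b ≤ b * b := by gcongr
      _ = b ^ 2 := (sq b).symm
      _ ≤ _ := le_add_self
  · calc a * b ≤ a * a := by gcongr
      _ = a ^ 2 := (sq a).symm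
      _ ≤ _ := le_self_add

lemma norm_oscInt_integrand {Y : Type*} {Φ : Y → ℝ × ℝ} {H : Y → ℂ} (p : ℝ × ℝ) (y : Y) :
    ‖Complex.exp (Complex.I * ((p.1 * (Φ y).1 + p.2 * (Φ y).2 : ℝ) : ℂ)) * H y‖ = ‖H y‖ := by
  rw [norm_mul, norm_cexp_I_mul_ofReal, one_mul]

section OscInt

variable {Y : Type*} [MeasurableSpace Y] {μ : Measure Y} {Φ : Y → ℝ × ℝ} {H : Y → ℂ}

lemma aestronglyMeasurable_oscInt_integrand (hΦ : Measurable Φ) (hH : AEStronglyMeasurable H μ)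
    (p : ℝ × ℝ) : AEStronglyMeasurable
      (fun y => Complex.exp (Complex.I * ((p.1 * (Φ y).1 + p.2 * (Φ y).2 : ℝ) : ℂ)) * H y) μ := by
  refine AEStronglyMeasurable.mul (Measurable.aestronglyMeasurable ?_) hH
  have h1 := hΦ.fst
  have h2 := hΦ.snd
  fun_prop

lemma integrable_oscInt_integrand (hΦ : Measurable Φ) (hH : Integrable H μ) (p : ℝ × ℝ) :
    Integrable
      (fun y => Complex.exp (Complex.I * ((p.1 * (Φ y).1 + p.2 * (Φ y).2 : ℝ) : ℂ)) * H y) μ :=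
  hH.mono (aestronglyMeasurable_oscInt_integrand hΦ hH.aestronglyMeasurable p)
    (Eventually.of_forall fun y => (norm_oscInt_integrand p y).le)

lemma continuous_oscInt (hΦ : Measurable Φ) (hH : Integrable H μ) : Continuous (oscInt μ Φ H) := by
  refine continuous_of_dominated (bound := fun y => ‖H y‖)
    (fun p => aestronglyMeasurable_oscInt_integrand hΦ hH.aestronglyMeasurable p)
    (fun p => Eventually.of_forall fun y => (norm_oscInt_integrand p y).le) hH.norm
    (Eventually.of_forall fun y => ?_)
  fun_prop

lemma norm_oscInt_le (p : ℝ × ℝ) : ‖oscInt μ Φ H p‖ ≤ ∫ y, ‖H y‖ ∂μ := by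
  refine (norm_integral_le_integral_norm _).trans (le_of_eq ?_)
  exact integral_congr_ae (Eventually.of_forall fun y => norm_oscInt_integrand p y)

lemma oscInt_add {H' : Y → ℂ} (hΦ : Measurable Φ) (hH : Integrable H μ) (hH' : Integrable H' μ)
    (p : ℝ × ℝ) : oscInt μ Φ (fun y => H y + H' y) p = oscInt μ Φ H p + oscInt μ Φ H' p := by
  unfold oscInt
  rw [← integral_add (integrable_oscInt_integrand hΦ hH p) (integrable_oscInt_integrand hΦ hH' p)]
  simp only [mul_add]

/-- The Gaussian weight. -/
noncomputable def gaussWeight (ε : ℝ) (p : ℝ × ℝ) : ℝ :=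
  Real.exp (-ε * p.1 ^ 2) * Real.exp (-ε * p.2 ^ 2)

lemma integrable_gaussWeight {ε : ℝ} (hε : 0 < ε) : Integrable (gaussWeight ε) :=
  (integrable_exp_neg_mul_sq hε).mul_prod (integrable_exp_neg_mul_sq hε)

lemma integral_cexp_gaussWeight {ε : ℝ} (hε : 0 < ε) (a b : ℝ) :
    ∫ p : ℝ × ℝ, Complex.exp (Complex.I * ((p.1 * a + p.2 * b : ℝ) : ℂ)) * (gaussWeight ε p : ℂ) =
      ((gaussKernel ε a * gaussKernel ε b : ℝ) : ℂ) := by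
  have h : ∀ p : ℝ × ℝ, Complex.exp (Complex.I * ((p.1 * a + p.2 * b : ℝ) : ℂ)) *
      (gaussWeight ε p : ℂ) =
      (Complex.exp (Complex.I * ((p.1 * a : ℝ) : ℂ)) * ((Real.exp (-ε * p.1 ^ 2) : ℝ) : ℂ)) *
      (Complex.exp (Complex.I * ((p.2 * b : ℝ) : ℂ)) * ((Real.exp (-ε * p.2 ^ 2) : ℝ) : ℂ)) :=
    fun p => by
      unfold gaussWeight
      rw [mul_mul_mul_comm, ← Complex.exp_add]
      push_cast
      congr 2
      ring
  simp_rw [h]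
  rw [Measure.volume_eq_prod, integral_prod_mul
    (fun x : ℝ => Complex.exp (Complex.I * ((x * a : ℝ) : ℂ)) * ((Real.exp (-ε * x ^ 2) : ℝ) : ℂ))
    (fun x : ℝ => Complex.exp (Complex.I * ((x * b : ℝ) : ℂ)) * ((Real.exp (-ε * x ^ 2) : ℝ) : ℂ)),
    integral_cexp_gauss hε, integral_cexp_gauss hε]
  push_cast
  rfl

/-- The two-dimensional kernel. -/
noncomputable def gaussKernel₂ (ε : ℝ) (p : ℝ × ℝ) : ℝ := gaussKernel ε p.1 * gaussKernel ε p.2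

lemma lintegral_gaussKernel₂ {ε : ℝ} (hε : 0 < ε) :
    ∫⁻ p, ENNReal.ofReal (gaussKernel₂ ε p) = ENNReal.ofReal (2 * Real.pi) ^ 2 := by
  have hm : AEMeasurable (fun a => ENNReal.ofReal (gaussKernel ε a)) volume :=
    (continuous_gaussKernel ε).measurable.ennreal_ofReal.aemeasurable
  simp_rw [gaussKernel₂, ENNReal.ofReal_mul (gaussKernel_nonneg _ _)]
  rw [Measure.volume_eq_prod, lintegral_prod_mul hm hm, lintegral_gaussKernel hε, sq]

/-- The square of the oscillatory integral is a double integral over $Y\times Y$. The Gaussian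
weight makes Fubini legitimate, and integrating in $p$ first gives the Gaussian kernel at
$\Phi(y)-\Phi(y')$. -/
lemma ofReal_integral_gaussWeight_le [SFinite μ] (hΦ : Measurable Φ) (hH : Integrable H μ)
    {ε : ℝ} (hε : 0 < ε) :
    ∫⁻ p, ENNReal.ofReal (gaussWeight ε p) * ‖oscInt μ Φ H p‖ₑ ^ 2 ≤
      ∫⁻ z : Y × Y, ‖H z.1‖ₑ * ‖H z.2‖ₑ * ENNReal.ofReal (gaussKernel₂ ε (Φ z.1 - Φ z.2))
        ∂(μ.prod μ) := by
  have hw0 : ∀ p, 0 ≤ gaussWeight ε p := fun p => by unfold gaussWeight; positivity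
  have hwc : Continuous (gaussWeight ε) := by unfold gaussWeight; fun_prop
  have hc := continuous_oscInt hΦ hH
  let B := ∫ y, ‖H y‖ ∂μ
  have hB : ∀ p, ‖oscInt μ Φ H p‖ ≤ B := norm_oscInt_le
  have hint : Integrable fun p => gaussWeight ε p * ‖oscInt μ Φ H p‖ ^ 2 := by
    refine (integrable_gaussWeight hε).mul_bdd (c := B ^ 2)
      (hc.norm.pow 2).aestronglyMeasurable (Eventually.of_forall fun p => ?_)
    rw [norm_pow, norm_norm]
    exact pow_le_pow_left₀ (norm_nonneg _) (hB p) 2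
  have h1 : ∫⁻ p, ENNReal.ofReal (gaussWeight ε p) * ‖oscInt μ Φ H p‖ₑ ^ 2 =
      ENNReal.ofReal (∫ p, gaussWeight ε p * ‖oscInt μ Φ H p‖ ^ 2) := by
    rw [ofReal_integral_eq_lintegral_ofReal hint
      (Eventually.of_forall fun p => mul_nonneg (hw0 p) (sq_nonneg _))]
    refine lintegral_congr fun p => ?_
    rw [ENNReal.ofReal_mul (hw0 p), ENNReal.ofReal_pow (norm_nonneg _), ofReal_norm]
  let e : ℝ × ℝ → Y × Y → ℂ := fun p z => Complex.exp (Complex.I *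
    ((p.1 * (Φ z.1 - Φ z.2).1 + p.2 * (Φ z.1 - Φ z.2).2 : ℝ) : ℂ))
  have hHH : Integrable (fun z : Y × Y => H z.1 * (starRingEnd ℂ) (H z.2)) (μ.prod μ) :=
    hH.mul_prod (Complex.conjCLE.toContinuousLinearMap.integrable_comp hH)
  have h2 : ∀ p, ((gaussWeight ε p * ‖oscInt μ Φ H p‖ ^ 2 : ℝ) : ℂ) =
      ∫ z, (e p z * (gaussWeight ε p : ℂ)) * (H z.1 * (starRingEnd ℂ) (H z.2)) ∂(μ.prod μ) := by
    intro p
    have h3 : ((‖oscInt μ Φ H p‖ ^ 2 : ℝ) : ℂ) =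
        oscInt μ Φ H p * (starRingEnd ℂ) (oscInt μ Φ H p) := by
      rw [Complex.mul_conj, Complex.normSq_eq_norm_sq]
    rw [Complex.ofReal_mul, h3]
    unfold oscInt
    rw [← integral_conj, ← integral_prod_mul, ← integral_const_mul]
    refine integral_congr_ae (Eventually.of_forall fun z => ?_)
    simp only [map_mul, e]
    rw [← Complex.exp_conj]
    have h4 : Complex.exp (Complex.I *
        ((p.1 * (Φ z.1 - Φ z.2).1 + p.2 * (Φ z.1 - Φ z.2).2 : ℝ) : ℂ)) =
        Complex.exp (Complex.I * ((p.1 * (Φ z.1).1 + p.2 * (Φ z.1).2 : ℝ) : ℂ)) *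
        Complex.exp ((starRingEnd ℂ) (Complex.I *
          ((p.1 * (Φ z.2).1 + p.2 * (Φ z.2).2 : ℝ) : ℂ))) := by
      rw [← Complex.exp_add]
      congr 1
      simp
      ring
    rw [h4]
    ring
  have hFint : Integrable (Function.uncurry fun (p : ℝ × ℝ) (z : Y × Y) =>
      (e p z * (gaussWeight ε p : ℂ)) * (H z.1 * (starRingEnd ℂ) (H z.2)))
      ((volume : Measure (ℝ × ℝ)).prod (μ.prod μ)) := by
    have h5 : Integrable (fun q : (ℝ × ℝ) × (Y × Y) =>
        (gaussWeight ε q.1 : ℂ) * (H q.2.1 * (starRingEnd ℂ) (H q.2.2)))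
        ((volume : Measure (ℝ × ℝ)).prod (μ.prod μ)) :=
      (integrable_gaussWeight hε).ofReal.mul_prod hHH
    have hem : Measurable fun q : (ℝ × ℝ) × (Y × Y) => e q.1 q.2 := by
      have h6 := hΦ.comp (measurable_fst.comp (measurable_snd : Measurable
        (Prod.snd : (ℝ × ℝ) × (Y × Y) → Y × Y)))
      have h7 := hΦ.comp (measurable_snd.comp (measurable_snd : Measurable
        (Prod.snd : (ℝ × ℝ) × (Y × Y) → Y × Y)))
      have h8 := (h6.sub h7).fst
      have h9 := (h6.sub h7).snd
      exact Complex.continuous_exp.measurable.comp (measurable_const.mul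
        (Complex.measurable_ofReal.comp (((measurable_fst.comp measurable_fst).mul h8).add
          ((measurable_snd.comp measurable_fst).mul h9))))
    refine (h5.bdd_mul (c := 1) hem.aestronglyMeasurable
      (Eventually.of_forall fun q => (norm_cexp_I_mul_ofReal _).le)).congr
      (Eventually.of_forall fun q => ?_)
    simp only [Function.uncurry]
    ring
  have h6 : ((∫ p, gaussWeight ε p * ‖oscInt μ Φ H p‖ ^ 2 : ℝ) : ℂ) =
      ∫ z, ((gaussKernel₂ ε (Φ z.1 - Φ z.2) : ℝ) : ℂ) * (H z.1 * (starRingEnd ℂ) (H z.2))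
        ∂(μ.prod μ) := by
    rw [← integral_complex_ofReal]
    simp_rw [h2]
    rw [integral_integral_swap hFint]
    refine integral_congr_ae (Eventually.of_forall fun z => ?_)
    simp only
    rw [integral_mul_const, integral_cexp_gaussWeight hε]
    rfl
  rw [h1]
  have h7 : ENNReal.ofReal (∫ p, gaussWeight ε p * ‖oscInt μ Φ H p‖ ^ 2) =
      ‖((∫ p, gaussWeight ε p * ‖oscInt μ Φ H p‖ ^ 2 : ℝ) : ℂ)‖ₑ := by
    rw [← ofReal_norm, Complex.norm_real, Real.norm_eq_abs, abs_of_nonneg]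
    exact integral_nonneg fun p => mul_nonneg (hw0 p) (sq_nonneg _)
  rw [h7, h6]
  refine (enorm_integral_le_lintegral_enorm _).trans (lintegral_mono fun z => ?_)
  have h8 : ‖((gaussKernel₂ ε (Φ z.1 - Φ z.2) : ℝ) : ℂ)‖ₑ =
      ENNReal.ofReal (gaussKernel₂ ε (Φ z.1 - Φ z.2)) := by
    rw [← ofReal_norm, Complex.norm_real, Real.norm_eq_abs, abs_of_nonneg]
    exact mul_nonneg (gaussKernel_nonneg _ _) (gaussKernel_nonneg _ _)
  have h9 : ‖(starRingEnd ℂ) (H z.2)‖ₑ = ‖H z.2‖ₑ := by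
    rw [← ofReal_norm, RCLike.norm_conj, ofReal_norm]
  rw [enorm_mul, enorm_mul, h8, h9, mul_comm]

/-- One-sided Plancherel for the image of $\mu$ under $\Phi$, whose density is at most $c$. Both
marginals of the kernel $K(\Phi(y)-\Phi(y'))$ are at most $c(2\pi)^2$, so Schur's test bounds the
regularized integral, and Fatou's lemma removes the weight. The factor 2 is the price of using
$ab\le a^2+b^2$. -/
lemma lintegral_oscInt_sq_le [SFinite μ] (hΦ : Measurable Φ) {c : ℝ≥0∞}
    (hc : ∀ g : ℝ × ℝ → ℝ≥0∞, Measurable g → ∫⁻ y, g (Φ y) ∂μ ≤ c * ∫⁻ p, g p)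
    (hH : Integrable H μ) :
    ∫⁻ p, ‖oscInt μ Φ H p‖ₑ ^ 2 ≤
      2 * (c * ENNReal.ofReal (2 * Real.pi) ^ 2) * ∫⁻ y, ‖H y‖ₑ ^ 2 ∂μ := by
  have hHm : AEMeasurable (fun y => ‖H y‖ₑ ^ 2) μ := hH.aestronglyMeasurable.enorm.pow_const 2
  have hbound : ∀ ε : ℝ, 0 < ε →
      ∫⁻ p, ENNReal.ofReal (gaussWeight ε p) * ‖oscInt μ Φ H p‖ₑ ^ 2 ≤
      2 * (c * ENNReal.ofReal (2 * Real.pi) ^ 2) * ∫⁻ y, ‖H y‖ₑ ^ 2 ∂μ := by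
    intro ε hε
    let K : ℝ × ℝ → ℝ≥0∞ := fun p => ENNReal.ofReal (gaussKernel₂ ε p)
    have hK : Measurable K := by
      have := continuous_gaussKernel ε
      exact (by unfold gaussKernel₂; fun_prop : Continuous (gaussKernel₂ ε)).measurable.ennreal_ofReal
    have hKl : ∀ ξ, ∫⁻ y, K (ξ - Φ y) ∂μ ≤ c * ENNReal.ofReal (2 * Real.pi) ^ 2 := fun ξ => by
      refine (hc (fun η => K (ξ - η)) (hK.comp (measurable_const.sub measurable_id))).trans ?_
      rw [lintegral_sub_left_eq_self K ξ, lintegral_gaussKernel₂ hε]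
    have hKr : ∀ ξ, ∫⁻ y, K (Φ y - ξ) ∂μ ≤ c * ENNReal.ofReal (2 * Real.pi) ^ 2 := fun ξ => by
      refine (hc (fun η => K (η - ξ)) (hK.comp (measurable_id.sub measurable_const))).trans ?_
      rw [lintegral_sub_right_eq_self K ξ, lintegral_gaussKernel₂ hε]
    refine (ofReal_integral_gaussWeight_le hΦ hH hε).trans ?_
    have hKm : Measurable fun z : Y × Y => K (Φ z.1 - Φ z.2) :=
      hK.comp ((hΦ.comp measurable_fst).sub (hΦ.comp measurable_snd))
    have hm1 : AEMeasurable (fun z : Y × Y => ‖H z.1‖ₑ ^ 2 * K (Φ z.1 - Φ z.2)) (μ.prod μ) :=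
      (hHm.comp_quasiMeasurePreserving Measure.quasiMeasurePreserving_fst).mul hKm.aemeasurable
    have hm2 : AEMeasurable (fun z : Y × Y => ‖H z.2‖ₑ ^ 2 * K (Φ z.1 - Φ z.2)) (μ.prod μ) :=
      (hHm.comp_quasiMeasurePreserving Measure.quasiMeasurePreserving_snd).mul hKm.aemeasurable
    calc ∫⁻ z : Y × Y, ‖H z.1‖ₑ * ‖H z.2‖ₑ * K (Φ z.1 - Φ z.2) ∂(μ.prod μ)
        ≤ ∫⁻ z : Y × Y, (‖H z.1‖ₑ ^ 2 * K (Φ z.1 - Φ z.2) + ‖H z.2‖ₑ ^ 2 * K (Φ z.1 - Φ z.2))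
            ∂(μ.prod μ) := by
          refine lintegral_mono fun z => ?_
          rw [← add_mul]
          exact mul_le_mul_left (ENNReal_mul_le_sq_add_sq _ _) _
      _ = (∫⁻ y, ‖H y‖ₑ ^ 2 * ∫⁻ y', K (Φ y - Φ y') ∂μ ∂μ) +
            ∫⁻ y', ‖H y'‖ₑ ^ 2 * ∫⁻ y, K (Φ y - Φ y') ∂μ ∂μ := by
          rw [lintegral_add_left' hm1, lintegral_prod _ hm1, lintegral_prod_symm _ hm2]
          congr 1
          · refine lintegral_congr fun y => ?_
            exact lintegral_const_mul (f := fun y' => K (Φ y - Φ y')) (‖H y‖ₑ ^ 2)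
              (hK.comp (measurable_const.sub hΦ))
          · refine lintegral_congr fun y => ?_
            exact lintegral_const_mul (f := fun y' => K (Φ y' - Φ y)) (‖H y‖ₑ ^ 2)
              (hK.comp (hΦ.sub measurable_const))
      _ ≤ (∫⁻ y, ‖H y‖ₑ ^ 2 * (c * ENNReal.ofReal (2 * Real.pi) ^ 2) ∂μ) +
            ∫⁻ y', ‖H y'‖ₑ ^ 2 * (c * ENNReal.ofReal (2 * Real.pi) ^ 2) ∂μ := by
          gcongr with y y'
          · exact hKl _
          · exact hKr _
      _ = _ := by
          rw [lintegral_mul_const'' _ hHm]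
          ring
  have hlim : ∀ p, ‖oscInt μ Φ H p‖ₑ ^ 2 = liminf (fun n : ℕ =>
      ENNReal.ofReal (gaussWeight (1 / ((n : ℝ) + 1)) p) * ‖oscInt μ Φ H p‖ₑ ^ 2) atTop := fun p => by
    have h1 : Tendsto (fun n : ℕ => gaussWeight (1 / ((n : ℝ) + 1)) p) atTop
        (𝓝 (gaussWeight 0 p)) := by
      have : Continuous fun ε => gaussWeight ε p := by unfold gaussWeight; fun_prop
      exact (this.tendsto 0).comp tendsto_one_div_add_atTop_nhds_zero_nat
    have h0 : gaussWeight 0 p = 1 := by simp [gaussWeight]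
    rw [h0] at h1
    have h2 := ENNReal.Tendsto.mul_const (b := ‖oscInt μ Φ H p‖ₑ ^ 2) (ENNReal.tendsto_ofReal h1)
      (Or.inl (by rw [ENNReal.ofReal_one]; exact one_ne_zero))
    rw [ENNReal.ofReal_one, one_mul] at h2
    exact h2.liminf_eq.symm
  rw [lintegral_congr hlim]
  have hmeas : ∀ n : ℕ, Measurable fun p =>
      ENNReal.ofReal (gaussWeight (1 / ((n : ℝ) + 1)) p) * ‖oscInt μ Φ H p‖ₑ ^ 2 := fun n => by
    have h1 := continuous_oscInt hΦ hH
    have h2 : Continuous (gaussWeight (1 / ((n : ℝ) + 1))) := by unfold gaussWeight; fun_prop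
    exact h2.measurable.ennreal_ofReal.mul (h1.measurable.enorm.pow_const 2)
  refine (lintegral_liminf_le hmeas).trans ?_
  exact liminf_le_of_le ⟨0, Eventually.of_forall fun _ => zero_le⟩ fun b hb => by
    obtain ⟨n, hn⟩ := hb.exists
    exact hn.trans (hbound _ (by positivity))

end OscInt

/-! ### Sums of points on an arc have bounded density -/

/-- The sum of the points of the circle with angles `a`, `a + ρ` and, with weight `κ`, `a + s ρ`. -/
noncomputable def chordSum (κ s : ℝ) (q : ℝ × ℝ) : ℝ × ℝ :=
  (Real.cos q.1 + Real.cos (q.1 + q.2) + κ * Real.cos (q.1 + s * q.2),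
    Real.sin q.1 + Real.sin (q.1 + q.2) + κ * Real.sin (q.1 + s * q.2))

/-- The derivative of `chordSum`. -/
noncomputable def chordDeriv (κ s : ℝ) (q : ℝ × ℝ) : ℝ × ℝ →L[ℝ] ℝ × ℝ :=
  (Matrix.toLin (.finTwoProd ℝ) (.finTwoProd ℝ)
    !![-Real.sin q.1 - Real.sin (q.1 + q.2) - κ * Real.sin (q.1 + s * q.2),
        -Real.sin (q.1 + q.2) - κ * s * Real.sin (q.1 + s * q.2);
      Real.cos q.1 + Real.cos (q.1 + q.2) + κ * Real.cos (q.1 + s * q.2),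
        Real.cos (q.1 + q.2) + κ * s * Real.cos (q.1 + s * q.2)]).toContinuousLinearMap

lemma hasFDerivAt_chordSum (κ s : ℝ) (q : ℝ × ℝ) :
    HasFDerivAt (chordSum κ s) (chordDeriv κ s q) q := by
  have h1 : HasFDerivAt (fun q : ℝ × ℝ => q.1) (ContinuousLinearMap.fst ℝ ℝ ℝ) q := hasFDerivAt_fst
  have h2 : HasFDerivAt (fun q : ℝ × ℝ => q.2) (ContinuousLinearMap.snd ℝ ℝ ℝ) q := hasFDerivAt_snd
  have h3 := h1.add h2
  have h4 := h1.add (h2.const_mul s)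
  unfold chordDeriv
  rw [Matrix.toLin_finTwoProd_toContinuousLinearMap]
  refine (((h1.cos.add h3.cos).add (h4.cos.const_mul κ)).prodMk
    ((h1.sin.add h3.sin).add (h4.sin.const_mul κ))).congr_fderiv ?_
  ext <;> simp <;> ring

lemma det_chordDeriv (κ s : ℝ) (q : ℝ × ℝ) : (chordDeriv κ s q).det =
    Real.sin q.2 + κ * ((1 - s) * Real.sin ((1 - s) * q.2) + s * Real.sin (s * q.2)) := by
  unfold chordDeriv
  simp only [LinearMap.det_toContinuousLinearMap, LinearMap.det_toLin, Matrix.det_fin_two_of]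
  have h1 : Real.sin q.2 = Real.sin (q.1 + q.2 - q.1) := by ring_nf
  have h2 : Real.sin ((1 - s) * q.2) = Real.sin (q.1 + q.2 - (q.1 + s * q.2)) := by ring_nf
  have h3 : Real.sin (s * q.2) = Real.sin (q.1 + s * q.2 - q.1) := by ring_nf
  rw [h1, h2, h3, Real.sin_sub, Real.sin_sub, Real.sin_sub]
  ring

/-- All sines in the determinant have arguments in $[0,\pi/2]$, so the terms carrying $\kappa$ are
nonnegative. -/
lemma sin_le_det_chordDeriv {κ s : ℝ} (hκ : 0 ≤ κ) (hs : s ∈ Set.Icc (0 : ℝ) 1) {q : ℝ × ℝ}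
    (hq : q.2 ∈ Set.Ioc 0 (Real.pi / 2)) : Real.sin q.2 ≤ |(chordDeriv κ s q).det| := by
  refine le_trans ?_ (le_abs_self _)
  rw [det_chordDeriv]
  have hpi := Real.pi_pos
  have h1 : ∀ u ∈ Set.Icc (0 : ℝ) 1, 0 ≤ u * Real.sin (u * q.2) := fun u hu => by
    refine mul_nonneg hu.1 (Real.sin_nonneg_of_nonneg_of_le_pi (mul_nonneg hu.1 hq.1.le) ?_)
    calc u * q.2 ≤ 1 * q.2 := mul_le_mul_of_nonneg_right hu.2 hq.1.le
      _ ≤ Real.pi := by linarith [hq.2]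
  have h2 := h1 s hs
  have h3 := h1 (1 - s) ⟨by linarith [hs.2], by linarith [hs.1]⟩
  nlinarith

/-- Rotation invariance: the length of the sum is independent of the base angle, so it can be used
to recover the opening $\rho$. -/
lemma normSq_chordSum (κ s : ℝ) (q : ℝ × ℝ) :
    (chordSum κ s q).1 ^ 2 + (chordSum κ s q).2 ^ 2 =
      2 + κ ^ 2 + 2 * Real.cos q.2 + 2 * κ * Real.cos (s * q.2) +
        2 * κ * Real.cos ((1 - s) * q.2) := by
  have h1 : Real.cos q.2 = Real.cos (q.1 + q.2 - q.1) := by ring_nf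
  have h2 : Real.cos ((1 - s) * q.2) = Real.cos (q.1 + q.2 - (q.1 + s * q.2)) := by ring_nf
  have h3 : Real.cos (s * q.2) = Real.cos (q.1 + s * q.2 - q.1) := by ring_nf
  rw [h1, h2, h3, Real.cos_sub, Real.cos_sub, Real.cos_sub]
  simp only [chordSum]
  linear_combination Real.sin_sq_add_cos_sq q.1 + Real.sin_sq_add_cos_sq (q.1 + q.2) +
    κ ^ 2 * Real.sin_sq_add_cos_sq (q.1 + s * q.2)

/-- The parameter region for pairs of angles in an arc of length `π / 2`. -/
def chordDomain (α : ℝ) : Set (ℝ × ℝ) :=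
  Set.Icc α (α + Real.pi / 2) ×ˢ Set.Ioc 0 (Real.pi / 2)

/-- The length of the sum strictly decreases in $\rho$ and hence determines it. With $\rho$ known,
the sum is a fixed nonzero vector rotated by the base angle, and two base angles differ by at most
$\pi/2$. -/
lemma injOn_chordSum {κ s : ℝ} (hκ : 0 ≤ κ) (hs : s ∈ Set.Icc (0 : ℝ) 1) (α : ℝ) :
    Set.InjOn (chordSum κ s) (chordDomain α) := by
  have hpi := Real.pi_pos
  have hmono : ∀ u ∈ Set.Icc (0 : ℝ) 1, ∀ x y : ℝ, 0 < x → x ≤ y → y ≤ Real.pi / 2 →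
      Real.cos (u * y) ≤ Real.cos (u * x) := fun u hu x y hx hxy hy => by
    refine Real.cos_le_cos_of_nonneg_of_le_pi (mul_nonneg hu.1 hx.le) ?_
      (mul_le_mul_of_nonneg_left hxy hu.1)
    calc u * y ≤ 1 * y := mul_le_mul_of_nonneg_right hu.2 (hx.le.trans hxy)
      _ ≤ Real.pi := by linarith
  have hs' : 1 - s ∈ Set.Icc (0 : ℝ) 1 := ⟨by linarith [hs.2], by linarith [hs.1]⟩
  have hlt : ∀ p q : ℝ × ℝ, p ∈ chordDomain α → q ∈ chordDomain α →
      chordSum κ s p = chordSum κ s q → ¬ p.2 < q.2 := fun p q hp hq h hpq => by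
    have h1 := normSq_chordSum κ s p
    rw [h, normSq_chordSum κ s q] at h1
    have h2 : Real.cos q.2 < Real.cos p.2 :=
      Real.cos_lt_cos_of_nonneg_of_le_pi hp.2.1.le (by linarith [hq.2.2]) hpq
    have h3 := mul_le_mul_of_nonneg_left (hmono s hs _ _ hp.2.1 hpq.le hq.2.2) hκ
    have h4 := mul_le_mul_of_nonneg_left (hmono (1 - s) hs' _ _ hp.2.1 hpq.le hq.2.2) hκ
    linarith
  rintro ⟨a, ρ⟩ hp ⟨a', ρ'⟩ hq h
  have hρ : ρ = ρ' := le_antisymm (not_lt.1 (hlt _ _ hq hp h.symm)) (not_lt.1 (hlt _ _ hp hq h))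
  subst hρ
  have hN := normSq_chordSum κ s (a, ρ)
  have hc : ∀ u ∈ Set.Icc (0 : ℝ) 1, 0 ≤ Real.cos (u * ρ) := fun u hu => by
    refine Real.cos_nonneg_of_mem_Icc ⟨?_, ?_⟩
    · have := mul_nonneg hu.1 hp.2.1.le
      simp only at this
      linarith
    · calc u * ρ ≤ 1 * ρ := mul_le_mul_of_nonneg_right hu.2 hp.2.1.le
        _ ≤ Real.pi / 2 := by rw [one_mul]; exact hp.2.2
  have h1 := mul_nonneg hκ (hc s hs)
  have h2 := mul_nonneg hκ (hc (1 - s) hs')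
  have h3 := hc 1 ⟨zero_le_one, le_rfl⟩
  rw [one_mul] at h3
  have hpos : 0 < 2 + κ ^ 2 + 2 * Real.cos ρ + 2 * κ * Real.cos (s * ρ) +
      2 * κ * Real.cos ((1 - s) * ρ) := by nlinarith [sq_nonneg κ]
  simp only at hN
  simp only [chordSum, Prod.mk.injEq, Real.cos_add, Real.sin_add] at h hN
  obtain ⟨hx, hy⟩ := h
  -- The vector $(A,B)$ is the sum for base angle zero.
  let A := 1 + Real.cos ρ + κ * Real.cos (s * ρ)
  let B := Real.sin ρ + κ * Real.sin (s * ρ)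
  have hx' : Real.cos a * A - Real.sin a * B = Real.cos a' * A - Real.sin a' * B := by
    simp only [A, B]; linear_combination hx
  have hy' : Real.sin a * A + Real.cos a * B = Real.sin a' * A + Real.cos a' * B := by
    simp only [A, B]; linear_combination hy
  have hAB : 0 < A ^ 2 + B ^ 2 := by
    have : A ^ 2 + B ^ 2 = 2 + κ ^ 2 + 2 * Real.cos ρ + 2 * κ * Real.cos (s * ρ) +
        2 * κ * Real.cos ((1 - s) * ρ) := by
      rw [← hN]
      simp only [A, B]
      linear_combination -((1 + Real.cos ρ + κ * Real.cos (s * ρ)) ^ 2 +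
        (Real.sin ρ + κ * Real.sin (s * ρ)) ^ 2) * Real.sin_sq_add_cos_sq a
    rw [this]; exact hpos
  have hcos : Real.cos (a - a') = 1 := by
    rw [Real.cos_sub]
    have h5 : (A ^ 2 + B ^ 2) * (Real.cos a * Real.cos a' + Real.sin a * Real.sin a') =
        (A ^ 2 + B ^ 2) * 1 := by
      linear_combination (Real.cos a' * A - Real.sin a' * B) * hx' +
        (Real.sin a' * A + Real.cos a' * B) * hy' + (A ^ 2 + B ^ 2) * Real.sin_sq_add_cos_sq a'
    exact mul_left_cancel₀ hAB.ne' h5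
  have h6 : a - a' = 0 := by
    have h7 := hp.1.1
    have h8 := hp.1.2
    have h9 := hq.1.1
    have h10 := hq.1.2
    simp only at h7 h8 h9 h10
    exact (Real.cos_eq_one_iff_of_lt_of_lt (by linarith) (by linarith)).1 hcos
  exact Prod.ext (by simpa using sub_eq_zero.1 h6) rfl

lemma measurable_chordSum (κ s : ℝ) : Measurable (chordSum κ s) := by
  unfold chordSum; fun_prop

lemma measurableSet_chordDomain (α : ℝ) : MeasurableSet (chordDomain α) :=
  measurableSet_Icc.prod measurableSet_Ioc

/-- The area formula for an injective map whose Jacobian is at least $\sin\rho$. -/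
lemma setLIntegral_chordSum_le {κ s : ℝ} (hκ : 0 ≤ κ) (hs : s ∈ Set.Icc (0 : ℝ) 1) (α : ℝ)
    (g : ℝ × ℝ → ℝ≥0∞) :
    ∫⁻ q in chordDomain α, ENNReal.ofReal (Real.sin q.2) * g (chordSum κ s q) ≤ ∫⁻ p, g p := by
  have h := lintegral_image_eq_lintegral_abs_det_fderiv_mul volume (measurableSet_chordDomain α)
    (fun q _ => (hasFDerivAt_chordSum κ s q).hasFDerivWithinAt) (injOn_chordSum hκ hs α) g
  refine le_trans ?_ (h.symm.le.trans (setLIntegral_le_lintegral _ _))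
  refine setLIntegral_mono' (measurableSet_chordDomain α) fun q hq => ?_
  exact mul_le_mul_left (ENNReal.ofReal_le_ofReal (sin_le_det_chordDeriv hκ hs hq.2)) _

lemma lintegral_comp_add_mul (f : ℝ → ℝ≥0∞) (hf : Measurable f) (a : ℝ) {ρ : ℝ} (hρ : 0 < ρ) :
    ∫⁻ x, f x = ENNReal.ofReal ρ * ∫⁻ s, f (a + s * ρ) := by
  have hm : Measurable fun x => f (a + x) := hf.comp (measurable_const_add a)
  rw [← lintegral_add_left_eq_self f a]
  conv_lhs => rw [← Real.smul_map_volume_mul_right hρ.ne']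
  rw [lintegral_smul_measure, lintegral_map hm (measurable_mul_const ρ), abs_of_pos hρ, smul_eq_mul]

lemma le_two_mul_sin {ρ : ℝ} (h0 : 0 ≤ ρ) (h1 : ρ ≤ Real.pi / 2) : ρ ≤ 2 * Real.sin ρ := by
  have h2 := Real.mul_le_sin h0 h1
  have h3 := Real.pi_lt_four
  have h4 := Real.pi_pos
  have h5 : ρ / 2 ≤ 2 / Real.pi * ρ := by
    rw [div_mul_eq_mul_div, div_le_div_iff₀ two_pos h4]
    nlinarith
  linarith

lemma ofReal_mul_le_two_mul_sin {ρ : ℝ} (h0 : 0 ≤ ρ) (h1 : ρ ≤ Real.pi / 2) (x : ℝ≥0∞) :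
    ENNReal.ofReal ρ * x ≤ 2 * (ENNReal.ofReal (Real.sin ρ) * x) := by
  have h : ENNReal.ofReal ρ ≤ 2 * ENNReal.ofReal (Real.sin ρ) := by
    refine (ENNReal.ofReal_le_ofReal (le_two_mul_sin h0 h1)).trans (le_of_eq ?_)
    rw [ENNReal.ofReal_mul two_pos.le, ENNReal.ofReal_ofNat]
  calc ENNReal.ofReal ρ * x ≤ 2 * ENNReal.ofReal (Real.sin ρ) * x := mul_le_mul_left h x
    _ = _ := mul_assoc _ _ _

/-- Writing the middle angle as $c=a+s\rho$ produces a factor $\rho\le2\sin\rho$, which is absorbed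
by the Jacobian degenerating at $\rho=0$. This is why triple sums have bounded density up to the
diagonal, while pair sums need separation. -/
lemma lintegral_between_eq {g : ℝ × ℝ → ℝ≥0∞} (hg : Measurable g) (a : ℝ) {ρ : ℝ} (hρ : 0 < ρ) :
    ∫⁻ c, (Set.Icc a (a + ρ)).indicator (fun c => g (Real.cos a + Real.cos (a + ρ) + Real.cos c,
        Real.sin a + Real.sin (a + ρ) + Real.sin c)) c =
      ENNReal.ofReal ρ * ∫⁻ s in Set.Icc (0 : ℝ) 1, g (chordSum 1 s (a, ρ)) := by
  have hm : Measurable fun c => g (Real.cos a + Real.cos (a + ρ) + Real.cos c,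
      Real.sin a + Real.sin (a + ρ) + Real.sin c) := hg.comp (by fun_prop)
  rw [lintegral_comp_add_mul _ (hm.indicator measurableSet_Icc) a hρ,
    ← lintegral_indicator measurableSet_Icc]
  congr 1
  refine lintegral_congr fun s => ?_
  have hmem : a + s * ρ ∈ Set.Icc a (a + ρ) ↔ s ∈ Set.Icc (0 : ℝ) 1 := by
    constructor
    · rintro ⟨h1, h2⟩
      exact ⟨by by_contra h; nlinarith, by by_contra h; nlinarith⟩
    · rintro ⟨h1, h2⟩
      exact ⟨by nlinarith, by nlinarith⟩
  by_cases h : s ∈ Set.Icc (0 : ℝ) 1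
  · rw [Set.indicator_of_mem h, Set.indicator_of_mem (hmem.2 h)]
    simp [chordSum]
  · rw [Set.indicator_of_notMem h, Set.indicator_of_notMem fun h' => h (hmem.1 h')]

lemma lintegral_second_angle_le {α a : ℝ} (ha : α ≤ a) {g : ℝ × ℝ → ℝ≥0∞} (hg : Measurable g) :
    ∫⁻ b in Set.Icc α (α + Real.pi / 2), ∫⁻ c,
      (Set.Icc a b).indicator (fun c => g (Real.cos a + Real.cos b + Real.cos c,
        Real.sin a + Real.sin b + Real.sin c)) c ≤
      ∫⁻ ρ in Set.Ioc 0 (Real.pi / 2), ENNReal.ofReal ρ *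
        ∫⁻ s in Set.Icc (0 : ℝ) 1, g (chordSum 1 s (a, ρ)) := by
  rw [← lintegral_indicator measurableSet_Icc, ← lintegral_indicator measurableSet_Ioc,
    ← lintegral_add_left_eq_self _ a]
  refine lintegral_mono_ae ?_
  have hne : ∀ᵐ ρ : ℝ, ρ ≠ 0 := by simp [ae_iff]
  filter_upwards [hne] with ρ hρ0
  by_cases hρ : ρ ∈ Set.Ioc 0 (Real.pi / 2)
  · rw [Set.indicator_of_mem hρ]
    refine (Set.indicator_le_self _ _ _).trans ?_
    exact (lintegral_between_eq hg a hρ.1).le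
  · rw [Set.indicator_of_notMem hρ, nonpos_iff_eq_zero]
    by_cases hb : a + ρ ∈ Set.Icc α (α + Real.pi / 2)
    · rw [Set.indicator_of_mem hb]
      have hneg : ρ < 0 := by
        by_contra h
        exact hρ ⟨lt_of_le_of_ne (not_lt.1 h) hρ0.symm, by linarith [hb.2]⟩
      rw [Set.Icc_eq_empty (by linarith)]
      simp
    · rw [Set.indicator_of_notMem hb]

lemma lintegral_chordDomain_le (α : ℝ) {g : ℝ × ℝ → ℝ≥0∞} (hg : Measurable g) :
    ∫⁻ q in chordDomain α, ∫⁻ s in Set.Icc (0 : ℝ) 1,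
      2 * (ENNReal.ofReal (Real.sin q.2) * g (chordSum 1 s q)) ≤ 2 * ∫⁻ p, g p := by
  have hm : Measurable fun x : (ℝ × ℝ) × ℝ =>
      2 * (ENNReal.ofReal (Real.sin x.1.2) * g (chordSum 1 x.2 x.1)) := by
    refine measurable_const.mul (Measurable.mul (by fun_prop) (hg.comp ?_))
    unfold chordSum
    fun_prop
  rw [lintegral_lintegral_swap hm.aemeasurable]
  calc _ ≤ ∫⁻ _ in Set.Icc (0 : ℝ) 1, 2 * ∫⁻ p, g p := by
        refine setLIntegral_mono' measurableSet_Icc fun s hs => ?_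
        rw [lintegral_const_mul' _ _ ENNReal.ofNat_ne_top]
        exact mul_le_mul_right (setLIntegral_chordSum_le zero_le_one hs α g) _
    _ = 2 * ∫⁻ p, g p := by
        rw [setLIntegral_const, Real.volume_Icc, sub_zero, ENNReal.ofReal_one, mul_one]

/-- The contribution of ordered triples. -/
lemma lintegral_ordered_triple_le (α : ℝ) {g : ℝ × ℝ → ℝ≥0∞} (hg : Measurable g) :
    ∫⁻ a in Set.Icc α (α + Real.pi / 2), ∫⁻ b in Set.Icc α (α + Real.pi / 2), ∫⁻ c,
      (Set.Icc a b).indicator (fun c => g (Real.cos a + Real.cos b + Real.cos c,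
        Real.sin a + Real.sin b + Real.sin c)) c ≤ 2 * ∫⁻ p, g p := by
  have hm : Measurable fun x : (ℝ × ℝ) × ℝ =>
      2 * (ENNReal.ofReal (Real.sin x.1.2) * g (chordSum 1 x.2 x.1)) := by
    refine measurable_const.mul (Measurable.mul (by fun_prop) (hg.comp ?_))
    unfold chordSum
    fun_prop
  have hm' : Measurable fun q : ℝ × ℝ => ∫⁻ s in Set.Icc (0 : ℝ) 1,
      2 * (ENNReal.ofReal (Real.sin q.2) * g (chordSum 1 s q)) :=
    Measurable.lintegral_prod_right' hm
  have h1 : ∀ a ∈ Set.Icc α (α + Real.pi / 2), ∫⁻ b in Set.Icc α (α + Real.pi / 2), ∫⁻ c,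
      (Set.Icc a b).indicator (fun c => g (Real.cos a + Real.cos b + Real.cos c,
        Real.sin a + Real.sin b + Real.sin c)) c ≤
      ∫⁻ ρ in Set.Ioc 0 (Real.pi / 2), ∫⁻ s in Set.Icc (0 : ℝ) 1,
        2 * (ENNReal.ofReal (Real.sin ρ) * g (chordSum 1 s (a, ρ))) := by
    intro a ha
    refine (lintegral_second_angle_le ha.1 hg).trans ?_
    refine setLIntegral_mono' measurableSet_Ioc fun ρ hρ => ?_
    have hKs : Measurable fun s => g (chordSum 1 s (a, ρ)) := by
      refine hg.comp ?_
      unfold chordSum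
      fun_prop
    refine (lintegral_const_mul (ENNReal.ofReal ρ) hKs).symm.le.trans ?_
    exact lintegral_mono fun s => ofReal_mul_le_two_mul_sin hρ.1.le hρ.2 _
  refine (setLIntegral_mono' measurableSet_Icc h1).trans (le_of_eq_of_le ?_
    (lintegral_chordDomain_le α hg))
  rw [chordDomain, Measure.volume_eq_prod, ← Measure.prod_restrict, lintegral_prod _ hm'.aemeasurable]

/-- The contribution of ordered separated pairs. -/
lemma lintegral_ordered_pair_le (α : ℝ) {δ : ℝ} (hδ : 0 < δ)
    {g : ℝ × ℝ → ℝ≥0∞} (hg : Measurable g) :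
    ∫⁻ a in Set.Icc α (α + Real.pi / 2), ∫⁻ b in Set.Icc α (α + Real.pi / 2),
      (Set.Ici (a + δ)).indicator (fun b => g (Real.cos a + Real.cos b,
        Real.sin a + Real.sin b)) b ≤ ENNReal.ofReal (2 / δ) * ∫⁻ p, g p := by
  have hpi := Real.pi_pos
  have hm : Measurable fun q : ℝ × ℝ => ENNReal.ofReal (2 / δ) *
      (ENNReal.ofReal (Real.sin q.2) * g (chordSum 0 0 q)) :=
    measurable_const.mul (Measurable.mul (by fun_prop) (hg.comp (measurable_chordSum 0 0)))
  have h1 : ∀ a ∈ Set.Icc α (α + Real.pi / 2), ∫⁻ b in Set.Icc α (α + Real.pi / 2),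
      (Set.Ici (a + δ)).indicator (fun b => g (Real.cos a + Real.cos b,
        Real.sin a + Real.sin b)) b ≤
      ∫⁻ ρ in Set.Ioc 0 (Real.pi / 2), ENNReal.ofReal (2 / δ) *
        (ENNReal.ofReal (Real.sin ρ) * g (chordSum 0 0 (a, ρ))) := by
    intro a ha
    rw [← lintegral_indicator measurableSet_Icc, ← lintegral_indicator measurableSet_Ioc,
      ← lintegral_add_left_eq_self _ a]
    refine lintegral_mono fun ρ => ?_
    by_cases hρ : δ ≤ ρ ∧ a + ρ ∈ Set.Icc α (α + Real.pi / 2)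
    · have hρ' : ρ ∈ Set.Ioc 0 (Real.pi / 2) :=
        ⟨hδ.trans_le hρ.1, by linarith [ha.1, hρ.2.2]⟩
      rw [Set.indicator_of_mem hρ.2, Set.indicator_of_mem hρ', Set.indicator_of_mem
        (Set.mem_Ici.2 (by linarith [hρ.1]))]
      -- Separation gives $\sin\rho\ge\rho/2\ge\delta/2$.
      have h2 : 1 ≤ ENNReal.ofReal (2 / δ) * ENNReal.ofReal (Real.sin ρ) := by
        rw [← ENNReal.ofReal_mul (by positivity), ← ENNReal.ofReal_one]
        refine ENNReal.ofReal_le_ofReal ?_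
        rw [div_mul_eq_mul_div, le_div_iff₀ hδ]
        linarith [le_two_mul_sin hρ'.1.le hρ'.2, hρ.1]
      rw [← mul_assoc]
      refine le_trans (le_of_eq ?_) (le_mul_of_one_le_left zero_le h2)
      simp [chordSum]
    · refine le_trans (le_of_eq ?_) zero_le
      by_cases hb : a + ρ ∈ Set.Icc α (α + Real.pi / 2)
      · rw [Set.indicator_of_mem hb, Set.indicator_of_notMem]
        intro h
        exact hρ ⟨by linarith [Set.mem_Ici.1 h], hb⟩
      · rw [Set.indicator_of_notMem hb]
  calc _ ≤ ∫⁻ a in Set.Icc α (α + Real.pi / 2), ∫⁻ ρ in Set.Ioc 0 (Real.pi / 2),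
        ENNReal.ofReal (2 / δ) * (ENNReal.ofReal (Real.sin ρ) * g (chordSum 0 0 (a, ρ))) :=
        setLIntegral_mono' measurableSet_Icc h1
    _ = ∫⁻ q in chordDomain α,
          ENNReal.ofReal (2 / δ) * (ENNReal.ofReal (Real.sin q.2) * g (chordSum 0 0 q)) := by
        rw [chordDomain, Measure.volume_eq_prod, ← Measure.prod_restrict,
          lintegral_prod _ hm.aemeasurable]
    _ ≤ _ := by
        rw [lintegral_const_mul' _ _ ENNReal.ofReal_ne_top]
        exact mul_le_mul_right (setLIntegral_chordSum_le le_rfl ⟨le_rfl, zero_le_one⟩ α g) _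

/-! ### The adjoint restriction inequality on a quarter of the circle -/

section Symmetrize

variable {μ : Measure ℝ} [SFinite μ]

lemma lintegral_triple_swap_left {f : ℝ → ℝ → ℝ → ℝ≥0∞}
    (hf : Measurable fun x : ℝ × ℝ × ℝ => f x.1 x.2.1 x.2.2) :
    ∫⁻ a, ∫⁻ b, ∫⁻ c, f b a c ∂μ ∂μ ∂μ = ∫⁻ a, ∫⁻ b, ∫⁻ c, f a b c ∂μ ∂μ ∂μ := by
  refine lintegral_lintegral_swap (Measurable.aemeasurable ?_)
  refine Measurable.lintegral_prod_right' (f := fun x : (ℝ × ℝ) × ℝ => f x.1.2 x.1.1 x.2) ?_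
  exact hf.comp ((measurable_snd.comp measurable_fst).prodMk
    ((measurable_fst.comp measurable_fst).prodMk measurable_snd))

lemma lintegral_triple_swap_right {f : ℝ → ℝ → ℝ → ℝ≥0∞}
    (hf : Measurable fun x : ℝ × ℝ × ℝ => f x.1 x.2.1 x.2.2) :
    ∫⁻ a, ∫⁻ b, ∫⁻ c, f a c b ∂μ ∂μ ∂μ = ∫⁻ a, ∫⁻ b, ∫⁻ c, f a b c ∂μ ∂μ ∂μ := by
  refine lintegral_congr fun a => lintegral_lintegral_swap (Measurable.aemeasurable ?_)
  exact hf.comp (measurable_const.prodMk (measurable_snd.prodMk measurable_fst))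

/-- Every triple has one of six orderings, and by symmetry each ordering contributes the integral
over triples whose last entry lies between the first two. -/
lemma lintegral_triple_le_of_symm {K : ℝ → ℝ → ℝ → ℝ≥0∞}
    (hK : Measurable fun x : ℝ × ℝ × ℝ => K x.1 x.2.1 x.2.2)
    (h12 : ∀ a b c, K b a c = K a b c) (h23 : ∀ a b c, K a c b = K a b c) :
    ∫⁻ a, ∫⁻ b, ∫⁻ c, K a b c ∂μ ∂μ ∂μ ≤
      6 * ∫⁻ a, ∫⁻ b, ∫⁻ c, (Set.Icc a b).indicator (K a b) c ∂μ ∂μ ∂μ := by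
  let F : ℝ → ℝ → ℝ → ℝ≥0∞ := fun a b c => (Set.Icc a b).indicator (K a b) c
  have hF : Measurable fun x : ℝ × ℝ × ℝ => F x.1 x.2.1 x.2.2 := by
    have hS : MeasurableSet {x : ℝ × ℝ × ℝ | x.1 ≤ x.2.2 ∧ x.2.2 ≤ x.2.1} :=
      (measurableSet_le measurable_fst (measurable_snd.comp measurable_snd)).inter
        (measurableSet_le (measurable_snd.comp measurable_snd) (measurable_fst.comp measurable_snd))
    exact hK.indicator hS
  have p1 : Measurable fun x : ℝ × ℝ × ℝ => F x.1 x.2.2 x.2.1 :=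
    hF.comp (measurable_fst.prodMk ((measurable_snd.comp measurable_snd).prodMk
      (measurable_fst.comp measurable_snd)))
  have p2 : Measurable fun x : ℝ × ℝ × ℝ => F x.2.1 x.1 x.2.2 :=
    hF.comp ((measurable_fst.comp measurable_snd).prodMk (measurable_fst.prodMk
      (measurable_snd.comp measurable_snd)))
  have p3 : Measurable fun x : ℝ × ℝ × ℝ => F x.2.1 x.2.2 x.1 :=
    hF.comp ((measurable_fst.comp measurable_snd).prodMk
      ((measurable_snd.comp measurable_snd).prodMk measurable_fst))
  have p4 : Measurable fun x : ℝ × ℝ × ℝ => F x.2.2 x.1 x.2.1 :=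
    hF.comp ((measurable_snd.comp measurable_snd).prodMk
      (measurable_fst.prodMk (measurable_fst.comp measurable_snd)))
  have p5 : Measurable fun x : ℝ × ℝ × ℝ => F x.2.2 x.2.1 x.1 :=
    hF.comp ((measurable_snd.comp measurable_snd).prodMk
      ((measurable_fst.comp measurable_snd).prodMk measurable_fst))
  have i1 := lintegral_triple_swap_right (μ := μ) hF
  have i2 := lintegral_triple_swap_left (μ := μ) hF
  have i3 := (lintegral_triple_swap_left (μ := μ) (f := fun a b c => F a c b) p1).trans i1
  have i4 := (lintegral_triple_swap_right (μ := μ) (f := fun a b c => F b a c) p2).trans i2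
  have i5 := (lintegral_triple_swap_right (μ := μ) (f := fun a b c => F b c a) p3).trans i3
  have hle : ∀ a b c, K a b c ≤ F a b c + F a c b + F b a c + F b c a + F c a b + F c b a := by
    intro a b c
    have e : ∀ x y z, K x y z = K a b c → x ≤ z → z ≤ y → F x y z = K a b c :=
      fun x y z h h1 h2 => by
        simp only [F]
        rw [Set.indicator_of_mem (Set.mem_Icc.2 ⟨h1, h2⟩), h]
    have k1 : K a c b = K a b c := h23 _ _ _
    have k2 : K b a c = K a b c := h12 _ _ _
    have k3 : K b c a = K a b c := (h23 _ _ _).trans k2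
    have k4 : K c a b = K a b c := (h12 _ _ _).trans k1
    have k5 : K c b a = K a b c := (h12 _ _ _).trans k3
    rcases le_total a b with h | h <;> rcases le_total b c with h' | h' <;>
      rcases le_total a c with h'' | h''
    · rw [← e a c b k1 h h']
      exact le_add_right (le_add_right (le_add_right (le_add_right le_add_self)))
    · rw [← e a c b k1 h h']
      exact le_add_right (le_add_right (le_add_right (le_add_right le_add_self)))
    · conv_lhs => rw [← e a b c rfl h'' h']
      exact le_add_right (le_add_right (le_add_right (le_add_right le_self_add)))
    · rw [← e c b a k5 h'' h]
      exact le_add_self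
    · rw [← e b c a k3 h h'']
      exact le_add_right (le_add_right le_add_self)
    · rw [← e b a c k2 h' h'']
      exact le_add_right (le_add_right (le_add_right le_add_self))
    · rw [← e c a b k4 h' h]
      exact le_add_right le_add_self
    · rw [← e c a b k4 h' h]
      exact le_add_right le_add_self
  have m3 : ∀ {f : ℝ → ℝ → ℝ → ℝ≥0∞}, (Measurable fun x : ℝ × ℝ × ℝ => f x.1 x.2.1 x.2.2) →
      ∀ a b, Measurable fun c => f a b c := fun hf a b =>
    hf.comp (measurable_const.prodMk (measurable_const.prodMk measurable_id))
  have m2 : ∀ {f : ℝ → ℝ → ℝ → ℝ≥0∞}, (Measurable fun x : ℝ × ℝ × ℝ => f x.1 x.2.1 x.2.2) →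
      ∀ a, Measurable fun b => ∫⁻ c, f a b c ∂μ := fun {f} hf a => by
    refine Measurable.lintegral_prod_right' (f := fun x : ℝ × ℝ => f a x.1 x.2) ?_
    exact hf.comp (measurable_const.prodMk measurable_id)
  have m1 : ∀ {f : ℝ → ℝ → ℝ → ℝ≥0∞}, (Measurable fun x : ℝ × ℝ × ℝ => f x.1 x.2.1 x.2.2) →
      Measurable fun a => ∫⁻ b, ∫⁻ c, f a b c ∂μ ∂μ := fun {f} hf => by
    refine Measurable.lintegral_prod_right' (f := fun x : ℝ × ℝ => ∫⁻ c, f x.1 x.2 c ∂μ) ?_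
    refine Measurable.lintegral_prod_right' (f := fun x : (ℝ × ℝ) × ℝ => f x.1.1 x.1.2 x.2) ?_
    exact hf.comp ((measurable_fst.comp measurable_fst).prodMk
      ((measurable_snd.comp measurable_fst).prodMk measurable_snd))
  have hadd : ∀ {f g : ℝ → ℝ → ℝ → ℝ≥0∞}, (Measurable fun x : ℝ × ℝ × ℝ => g x.1 x.2.1 x.2.2) →
      ∫⁻ a, ∫⁻ b, ∫⁻ c, (f a b c + g a b c) ∂μ ∂μ ∂μ =
        (∫⁻ a, ∫⁻ b, ∫⁻ c, f a b c ∂μ ∂μ ∂μ) + ∫⁻ a, ∫⁻ b, ∫⁻ c, g a b c ∂μ ∂μ ∂μ :=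
    fun {f g} hg => by
      rw [← lintegral_add_right _ (m1 hg)]
      refine lintegral_congr fun a => ?_
      rw [← lintegral_add_right _ (m2 hg a)]
      refine lintegral_congr fun b => ?_
      rw [← lintegral_add_right _ (m3 hg a b)]
  refine (lintegral_mono fun a => lintegral_mono fun b => lintegral_mono fun c =>
    hle a b c).trans (le_of_eq ?_)
  rw [hadd (g := fun a b c => F c b a) p5, hadd (g := fun a b c => F c a b) p4,
    hadd (g := fun a b c => F b c a) p3, hadd (g := fun a b c => F b a c) p2,
    hadd (g := fun a b c => F a c b) p1, i1, i2, i3, i4, i5]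
  ring

end Symmetrize

/-! ### Extension from a quarter circle -/

/-- Lebesgue measure on the angles of a quarter circle. -/
noncomputable def arc (α : ℝ) : Measure ℝ := volume.restrict (Set.Icc α (α + Real.pi / 2))

instance (α : ℝ) : IsFiniteMeasure (arc α) := by unfold arc; infer_instance

/-- The point of the circle with a given angle. -/
noncomputable def circlePoint (θ : ℝ) : ℝ × ℝ := (Real.cos θ, Real.sin θ)

lemma measurable_circlePoint : Measurable circlePoint := by unfold circlePoint; fun_prop

/-- Six orderings at a cost of 2 each. -/
lemma lintegral_triple_sum_le (α : ℝ) {g : ℝ × ℝ → ℝ≥0∞} (hg : Measurable g) :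
    ∫⁻ q, g (circlePoint q.1.1 + circlePoint q.1.2 + circlePoint q.2)
      ∂(((arc α).prod (arc α)).prod (arc α)) ≤ 12 * ∫⁻ p, g p := by
  have hm : Measurable fun q : (ℝ × ℝ) × ℝ =>
      g (circlePoint q.1.1 + circlePoint q.1.2 + circlePoint q.2) := by
    refine hg.comp ?_
    unfold circlePoint
    fun_prop
  have hK : Measurable fun x : ℝ × ℝ × ℝ =>
      g (circlePoint x.1 + circlePoint x.2.1 + circlePoint x.2.2) := by
    refine hg.comp ?_
    unfold circlePoint
    fun_prop
  rw [lintegral_prod _ hm.aemeasurable, lintegral_prod]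
  · refine (lintegral_triple_le_of_symm (μ := arc α)
      (K := fun a b c => g (circlePoint a + circlePoint b + circlePoint c)) hK
      (fun a b c => by rw [add_comm (circlePoint b)])
      (fun a b c => by rw [add_right_comm])).trans ?_
    rw [show (12 : ℝ≥0∞) = 6 * 2 by norm_num, mul_assoc]
    refine mul_le_mul_right ?_ _
    refine le_trans ?_ (lintegral_ordered_triple_le α hg)
    refine lintegral_mono fun a => lintegral_mono fun b => ?_
    exact lintegral_mono' Measure.restrict_le_self le_rfl
  · exact (Measurable.lintegral_prod_right' hm).aemeasurable

/-- Pairs of angles at distance at least `δ`. -/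
def farPairs (δ : ℝ) : Set (ℝ × ℝ) := {q | δ ≤ |q.1 - q.2|}

lemma measurableSet_farPairs (δ : ℝ) : MeasurableSet (farPairs δ) :=
  measurableSet_le measurable_const (by fun_prop)

lemma lintegral_pair_sum_le (α : ℝ) {δ : ℝ} (hδ : 0 < δ) {g : ℝ × ℝ → ℝ≥0∞} (hg : Measurable g) :
    ∫⁻ q, g (circlePoint q.1 + circlePoint q.2)
      ∂(((arc α).prod (arc α)).restrict (farPairs δ)) ≤
        ENNReal.ofReal (4 / δ) * ∫⁻ p, g p := by
  have hm : Measurable fun q : ℝ × ℝ => g (circlePoint q.1 + circlePoint q.2) := by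
    refine hg.comp ?_
    unfold circlePoint
    fun_prop
  let F : ℝ → ℝ → ℝ≥0∞ := fun a b =>
    (Set.Ici (a + δ)).indicator (fun b => g (circlePoint a + circlePoint b)) b
  have hF : Measurable fun q : ℝ × ℝ => F q.1 q.2 := by
    have hS : MeasurableSet {q : ℝ × ℝ | q.1 + δ ≤ q.2} :=
      measurableSet_le (by fun_prop) measurable_snd
    exact hm.indicator hS
  have hF' : Measurable fun q : ℝ × ℝ => F q.2 q.1 := hF.comp measurable_swap
  have hle : ∀ q, (farPairs δ).indicator (fun q : ℝ × ℝ => g (circlePoint q.1 + circlePoint q.2)) q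
      ≤ F q.1 q.2 + F q.2 q.1 := fun q => by
    by_cases hq : q ∈ farPairs δ
    · rw [Set.indicator_of_mem hq]
      have h : δ ≤ |q.1 - q.2| := hq
      rcases le_abs.1 h with h1 | h1
      · refine le_trans ?_ le_add_self
        simp only [F]
        rw [Set.indicator_of_mem (Set.mem_Ici.2 (by linarith)), add_comm]
      · refine le_trans ?_ le_self_add
        simp only [F]
        rw [Set.indicator_of_mem (Set.mem_Ici.2 (by linarith))]
    · rw [Set.indicator_of_notMem hq]; exact zero_le
  have hI : ∫⁻ a, ∫⁻ b, F a b ∂(arc α) ∂(arc α) ≤ ENNReal.ofReal (2 / δ) * ∫⁻ p, g p :=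
    lintegral_ordered_pair_le α hδ hg
  rw [← lintegral_indicator (measurableSet_farPairs δ)]
  refine (lintegral_mono hle).trans ?_
  rw [lintegral_add_left hF, lintegral_prod _ hF.aemeasurable, lintegral_prod_symm _ hF'.aemeasurable]
  refine (add_le_add hI hI).trans (le_of_eq ?_)
  rw [← add_mul, ← ENNReal.ofReal_add (by positivity) (by positivity)]
  congr 2
  ring

/-- The extension operator of a quarter circle. -/
noncomputable def arcExt (α : ℝ) (f : ℝ → ℂ) (p : ℝ × ℝ) : ℂ := oscInt (arc α) circlePoint f p

lemma oscInt_mul {Y Z : Type*} [MeasurableSpace Y] [MeasurableSpace Z] {μ : Measure Y}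
    {ν : Measure Z} [SFinite μ] [SFinite ν] (Φ : Y → ℝ × ℝ) (Ψ : Z → ℝ × ℝ) (H : Y → ℂ) (G : Z → ℂ)
    (p : ℝ × ℝ) : oscInt μ Φ H p * oscInt ν Ψ G p =
      oscInt (μ.prod ν) (fun q => Φ q.1 + Ψ q.2) (fun q => H q.1 * G q.2) p := by
  unfold oscInt
  rw [← integral_prod_mul]
  refine integral_congr_ae (Eventually.of_forall fun q => ?_)
  simp only
  have h : Complex.exp (Complex.I *
      ((p.1 * (Φ q.1 + Ψ q.2).1 + p.2 * (Φ q.1 + Ψ q.2).2 : ℝ) : ℂ)) =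
      Complex.exp (Complex.I * ((p.1 * (Φ q.1).1 + p.2 * (Φ q.1).2 : ℝ) : ℂ)) *
      Complex.exp (Complex.I * ((p.1 * (Ψ q.2).1 + p.2 * (Ψ q.2).2 : ℝ) : ℂ)) := by
    rw [← Complex.exp_add]
    congr 1
    push_cast [Prod.fst_add, Prod.snd_add]
    ring
  rw [h]
  ring

lemma ENNReal_add_sq_le (a b : ℝ≥0∞) : (a + b) ^ 2 ≤ 4 * (a ^ 2 + b ^ 2) := by
  rcases le_total a b with h | h
  · calc (a + b) ^ 2 ≤ (b + b) ^ 2 := by gcongr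
      _ = 4 * b ^ 2 := by ring
      _ ≤ _ := by gcongr; exact le_add_self
  · calc (a + b) ^ 2 ≤ (a + a) ^ 2 := by gcongr
      _ = 4 * a ^ 2 := by ring
      _ ≤ _ := by gcongr; exact le_self_add

/-- The refined adjoint restriction inequality: `m` bounds the mass of `f` on short arcs and `B`
bounds the extension of `f`. -/
lemma exists_lintegral_arcExt_le : ∃ C : ℝ≥0∞, C ≠ ⊤ ∧ ∀ (α δ : ℝ), 0 < δ → ∀ f : ℝ → ℂ,
    MemLp f 2 (arc α) → ∀ m B : ℝ≥0∞,
    (∀ a, ∫⁻ b in Set.Ioo (a - δ) (a + δ), ‖f b‖ₑ ^ 2 ∂(arc α) ≤ m) →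
    (∀ p, ‖arcExt α f p‖ₑ ≤ B) →
    ∫⁻ p, ‖arcExt α f p‖ₑ ^ 6 ≤
      C * (∫⁻ a, ‖f a‖ₑ ^ 2 ∂(arc α)) ^ 2 * (m + B ^ 2 * ENNReal.ofReal (1 / δ)) := by
  let P : ℝ≥0∞ := ENNReal.ofReal (2 * Real.pi) ^ 2
  have hP : P ≠ ⊤ := ENNReal.pow_ne_top ENNReal.ofReal_ne_top
  -- Here $96=4\cdot2\cdot12$: the square of a sum, the factor of the Plancherel bound, and the
  -- density of triple sums. The far part needs only $32=4\cdot2\cdot4$.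
  refine ⟨96 * P, ENNReal.mul_ne_top (by simp) hP, ?_⟩
  intro α δ hδ f hf m B hm hB
  have hfi : Integrable f (arc α) := hf.integrable one_le_two
  let N := ∫⁻ a, ‖f a‖ₑ ^ 2 ∂(arc α)
  have hfm : AEMeasurable (fun a => ‖f a‖ₑ ^ 2) (arc α) := hfi.aestronglyMeasurable.enorm.pow_const 2
  let H : ℝ × ℝ → ℂ := fun q => f q.1 * f q.2
  have hH : Integrable H ((arc α).prod (arc α)) := hfi.mul_prod hfi
  let D := farPairs δ
  have hD : MeasurableSet D := measurableSet_farPairs δ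
  let Φ : ℝ × ℝ → ℝ × ℝ := fun q => circlePoint q.1 + circlePoint q.2
  have hΦ : Measurable Φ :=
    (measurable_circlePoint.comp measurable_fst).add (measurable_circlePoint.comp measurable_snd)
  have hHn : Integrable (Dᶜ.indicator H) ((arc α).prod (arc α)) := hH.indicator hD.compl
  have hHf : Integrable (D.indicator H) ((arc α).prod (arc α)) := hH.indicator hD
  -- The product of the first two factors is split at the diagonal. The near part keeps the third
  -- factor inside a threefold integral; in the far part it is only bounded by `B`.
  have hsplit : ∀ p, arcExt α f p ^ 3 =
      oscInt (((arc α).prod (arc α)).prod (arc α)) (fun q => Φ q.1 + circlePoint q.2)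
        (fun q => Dᶜ.indicator H q.1 * f q.2) p +
      oscInt (((arc α).prod (arc α)).restrict D) Φ H p * arcExt α f p := fun p => by
    have h1 : oscInt (((arc α).prod (arc α)).restrict D) Φ H p =
        oscInt ((arc α).prod (arc α)) Φ (D.indicator H) p := by
      unfold oscInt
      rw [← integral_indicator hD]
      refine integral_congr_ae (Eventually.of_forall fun q => ?_)
      by_cases h : q ∈ D <;> simp [h]
    have h2 : arcExt α f p ^ 2 = oscInt ((arc α).prod (arc α)) Φ (Dᶜ.indicator H) p +
        oscInt ((arc α).prod (arc α)) Φ (D.indicator H) p := by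
      rw [← oscInt_add hΦ hHn hHf, sq]
      unfold arcExt
      rw [oscInt_mul]
      congr 1
      ext q
      exact (Set.indicator_compl_add_self_apply D H q).symm
    rw [h1, pow_succ, h2, add_mul]
    congr 1
    exact oscInt_mul _ _ _ _ _
  -- the far part
  have hfar : ∫⁻ p, ‖oscInt (((arc α).prod (arc α)).restrict D) Φ H p * arcExt α f p‖ₑ ^ 2 ≤
      8 * P * ENNReal.ofReal (1 / δ) * B ^ 2 * N ^ 2 := by
    have h1 := lintegral_oscInt_sq_le (μ := ((arc α).prod (arc α)).restrict D) hΦ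
      (fun g hg => lintegral_pair_sum_le α hδ hg) (hH.mono_measure Measure.restrict_le_self)
    have h2 : ∫⁻ q in D, ‖H q‖ₑ ^ 2 ∂((arc α).prod (arc α)) ≤ N ^ 2 := by
      refine (setLIntegral_le_lintegral _ _).trans (le_of_eq ?_)
      simp only [H, enorm_mul, mul_pow]
      rw [lintegral_prod_mul hfm hfm, sq]
    calc _ ≤ ∫⁻ p, ‖oscInt (((arc α).prod (arc α)).restrict D) Φ H p‖ₑ ^ 2 * B ^ 2 := by
          refine lintegral_mono fun p => ?_
          rw [enorm_mul, mul_pow]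
          gcongr
          exact hB p
      _ = (∫⁻ p, ‖oscInt (((arc α).prod (arc α)).restrict D) Φ H p‖ₑ ^ 2) * B ^ 2 := by
          rw [lintegral_mul_const]
          exact (continuous_oscInt hΦ (hH.mono_measure Measure.restrict_le_self)).measurable.enorm.pow_const 2
      _ ≤ (2 * (ENNReal.ofReal (4 / δ) * P) * N ^ 2) * B ^ 2 := by
          gcongr
          exact h1.trans (mul_le_mul_right h2 _)
      _ = _ := by
          rw [show 4 / δ = 4 * (1 / δ) by ring, ENNReal.ofReal_mul (by norm_num),
            ENNReal.ofReal_ofNat]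
          ring
  -- the near part
  have hnear : ∫⁻ p, ‖oscInt (((arc α).prod (arc α)).prod (arc α))
      (fun q => Φ q.1 + circlePoint q.2) (fun q => Dᶜ.indicator H q.1 * f q.2) p‖ₑ ^ 2 ≤
      24 * P * m * N ^ 2 := by
    have hΦ3 : Measurable fun q : (ℝ × ℝ) × ℝ => Φ q.1 + circlePoint q.2 :=
      (hΦ.comp measurable_fst).add (measurable_circlePoint.comp measurable_snd)
    have h1 := lintegral_oscInt_sq_le (μ := ((arc α).prod (arc α)).prod (arc α)) hΦ3
      (fun g hg => lintegral_triple_sum_le α hg) (hHn.mul_prod hfi)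
    have h2 : ∫⁻ q, ‖Dᶜ.indicator H q‖ₑ ^ 2 ∂((arc α).prod (arc α)) ≤ N * m := by
      have hm2 : AEMeasurable (fun q => ‖Dᶜ.indicator H q‖ₑ ^ 2) ((arc α).prod (arc α)) :=
        hHn.aestronglyMeasurable.enorm.pow_const 2
      rw [lintegral_prod _ hm2, ← lintegral_mul_const'' _ hfm]
      refine lintegral_mono fun a => ?_
      have h3 : ∀ b, ‖Dᶜ.indicator H (a, b)‖ₑ ^ 2 =
          ‖f a‖ₑ ^ 2 * (Set.Ioo (a - δ) (a + δ)).indicator (fun b => ‖f b‖ₑ ^ 2) b := fun b => by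
        have hiff : (a, b) ∈ Dᶜ ↔ b ∈ Set.Ioo (a - δ) (a + δ) := by
          simp only [D, farPairs, Set.mem_compl_iff, Set.mem_ofPred_eq, not_le, abs_lt, Set.mem_Ioo]
          constructor <;> rintro ⟨h4, h5⟩ <;> constructor <;> linarith
        by_cases hb : b ∈ Set.Ioo (a - δ) (a + δ)
        · rw [Set.indicator_of_mem (hiff.2 hb), Set.indicator_of_mem hb]
          simp only [H, enorm_mul, mul_pow]
        · rw [Set.indicator_of_notMem fun h => hb (hiff.1 h), Set.indicator_of_notMem hb]
          simp
      simp_rw [h3]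
      rw [lintegral_const_mul'' _ (hfm.indicator measurableSet_Ioo), lintegral_indicator measurableSet_Ioo]
      exact mul_le_mul_right (hm a) _
    have h4 : ∫⁻ q, ‖Dᶜ.indicator H q.1 * f q.2‖ₑ ^ 2 ∂(((arc α).prod (arc α)).prod (arc α)) ≤
        N * m * N := by
      simp only [enorm_mul, mul_pow]
      rw [lintegral_prod_mul (hHn.aestronglyMeasurable.enorm.pow_const 2) hfm]
      exact mul_le_mul_left h2 _
    refine h1.trans ((mul_le_mul_right h4 _).trans (le_of_eq ?_))
    ring
  have hmeas : Measurable fun p => ‖oscInt (((arc α).prod (arc α)).prod (arc α))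
      (fun q => Φ q.1 + circlePoint q.2) (fun q => Dᶜ.indicator H q.1 * f q.2) p‖ₑ ^ 2 := by
    have hΦ3 : Measurable fun q : (ℝ × ℝ) × ℝ => Φ q.1 + circlePoint q.2 :=
      (hΦ.comp measurable_fst).add (measurable_circlePoint.comp measurable_snd)
    exact (continuous_oscInt hΦ3 (hHn.mul_prod hfi)).measurable.enorm.pow_const 2
  calc ∫⁻ p, ‖arcExt α f p‖ₑ ^ 6
      ≤ ∫⁻ p, 4 * (‖oscInt (((arc α).prod (arc α)).prod (arc α))
          (fun q => Φ q.1 + circlePoint q.2) (fun q => Dᶜ.indicator H q.1 * f q.2) p‖ₑ ^ 2 +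
          ‖oscInt (((arc α).prod (arc α)).restrict D) Φ H p * arcExt α f p‖ₑ ^ 2) := by
        refine lintegral_mono fun p => ?_
        rw [show 6 = 3 * 2 by norm_num, pow_mul, ← enorm_pow, hsplit]
        exact (pow_le_pow_left₀ zero_le (enorm_add_le _ _) 2).trans (ENNReal_add_sq_le _ _)
    _ ≤ 4 * (24 * P * m * N ^ 2 + 8 * P * ENNReal.ofReal (1 / δ) * B ^ 2 * N ^ 2) := by
        rw [lintegral_const_mul' _ _ (by simp), lintegral_add_left hmeas]
        gcongr
    _ = (96 * P) * N ^ 2 * m + (32 * P) * N ^ 2 * (B ^ 2 * ENNReal.ofReal (1 / δ)) := by ring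
    _ ≤ (96 * P) * N ^ 2 * m + (96 * P) * N ^ 2 * (B ^ 2 * ENNReal.ofReal (1 / δ)) := by
        gcongr
        norm_num
    _ = _ := by rw [← mul_add]

/-- The adjoint restriction inequality from `L²` to `L⁶`. -/
lemma exists_lintegral_arcExt_le_cube : ∃ C : ℝ≥0∞, C ≠ ⊤ ∧ ∀ (α : ℝ) (f : ℝ → ℂ),
    MemLp f 2 (arc α) →
    ∫⁻ p, ‖arcExt α f p‖ₑ ^ 6 ≤ C * (∫⁻ a, ‖f a‖ₑ ^ 2 ∂(arc α)) ^ 3 := by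
  obtain ⟨C, hC, h⟩ := exists_lintegral_arcExt_le
  refine ⟨C, hC, fun α f hf => ?_⟩
  let N := ∫⁻ a, ‖f a‖ₑ ^ 2 ∂(arc α)
  have hfi : Integrable f (arc α) := hf.integrable one_le_two
  let B := ENNReal.ofReal (∫ a, ‖f a‖ ∂(arc α))
  have hB : ∀ p, ‖arcExt α f p‖ₑ ≤ B := fun p => by
    rw [← ofReal_norm]
    exact ENNReal.ofReal_le_ofReal (norm_oscInt_le p)
  -- Separations $\delta=n+1\to\infty$ with the trivial mass bound `N`: the far term disappears
  -- since the supremum is finite.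
  have h1 : ∀ n : ℕ, ∫⁻ p, ‖arcExt α f p‖ₑ ^ 6 ≤
      C * N ^ 2 * (N + B ^ 2 * ENNReal.ofReal (1 / ((n : ℝ) + 1))) := fun n =>
    h α (n + 1) (by positivity) f hf N B (fun a => setLIntegral_le_lintegral _ _) hB
  have hN : N ≠ ⊤ := by
    have h3 := hf.eLpNorm_lt_top
    rw [eLpNorm_lt_top_iff_lintegral_rpow_enorm_lt_top (by norm_num) (by norm_num)] at h3
    simpa using h3.ne
  have h2 : Tendsto (fun n : ℕ => C * N ^ 2 * (N + B ^ 2 * ENNReal.ofReal (1 / ((n : ℝ) + 1))))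
      atTop (𝓝 (C * N ^ 2 * (N + B ^ 2 * ENNReal.ofReal 0))) := by
    refine ENNReal.Tendsto.const_mul ?_ (Or.inr (ENNReal.mul_ne_top hC (ENNReal.pow_ne_top hN)))
    refine tendsto_const_nhds.add (ENNReal.Tendsto.const_mul ?_
      (Or.inr (ENNReal.pow_ne_top ENNReal.ofReal_ne_top)))
    exact ENNReal.tendsto_ofReal tendsto_one_div_add_atTop_nhds_zero_nat
  refine (ge_of_tendsto h2 (Eventually.of_forall h1)).trans (le_of_eq ?_)
  rw [ENNReal.ofReal_zero, mul_zero, add_zero, mul_assoc, ← pow_succ]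

/-! ### The modified evolution in terms of angles -/

/-- The angles parametrizing the open half circle. -/
def halfAngles : Set ℝ := Set.Ioo (-(Real.pi / 2)) (Real.pi / 2)

lemma cos_pos_of_mem_halfAngles {θ : ℝ} (h : θ ∈ halfAngles) : 0 < Real.cos θ :=
  Real.cos_pos_of_mem_Ioo h

lemma measurableSet_halfAngles : MeasurableSet halfAngles := measurableSet_Ioo

lemma measurableSet_chartDomain (r : ℝ) : MeasurableSet (chartDomain r) :=
  measurableSet_lt (by fun_prop) measurable_const

lemma hasDerivAt_sin_div (r θ : ℝ) : HasDerivAt (fun θ => Real.sin θ / r) (Real.cos θ / r) θ :=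
  (Real.hasDerivAt_sin θ).div_const r

lemma injOn_sin_div {r : ℝ} (hr : 0 < r) : Set.InjOn (fun θ => Real.sin θ / r) halfAngles := by
  intro a ha b hb h
  exact Real.injOn_sin (Set.Ioo_subset_Icc_self ha) (Set.Ioo_subset_Icc_self hb)
    ((div_left_inj' hr.ne').1 h)

lemma image_sin_div {r : ℝ} (hr : 0 < r) :
    (fun θ => Real.sin θ / r) '' halfAngles = chartDomain r := by
  ext y
  simp only [Set.mem_image, chartDomain, Set.mem_ofPred_eq, abs_lt]
  constructor
  · rintro ⟨θ, hθ, rfl⟩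
    rw [mul_div_cancel₀ _ hr.ne']
    have h1 := cos_pos_of_mem_halfAngles hθ
    have h2 := Real.sin_sq_add_cos_sq θ
    constructor <;> nlinarith
  · rintro ⟨h1, h2⟩
    refine ⟨Real.arcsin (r * y), ⟨?_, ?_⟩, ?_⟩
    · exact Real.neg_pi_div_two_lt_arcsin.2 h1
    · exact Real.arcsin_lt_pi_div_two.2 h2
    · rw [Real.sin_arcsin h1.le h2.le]
      field_simp

lemma lintegral_chartDomain {r : ℝ} (hr : 0 < r) (F : ℝ → ℝ≥0∞) :
    ∫⁻ y in chartDomain r, F y =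
      ∫⁻ θ in halfAngles, ENNReal.ofReal (Real.cos θ / r) * F (Real.sin θ / r) := by
  rw [← image_sin_div hr, lintegral_image_eq_lintegral_abs_deriv_mul measurableSet_halfAngles
    (fun θ _ => (hasDerivAt_sin_div r θ).hasDerivWithinAt) (injOn_sin_div hr)]
  refine setLIntegral_congr_fun measurableSet_halfAngles fun θ hθ => ?_
  rw [abs_of_pos (div_pos (cos_pos_of_mem_halfAngles hθ) hr)]

lemma integral_chartDomain {r : ℝ} (hr : 0 < r) (F : ℝ → ℂ) :
    ∫ y in chartDomain r, F y =
      ∫ θ in halfAngles, ((Real.cos θ / r : ℝ) : ℂ) * F (Real.sin θ / r) := by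
  rw [← image_sin_div hr, integral_image_eq_integral_abs_deriv_smul measurableSet_halfAngles
    (fun θ _ => (hasDerivAt_sin_div r θ).hasDerivWithinAt) (injOn_sin_div hr)]
  refine setIntegral_congr_fun measurableSet_halfAngles fun θ hθ => ?_
  rw [abs_of_pos (div_pos (cos_pos_of_mem_halfAngles hθ) hr), Complex.real_smul]

lemma one_sub_sin_div_sq {r : ℝ} (hr : 0 < r) (θ : ℝ) :
    1 - r ^ 2 * (Real.sin θ / r) ^ 2 = Real.cos θ ^ 2 := by
  have := Real.sin_sq_add_cos_sq θ
  rw [div_pow, mul_div_cancel₀ _ (pow_ne_zero 2 hr.ne')]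
  linarith

/-- The function on the circle corresponding to a function on the chart. -/
noncomputable def circFun (r : ℝ) (e : ℝ → ℂ) : ℝ → ℂ :=
  halfAngles.indicator fun θ => ((√(Real.cos θ / r) : ℝ) : ℂ) * e (Real.sin θ / r)

lemma enorm_circFun_sq (r : ℝ) (e : ℝ → ℂ) {θ : ℝ} (hr : 0 < r) (hθ : θ ∈ halfAngles) :
    ‖circFun r e θ‖ₑ ^ 2 = ENNReal.ofReal (Real.cos θ / r) * ‖e (Real.sin θ / r)‖ₑ ^ 2 := by
  have h := div_pos (cos_pos_of_mem_halfAngles hθ) hr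
  rw [circFun, Set.indicator_of_mem hθ, enorm_mul, mul_pow]
  congr 1
  rw [← ofReal_norm, Complex.norm_real, Real.norm_eq_abs, abs_of_nonneg (Real.sqrt_nonneg _),
    ← ENNReal.ofReal_pow (Real.sqrt_nonneg _), Real.sq_sqrt h.le]

/-- The weight in `circFun` is the square root of the Jacobian of $y=\sin\theta/r$. -/
lemma lintegral_circFun_sq {r : ℝ} (hr : 0 < r) (e : ℝ → ℂ) :
    ∫⁻ θ, ‖circFun r e θ‖ₑ ^ 2 = ∫⁻ y in chartDomain r, ‖e y‖ₑ ^ 2 := by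
  rw [lintegral_chartDomain hr, ← lintegral_indicator measurableSet_halfAngles]
  refine lintegral_congr fun θ => ?_
  by_cases hθ : θ ∈ halfAngles
  · rw [Set.indicator_of_mem hθ, enorm_circFun_sq r e hr hθ]
  · rw [Set.indicator_of_notMem hθ, circFun, Set.indicator_of_notMem hθ]
    simp

lemma lintegral_circFun_sq_le {r : ℝ} (hr : 0 < r) (e : ℝ → ℂ) :
    ∫⁻ θ, ‖circFun r e θ‖ₑ ^ 2 ≤ ∫⁻ y, ‖e y‖ₑ ^ 2 :=
  (lintegral_circFun_sq hr e).le.trans (setLIntegral_le_lintegral _ _)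

/-- Since the sine is 1-Lipschitz, an arc of radius $r\delta$ in $\theta$ lands in an interval of
radius $\delta$ in $y$. -/
lemma lintegral_circFun_Ioo_le {r : ℝ} (hr : 0 < r) (e : ℝ → ℂ) (a δ : ℝ) :
    ∫⁻ θ in Set.Ioo (a - r * δ) (a + r * δ), ‖circFun r e θ‖ₑ ^ 2 ≤
      ∫⁻ y in Set.Ioo (Real.sin a / r - δ) (Real.sin a / r + δ), ‖e y‖ₑ ^ 2 := by
  let J := Set.Ioo (Real.sin a / r - δ) (Real.sin a / r + δ)
  have h1 : ∀ θ ∈ Set.Ioo (a - r * δ) (a + r * δ),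
      ‖circFun r e θ‖ₑ ^ 2 = ‖circFun r (J.indicator e) θ‖ₑ ^ 2 := fun θ hθ => by
    have h2 : |Real.sin θ - Real.sin a| ≤ |θ - a| := by
      have := Real.abs_sin_sub_sin_le θ a
      exact this
    have h3 : |θ - a| < r * δ := abs_lt.2 ⟨by linarith [hθ.1], by linarith [hθ.2]⟩
    have h4 : |Real.sin θ / r - Real.sin a / r| < δ := by
      rw [← sub_div, abs_div, abs_of_pos hr, div_lt_iff₀ hr]
      linarith
    have h5 : Real.sin θ / r ∈ J := by
      have := abs_lt.1 h4
      exact ⟨by linarith, by linarith⟩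
    congr 2
    unfold circFun
    by_cases h : θ ∈ halfAngles
    · rw [Set.indicator_of_mem h, Set.indicator_of_mem h, Set.indicator_of_mem h5]
    · rw [Set.indicator_of_notMem h, Set.indicator_of_notMem h]
  rw [setLIntegral_congr_fun measurableSet_Ioo h1]
  refine (setLIntegral_le_lintegral _ _).trans ((lintegral_circFun_sq_le hr _).trans (le_of_eq ?_))
  rw [← lintegral_indicator measurableSet_Ioo]
  refine lintegral_congr fun y => ?_
  by_cases h : y ∈ J
  · rw [Set.indicator_of_mem h, Set.indicator_of_mem h]
  · rw [Set.indicator_of_notMem h, Set.indicator_of_notMem h]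
    simp

lemma measurable_circFun (r : ℝ) {e : ℝ → ℂ} (he : Measurable e) : Measurable (circFun r e) := by
  refine Measurable.indicator ?_ measurableSet_halfAngles
  exact (Complex.measurable_ofReal.comp (by fun_prop)).mul
    (he.comp (Real.measurable_sin.div_const r))

lemma memLp_two_of_lintegral_lt_top {μ : Measure ℝ} {f : ℝ → ℂ} (hf : AEStronglyMeasurable f μ)
    (h : ∫⁻ x, ‖f x‖ₑ ^ 2 ∂μ < ⊤) : MemLp f 2 μ := by
  refine ⟨hf, ?_⟩
  rw [eLpNorm_lt_top_iff_lintegral_rpow_enorm_lt_top (by norm_num) (by norm_num)]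
  simpa using h

lemma lintegral_lt_top_of_memLp_two {α F : Type*} [MeasurableSpace α] [NormedAddCommGroup F]
    {μ : Measure α} {f : α → F} (h : MemLp f 2 μ) : ∫⁻ x, ‖f x‖ₑ ^ 2 ∂μ < ⊤ := by
  have h3 := h.eLpNorm_lt_top
  rw [eLpNorm_lt_top_iff_lintegral_rpow_enorm_lt_top (by norm_num) (by norm_num)] at h3
  simpa using h3

lemma memLp_circFun {r : ℝ} (hr : 0 < r) {e : ℝ → ℂ} (he : Measurable e)
    (h : ∫⁻ y, ‖e y‖ₑ ^ 2 < ⊤) : MemLp (circFun r e) 2 volume :=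
  memLp_two_of_lintegral_lt_top (measurable_circFun r he).aestronglyMeasurable
    ((lintegral_circFun_sq_le hr e).trans_lt h)

lemma integrable_circFun {r : ℝ} (hr : 0 < r) {e : ℝ → ℂ} (he : Measurable e)
    (h : ∫⁻ y, ‖e y‖ₑ ^ 2 < ⊤) : Integrable (circFun r e) := by
  have h1 : IntegrableOn (circFun r e) halfAngles := by
    have : IsFiniteMeasure (volume.restrict halfAngles) := by
      unfold halfAngles; infer_instance
    exact ((memLp_circFun hr he h).restrict _).integrable one_le_two
  refine (integrableOn_iff_integrable_of_support_subset ?_).1 h1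
  exact Set.support_indicator_subset

/-- The factor `hFactor` replaces the parabola in the Schrödinger phase by the circle, leaving a
modulation with parameters $(rx,r^2t)$. -/
lemma modifiedEvolution_eq_integral (r : ℝ) (e : ℝ → ℂ) (p : ℝ × ℝ) :
    modifiedEvolution r e p = ((r ^ (1 / 2 : ℝ) : ℝ) : ℂ) *
      ∫ y in chartDomain r, mult r (r * p.2, r ^ 2 * p.1) y *
        (e y / (((1 - r ^ 2 * y ^ 2) ^ (1 / 4 : ℝ) : ℝ) : ℂ)) := by
  unfold modifiedEvolution schrodinger
  congr 1
  rw [← integral_indicator (measurableSet_chartDomain r)]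
  refine integral_congr_ae (Eventually.of_forall fun y => ?_)
  simp only
  by_cases h : y ∈ chartDomain r
  · rw [Set.indicator_of_mem h, Set.indicator_of_mem h, mul_div_assoc (hFactor _ _ _),
      ← mul_assoc]
    congr 1
    unfold hFactor mult phase
    rw [← Complex.exp_add]
    congr 1
    push_cast
    ring
  · rw [Set.indicator_of_notMem h, Set.indicator_of_notMem h, mul_zero]

/-- For $y=\sin\theta/r$ the phase becomes $x\sin\theta+t(\cos\theta-1)$, the extension phase
shifted by $-t$. -/
lemma modifiedEvolution_eq_oscInt {r : ℝ} (hr : 0 < r) (e : ℝ → ℂ) (p : ℝ × ℝ) :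
    modifiedEvolution r e p = Complex.exp (Complex.I * ((-p.1 : ℝ) : ℂ)) *
      oscInt volume circlePoint (circFun r e) p := by
  rw [modifiedEvolution_eq_integral, integral_chartDomain hr, oscInt, ← integral_const_mul,
    ← integral_const_mul, ← integral_indicator measurableSet_halfAngles]
  refine integral_congr_ae (Eventually.of_forall fun θ => ?_)
  simp only
  by_cases h : θ ∈ halfAngles
  · rw [Set.indicator_of_mem h, circFun, Set.indicator_of_mem h]
    have hc := cos_pos_of_mem_halfAngles h
    have h1 : mult r (r * p.2, r ^ 2 * p.1) (Real.sin θ / r) =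
        Complex.exp (Complex.I * ((-p.1 : ℝ) : ℂ)) * Complex.exp (Complex.I *
          ((p.1 * (circlePoint θ).1 + p.2 * (circlePoint θ).2 : ℝ) : ℂ)) := by
      unfold mult phase
      rw [one_sub_sin_div_sq hr, Real.sqrt_sq hc.le, ← Complex.exp_add]
      congr 1
      rw [← mul_add, ← Complex.ofReal_add]
      congr 2
      simp only [circlePoint]
      field_simp
      ring
    have h2 : (1 - r ^ 2 * (Real.sin θ / r) ^ 2) ^ (1 / 4 : ℝ) = √(Real.cos θ) := by
      rw [one_sub_sin_div_sq hr, Real.sqrt_eq_rpow, ← Real.rpow_natCast, ← Real.rpow_mul hc.le]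
      norm_num
    -- The prefactor, the Jacobian and the weight $(1-r^2y^2)^{-1/4}=(\cos\theta)^{-1/2}$ combine to
    -- the weight of `circFun`.
    have h3 : r ^ (1 / 2 : ℝ) * (Real.cos θ / r) / √(Real.cos θ) = √(Real.cos θ / r) := by
      rw [← Real.sqrt_eq_rpow, Real.sqrt_div hc.le]
      have h4 := Real.sqrt_pos.2 hc
      have h5 := Real.sqrt_pos.2 hr
      rw [div_eq_div_iff h4.ne' h5.ne']
      have h6 := Real.mul_self_sqrt hr.le
      have h7 := Real.mul_self_sqrt hc.le
      field_simp
      rw [sq, sq, h6, h7]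
    rw [h1, h2, ← h3]
    push_cast
    ring
  · rw [Set.indicator_of_notMem h, circFun, Set.indicator_of_notMem h]
    simp

lemma norm_modifiedEvolution {r : ℝ} (hr : 0 < r) (e : ℝ → ℂ) (p : ℝ × ℝ) :
    ‖modifiedEvolution r e p‖ = ‖oscInt volume circlePoint (circFun r e) p‖ := by
  rw [modifiedEvolution_eq_oscInt hr, norm_mul, norm_cexp_I_mul_ofReal, one_mul]

lemma enorm_modifiedEvolution {r : ℝ} (hr : 0 < r) (e : ℝ → ℂ) (p : ℝ × ℝ) :
    ‖modifiedEvolution r e p‖ₑ = ‖oscInt volume circlePoint (circFun r e) p‖ₑ := by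
  rw [← ofReal_norm, norm_modifiedEvolution hr, ofReal_norm]

lemma circFun_add (r : ℝ) (e e' : ℝ → ℂ) :
    circFun r (fun y => e y + e' y) = fun θ => circFun r e θ + circFun r e' θ := by
  ext θ
  unfold circFun
  by_cases h : θ ∈ halfAngles
  · simp only [Set.indicator_of_mem h]; ring
  · simp only [Set.indicator_of_notMem h, add_zero]

lemma modifiedEvolution_congr_ae {r : ℝ} {e e' : ℝ → ℂ} (h : e =ᵐ[volume] e') (p : ℝ × ℝ) :
    modifiedEvolution r e p = modifiedEvolution r e' p := by
  rw [modifiedEvolution_eq_integral, modifiedEvolution_eq_integral]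
  congr 1
  refine integral_congr_ae ?_
  filter_upwards [ae_restrict_of_ae h] with y hy
  rw [hy]

lemma ENNReal_add_pow_six_le (a b : ℝ≥0∞) : (a + b) ^ 6 ≤ 64 * (a ^ 6 + b ^ 6) := by
  rcases le_total a b with h | h
  · calc (a + b) ^ 6 ≤ (b + b) ^ 6 := by gcongr
      _ = 64 * b ^ 6 := by ring
      _ ≤ _ := by gcongr; exact le_add_self
  · calc (a + b) ^ 6 ≤ (a + a) ^ 6 := by gcongr
      _ = 64 * a ^ 6 := by ring
      _ ≤ _ := by gcongr; exact le_self_add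

lemma lintegral_modifiedEvolution_add_le {r : ℝ} (hr : 0 < r) {e e' : ℝ → ℂ} (he : Measurable e)
    (he' : Measurable e') (h : ∫⁻ y, ‖e y‖ₑ ^ 2 < ⊤) (h' : ∫⁻ y, ‖e' y‖ₑ ^ 2 < ⊤) :
    ∫⁻ p, ‖modifiedEvolution r (fun y => e y + e' y) p‖ₑ ^ 6 ≤
      64 * ((∫⁻ p, ‖modifiedEvolution r e p‖ₑ ^ 6) +
        ∫⁻ p, ‖modifiedEvolution r e' p‖ₑ ^ 6) := by
  have hi := integrable_circFun hr he h
  have hi' := integrable_circFun hr he' h'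
  have hm : Measurable fun p => ‖modifiedEvolution r e p‖ₑ ^ 6 := by
    simp_rw [enorm_modifiedEvolution hr]
    exact (continuous_oscInt measurable_circlePoint hi).measurable.enorm.pow_const 6
  rw [← lintegral_add_left hm, ← lintegral_const_mul' _ _ ENNReal.ofNat_ne_top]
  refine lintegral_mono fun p => ?_
  rw [enorm_modifiedEvolution hr, enorm_modifiedEvolution hr, enorm_modifiedEvolution hr,
    circFun_add, oscInt_add measurable_circlePoint hi hi']
  exact (pow_le_pow_left₀ zero_le (enorm_add_le _ _) 6).trans (ENNReal_add_pow_six_le _ _)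

/-- The half circle is a union of two quarter circles, each covered by the restriction inequality.
-/
lemma exists_lintegral_modifiedEvolution_le : ∃ C : ℝ≥0∞, C ≠ ⊤ ∧ ∀ (r : ℝ), 0 < r →
    ∀ e : ℝ → ℂ, Measurable e → ∫⁻ y, ‖e y‖ₑ ^ 2 < ⊤ →
    ∫⁻ p, ‖modifiedEvolution r e p‖ₑ ^ 6 ≤ C * (∫⁻ y, ‖e y‖ₑ ^ 2) ^ 3 := by
  obtain ⟨C, hC, h⟩ := exists_lintegral_arcExt_le_cube
  refine ⟨64 * (C + C), ENNReal.mul_ne_top (by simp) (ENNReal.add_ne_top.2 ⟨hC, hC⟩), ?_⟩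
  intro r hr e he hfin
  have hi := integrable_circFun hr he hfin
  have hL := memLp_circFun hr he hfin
  have hpi := Real.pi_pos
  have hsplit : ∀ p, oscInt volume circlePoint (circFun r e) p =
      arcExt (-(Real.pi / 2)) (circFun r e) p + arcExt 0 (circFun r e) p := fun p => by
    unfold arcExt oscInt arc
    let G : ℝ → ℂ := fun y => Complex.exp (Complex.I *
      ((p.1 * (circlePoint y).1 + p.2 * (circlePoint y).2 : ℝ) : ℂ)) * circFun r e y
    have hG : Integrable G := integrable_oscInt_integrand measurable_circlePoint hi p
    have h1 : ∫ y, G y = ∫ y in Set.Icc (-(Real.pi / 2)) (Real.pi / 2), G y := by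
      refine (setIntegral_eq_integral_of_forall_compl_eq_zero fun y hy => ?_).symm
      have : y ∉ halfAngles := fun h' => hy (Set.Ioo_subset_Icc_self h')
      simp only [G, circFun, Set.indicator_of_notMem this, mul_zero]
    have h2 : Set.Icc (-(Real.pi / 2)) (Real.pi / 2) =
        Set.Icc (-(Real.pi / 2)) 0 ∪ Set.Ioc 0 (Real.pi / 2) :=
      (Set.Icc_union_Ioc_eq_Icc (by linarith) (by linarith)).symm
    change ∫ y, G y = _
    rw [h1, h2, setIntegral_union _ measurableSet_Ioc hG.integrableOn hG.integrableOn,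
      ← integral_Icc_eq_integral_Ioc, neg_add_cancel, zero_add]
    rw [Set.disjoint_left]
    intro y hy hy'
    exact absurd hy.2 (not_le.2 hy'.1)
  have hN : ∀ α, ∫⁻ a, ‖circFun r e a‖ₑ ^ 2 ∂(arc α) ≤ ∫⁻ y, ‖e y‖ₑ ^ 2 := fun α =>
    (setLIntegral_le_lintegral _ _).trans (lintegral_circFun_sq_le hr e)
  have hm : Measurable fun p => ‖arcExt (-(Real.pi / 2)) (circFun r e) p‖ₑ ^ 6 :=
    (continuous_oscInt measurable_circlePoint
      (hi.mono_measure Measure.restrict_le_self)).measurable.enorm.pow_const 6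
  have hE : ∀ α, ∫⁻ p, ‖arcExt α (circFun r e) p‖ₑ ^ 6 ≤ C * (∫⁻ y, ‖e y‖ₑ ^ 2) ^ 3 := fun α =>
    (h α _ (hL.restrict _)).trans (mul_le_mul_right (pow_le_pow_left₀ zero_le (hN α) 3) _)
  calc ∫⁻ p, ‖modifiedEvolution r e p‖ₑ ^ 6
      ≤ ∫⁻ p, 64 * (‖arcExt (-(Real.pi / 2)) (circFun r e) p‖ₑ ^ 6 +
          ‖arcExt 0 (circFun r e) p‖ₑ ^ 6) := by
        refine lintegral_mono fun p => ?_
        rw [enorm_modifiedEvolution hr, hsplit]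
        exact (pow_le_pow_left₀ zero_le (enorm_add_le _ _) 6).trans (ENNReal_add_pow_six_le _ _)
    _ ≤ 64 * (C * (∫⁻ y, ‖e y‖ₑ ^ 2) ^ 3 + C * (∫⁻ y, ‖e y‖ₑ ^ 2) ^ 3) := by
        rw [lintegral_const_mul' _ _ ENNReal.ofNat_ne_top, lintegral_add_left hm]
        exact mul_le_mul_right (add_le_add (hE _) (hE _)) _
    _ = _ := by ring

/-- Support in $|y|\le N$ with $rN\le1/2<\sin(\pi/4)$ fits in one quarter circle. The scale $\delta$
in $y$ is $r\delta$ in angle, and the square of the factor $\sqrt r$ in the supremum bound cancels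
the resulting $1/r$. -/
lemma exists_lintegral_modifiedEvolution_le_of_support : ∃ C : ℝ≥0∞, C ≠ ⊤ ∧
    ∀ (r N δ : ℝ), 0 < r → r * N ≤ 1 / 2 → 0 < δ →
    ∀ e : ℝ → ℂ, Measurable e → ∫⁻ y, ‖e y‖ₑ ^ 2 < ⊤ → (∀ y, N < |y| → e y = 0) →
    ∀ m B : ℝ≥0∞, (∀ a, ∫⁻ b in Set.Ioo (a - δ) (a + δ), ‖e b‖ₑ ^ 2 ≤ m) →
    (∀ p, ‖modifiedEvolution r e p‖ₑ ≤ ENNReal.ofReal √r * B) →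
    ∫⁻ p, ‖modifiedEvolution r e p‖ₑ ^ 6 ≤
      C * (∫⁻ y, ‖e y‖ₑ ^ 2) ^ 2 * (m + B ^ 2 * ENNReal.ofReal (1 / δ)) := by
  obtain ⟨C, hC, h⟩ := exists_lintegral_arcExt_le
  refine ⟨C, hC, ?_⟩
  intro r N δ hr hrN hδ e he hfin hsupp m B hm hB
  have hL := memLp_circFun hr he hfin
  have hpi := Real.pi_pos
  let α := -(Real.pi / 4)
  have hα : α + Real.pi / 2 = Real.pi / 4 := by simp only [α]; ring
  have hzero : ∀ θ, θ ∉ Set.Icc α (α + Real.pi / 2) → circFun r e θ = 0 := fun θ hθ => by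
    rw [hα] at hθ
    unfold circFun
    by_cases hh : θ ∈ halfAngles
    · rw [Set.indicator_of_mem hh, hsupp, mul_zero]
      rw [abs_div, abs_of_pos hr, lt_div_iff₀ hr, mul_comm]
      refine hrN.trans_lt ?_
      have h4 : Real.pi / 4 < |θ| := by
        by_contra h5
        exact hθ (abs_le.1 (not_lt.1 h5))
      have h6 : |θ| < Real.pi / 2 := abs_lt.2 hh
      have h7 : Real.sin (Real.pi / 4) < Real.sin |θ| :=
        Real.sin_lt_sin_of_lt_of_le_pi_div_two (by linarith) h6.le h4
      rw [Real.sin_pi_div_four] at h7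
      have h8 : (1 : ℝ) ≤ √2 := Real.one_le_sqrt.2 one_le_two
      have h9 : Real.sin |θ| ≤ |Real.sin θ| := by
        rcases abs_choice θ with h | h <;> rw [h]
        · exact le_abs_self _
        · rw [Real.sin_neg]; exact neg_le_abs _
      linarith
    · rw [Set.indicator_of_notMem hh]
  have heq : ∀ p, arcExt α (circFun r e) p = oscInt volume circlePoint (circFun r e) p := fun p => by
    unfold arcExt oscInt arc
    refine setIntegral_eq_integral_of_forall_compl_eq_zero fun θ hθ => ?_
    rw [hzero θ hθ, mul_zero]
  have hmain := h α (r * δ) (by positivity) (circFun r e) (hL.restrict _) m (ENNReal.ofReal √r * B)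
    (fun a => by
      refine le_trans ?_ ((lintegral_circFun_Ioo_le hr e a δ).trans (hm _))
      exact lintegral_mono' (Measure.restrict_mono_measure Measure.restrict_le_self _) le_rfl)
    (fun p => by
      rw [heq, ← enorm_modifiedEvolution hr]
      exact hB p)
  simp_rw [heq, ← enorm_modifiedEvolution hr] at hmain
  refine hmain.trans ?_
  have h1 : (ENNReal.ofReal √r * B) ^ 2 * ENNReal.ofReal (1 / (r * δ)) =
      B ^ 2 * ENNReal.ofReal (1 / δ) := by
    have h2 : ENNReal.ofReal (1 / δ) = ENNReal.ofReal r * ENNReal.ofReal (1 / (r * δ)) := by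
      rw [← ENNReal.ofReal_mul hr.le]
      congr 1
      field_simp
    rw [h2, mul_pow, ← ENNReal.ofReal_pow (Real.sqrt_nonneg _), Real.sq_sqrt hr.le]
    ring
  rw [h1]
  have hN : ∫⁻ a, ‖circFun r e a‖ₑ ^ 2 ∂(arc α) ≤ ∫⁻ y, ‖e y‖ₑ ^ 2 :=
    (setLIntegral_le_lintegral _ _).trans (lintegral_circFun_sq_le hr e)
  exact mul_le_mul_left (mul_le_mul_right (pow_le_pow_left₀ zero_le hN 2) _) _

/-! ### Functions on the circle in the coordinates of a cap -/

/-- The unit speed parametrization of the circle adapted to an orthonormal frame. -/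
noncomputable def frameCurve (z w : Plane) (θ : ℝ) : Plane := Real.cos θ • z + Real.sin θ • w

lemma measurable_frameCurve (z w : Plane) : Measurable (frameCurve z w) := by
  unfold frameCurve; fun_prop

lemma continuous_unitCircle :
    Continuous (fun θ : ℝ => (!₂[Real.cos θ, Real.sin θ] : Plane)) := by
  refine (PiLp.continuous_toLp 2 _).comp (continuous_pi fun i => ?_)
  fin_cases i
  · exact Real.continuous_cos
  · exact Real.continuous_sin

/-- An orthonormal frame of the plane is a rotation of the standard one, up to a reflection; `ε` is
its orientation and `α` the argument of `z`. -/
lemma exists_frameCurve_eq {z w : Plane} (hz : ‖z‖ = 1) (hw : ‖w‖ = 1) (hzw : inner ℝ z w = 0) :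
    ∃ α ε : ℝ, (ε = 1 ∨ ε = -1) ∧
      ∀ θ, frameCurve z w θ = !₂[Real.cos (α + ε * θ), Real.sin (α + ε * θ)] := by
  have h1 : z 0 ^ 2 + z 1 ^ 2 = 1 := by
    have h := EuclideanSpace.norm_sq_eq z
    rw [hz] at h
    simpa using h.symm
  have h2 : w 0 ^ 2 + w 1 ^ 2 = 1 := by
    have h := EuclideanSpace.norm_sq_eq w
    rw [hw] at h
    simpa using h.symm
  have h3 : z 0 * w 0 + z 1 * w 1 = 0 := by
    rw [PiLp.inner_apply] at hzw
    simp only [Fin.sum_univ_two, RCLike.inner_apply, conj_trivial] at hzw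
    linarith
  obtain ⟨α, hα0, hα1⟩ : ∃ α : ℝ, z 0 = Real.cos α ∧ z 1 = Real.sin α := by
    have hn : ‖(⟨z 0, z 1⟩ : ℂ)‖ = 1 := by
      rw [Complex.norm_def, Complex.normSq_mk, ← sq, ← sq, h1, Real.sqrt_one]
    have hne : (⟨z 0, z 1⟩ : ℂ) ≠ 0 := by
      intro h
      rw [h, norm_zero] at hn
      exact zero_ne_one hn
    refine ⟨Complex.arg ⟨z 0, z 1⟩, ?_, ?_⟩
    · rw [Complex.cos_arg hne, hn, div_one]
    · rw [Complex.sin_arg, hn, div_one]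
  let ε := w 1 * z 0 - w 0 * z 1
  have hε : ε ^ 2 = 1 := by
    have : ε ^ 2 = (z 0 ^ 2 + z 1 ^ 2) * (w 0 ^ 2 + w 1 ^ 2) - (z 0 * w 0 + z 1 * w 1) ^ 2 := by
      simp only [ε]; ring
    rw [this, h1, h2, h3]; norm_num
  have hε1 : ε = 1 ∨ ε = -1 := by
    have h : (ε - 1) * (ε + 1) = 0 := by linear_combination hε
    rcases mul_eq_zero.1 h with h | h
    · exact Or.inl (by linarith)
    · exact Or.inr (by linarith)
  have hw0 : w 0 = -ε * z 1 := by
    have : -ε * z 1 = w 0 * (z 0 ^ 2 + z 1 ^ 2) - z 0 * (z 0 * w 0 + z 1 * w 1) := by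
      simp only [ε]; ring
    rw [this, h1, h3]; ring
  have hw1 : w 1 = ε * z 0 := by
    have : ε * z 0 = w 1 * (z 0 ^ 2 + z 1 ^ 2) - z 1 * (z 0 * w 0 + z 1 * w 1) := by
      simp only [ε]; ring
    rw [this, h1, h3]; ring
  refine ⟨α, ε, hε1, fun θ => ?_⟩
  have hcs : Real.cos (ε * θ) = Real.cos θ ∧ Real.sin (ε * θ) = ε * Real.sin θ := by
    rcases hε1 with h | h <;> rw [h] <;> simp
  ext i
  fin_cases i
  · simp [frameCurve, Real.cos_add, hcs.1, hcs.2, hw0, hα0, hα1]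
    ring
  · simp [frameCurve, Real.sin_add, hcs.1, hcs.2, hw1, hα0, hα1]
    ring

lemma lintegral_Ioc_periodic_eq {h : ℝ → ℝ≥0∞} (hper : Function.Periodic h (2 * Real.pi))
    (a b : ℝ) : ∫⁻ θ in Set.Ioc a (a + 2 * Real.pi), h θ =
      ∫⁻ θ in Set.Ioc b (b + 2 * Real.pi), h θ := by
  have : VAddInvariantMeasure (AddSubgroup.zmultiples (2 * Real.pi)) ℝ volume :=
    ⟨fun c s _ => measure_preimage_add _ _ _⟩
  exact IsAddFundamentalDomain.setLIntegral_eq (G := AddSubgroup.zmultiples (2 * Real.pi))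
    (isAddFundamentalDomain_Ioc Real.two_pi_pos a) (isAddFundamentalDomain_Ioc Real.two_pi_pos b)
    h hper.map_vadd_zmultiples

/-- Arc length is invariant under rotations and reflections: a period of a periodic function may
start anywhere and be traversed in either direction. -/
lemma map_frameCurve {z w : Plane} (hz : ‖z‖ = 1) (hw : ‖w‖ = 1) (hzw : inner ℝ z w = 0) :
    (volume.restrict (Set.Ioc (-Real.pi) Real.pi)).map (frameCurve z w) = arcMeasure := by
  obtain ⟨α, ε, hε, hγ⟩ := exists_frameCurve_eq hz hw hzw
  have hper : ∀ G : Plane → ℝ≥0∞, Function.Periodic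
      (fun θ : ℝ => G !₂[Real.cos θ, Real.sin θ]) (2 * Real.pi) := fun G θ => by
    simp only [Real.cos_add_two_pi, Real.sin_add_two_pi]
  refine Measure.ext_of_lintegral _ fun G hG => ?_
  let h : ℝ → ℝ≥0∞ := fun θ => G !₂[Real.cos θ, Real.sin θ]
  have hm : Measurable h := hG.comp continuous_unitCircle.measurable
  have hpi : -Real.pi + 2 * Real.pi = Real.pi := by ring
  have hbase : ∀ a, ∫⁻ θ in Set.Ioc a (a + 2 * Real.pi), h θ =
      ∫⁻ θ in Set.Ioc (-Real.pi) Real.pi, h θ := fun a => by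
    rw [lintegral_Ioc_periodic_eq (hper G) a (-Real.pi), hpi]
  rw [arcMeasure, lintegral_map hG (measurable_frameCurve z w),
    lintegral_map hG continuous_unitCircle.measurable]
  simp_rw [hγ]
  change ∫⁻ θ in Set.Ioc (-Real.pi) Real.pi, h (α + ε * θ) = _
  rcases hε with rfl | rfl
  · rw [← hbase (α + -Real.pi), ← lintegral_indicator measurableSet_Ioc,
      ← lintegral_indicator measurableSet_Ioc, ← lintegral_add_left_eq_self
        ((Set.Ioc (α + -Real.pi) (α + -Real.pi + 2 * Real.pi)).indicator h) α]
    refine lintegral_congr fun θ => ?_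
    have hiff : θ ∈ Set.Ioc (-Real.pi) Real.pi ↔
        α + θ ∈ Set.Ioc (α + -Real.pi) (α + -Real.pi + 2 * Real.pi) := by
      simp only [Set.mem_Ioc]
      constructor <;> rintro ⟨h1, h2⟩ <;> constructor <;> linarith
    by_cases hθ : θ ∈ Set.Ioc (-Real.pi) Real.pi
    · rw [Set.indicator_of_mem hθ, Set.indicator_of_mem (hiff.1 hθ), one_mul]
    · rw [Set.indicator_of_notMem hθ, Set.indicator_of_notMem fun h' => hθ (hiff.2 h')]
  -- Reflection exchanges the open and the closed end of the interval, hence the passage to the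
  -- other half-open interval.
  · rw [← hbase (α + -Real.pi), ← restrict_Ico_eq_restrict_Ioc (a := α + -Real.pi),
      ← lintegral_indicator measurableSet_Ioc,
      ← lintegral_indicator measurableSet_Ico, ← lintegral_sub_left_eq_self
        ((Set.Ico (α + -Real.pi) (α + -Real.pi + 2 * Real.pi)).indicator h) α]
    refine lintegral_congr fun θ => ?_
    have hiff : θ ∈ Set.Ioc (-Real.pi) Real.pi ↔
        α - θ ∈ Set.Ico (α + -Real.pi) (α + -Real.pi + 2 * Real.pi) := by
      simp only [Set.mem_Ioc, Set.mem_Ico]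
      constructor <;> rintro ⟨h1, h2⟩ <;> constructor <;> linarith
    by_cases hθ : θ ∈ Set.Ioc (-Real.pi) Real.pi
    · rw [Set.indicator_of_mem hθ, Set.indicator_of_mem (hiff.1 hθ)]
      congr 1
      ring
    · rw [Set.indicator_of_notMem hθ, Set.indicator_of_notMem fun h' => hθ (hiff.2 h')]

lemma halfAngles_subset : halfAngles ⊆ Set.Ioc (-Real.pi) Real.pi := fun θ hθ => by
  have := Real.pi_pos
  exact ⟨by linarith [hθ.1], by linarith [hθ.2]⟩

lemma capMap_sin_div {z w : Plane} {r θ : ℝ} (hr : 0 < r) (hθ : θ ∈ halfAngles) :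
    capMap z w r (Real.sin θ / r) = frameCurve z w θ := by
  unfold capMap frameCurve
  rw [one_sub_sin_div_sq hr, Real.sqrt_sq (cos_pos_of_mem_halfAngles hθ).le,
    mul_div_cancel₀ _ hr.ne', add_comm]

lemma measurable_capMap {z w : Plane} (r : ℝ) : Measurable (capMap z w r) := by
  unfold capMap; fun_prop

lemma lintegral_arcMeasure_eq {z w : Plane} (hz : ‖z‖ = 1) (hw : ‖w‖ = 1)
    (hzw : inner ℝ z w = 0) {G : Plane → ℝ≥0∞} (hG : AEMeasurable G arcMeasure) :
    ∫⁻ x, G x ∂arcMeasure = ∫⁻ θ in Set.Ioc (-Real.pi) Real.pi, G (frameCurve z w θ) := by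
  rw [← map_frameCurve hz hw hzw] at hG ⊢
  exact lintegral_map' hG (measurable_frameCurve z w).aemeasurable

/-- Functions on the circle are only defined almost everywhere; preservation of null sets makes the
rescaled function well defined and measurable. -/
lemma quasiMeasurePreserving_capMap {z w : Plane} (hz : ‖z‖ = 1) (hw : ‖w‖ = 1)
    (hzw : inner ℝ z w = 0) {r : ℝ} (hr : 0 < r) :
    Measure.QuasiMeasurePreserving (capMap z w r) (volume.restrict (chartDomain r)) arcMeasure := by
  refine ⟨measurable_capMap r, Measure.AbsolutelyContinuous.mk fun Z hZ h0 => ?_⟩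
  have hm : Measurable (Z.indicator fun _ => (1 : ℝ≥0∞)) := measurable_const.indicator hZ
  have h1 : ∫⁻ θ in Set.Ioc (-Real.pi) Real.pi, Z.indicator (fun _ => (1 : ℝ≥0∞))
      (frameCurve z w θ) = 0 := by
    rw [← lintegral_arcMeasure_eq hz hw hzw hm.aemeasurable, lintegral_indicator hZ]
    simpa using h0
  rw [lintegral_eq_zero_iff
    (f := fun θ => Z.indicator (fun _ => (1 : ℝ≥0∞)) (frameCurve z w θ))
    (hm.comp (measurable_frameCurve z w))] at h1
  have h2 : (Measure.map (capMap z w r) (volume.restrict (chartDomain r))) Z =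
      ∫⁻ y in chartDomain r, Z.indicator (fun _ => (1 : ℝ≥0∞)) (capMap z w r y) := by
    rw [← lintegral_map hm (measurable_capMap r), lintegral_indicator hZ]
    simp
  rw [h2, lintegral_chartDomain hr]
  refine lintegral_eq_zero_of_ae_eq_zero ?_
  have h3 := ae_restrict_of_ae_restrict_of_subset halfAngles_subset h1
  filter_upwards [h3, ae_restrict_mem measurableSet_halfAngles] with θ h4 hθ
  rw [capMap_sin_div hr hθ]
  simp only [Pi.zero_apply] at h4 ⊢
  rw [h4, mul_zero]

lemma aestronglyMeasurable_rescaled {z w : Plane} (hz : ‖z‖ = 1) (hw : ‖w‖ = 1)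
    (hzw : inner ℝ z w = 0) {r : ℝ} (hr : 0 < r) {f : Plane → ℝ}
    (hf : AEStronglyMeasurable f arcMeasure) :
    AEStronglyMeasurable (rescaled z w r f) volume := by
  unfold rescaled
  rw [aestronglyMeasurable_indicator_iff (measurableSet_chartDomain r)]
  have h1 := hf.comp_quasiMeasurePreserving (quasiMeasurePreserving_capMap hz hw hzw hr)
  have h2 : Measurable fun y : ℝ => ((1 - r ^ 2 * y ^ 2) ^ (1 / 4 : ℝ))⁻¹ := by fun_prop
  exact (h1.const_mul _).mul h2.aestronglyMeasurable

lemma enorm_rescaled_sq {z w : Plane} {r θ : ℝ} (hr : 0 < r) (hθ : θ ∈ halfAngles) (f : Plane → ℝ) :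
    ENNReal.ofReal (Real.cos θ / r) * ‖rescaled z w r f (Real.sin θ / r)‖ₑ ^ 2 =
      ‖f (frameCurve z w θ)‖ₑ ^ 2 := by
  have hc := cos_pos_of_mem_halfAngles hθ
  have hmem : Real.sin θ / r ∈ chartDomain r := by
    rw [← image_sin_div hr]; exact ⟨θ, hθ, rfl⟩
  have h2 : (1 - r ^ 2 * (Real.sin θ / r) ^ 2) ^ (1 / 4 : ℝ) = √(Real.cos θ) := by
    rw [one_sub_sin_div_sq hr, Real.sqrt_eq_rpow, ← Real.rpow_natCast, ← Real.rpow_mul hc.le]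
    norm_num
  rw [rescaled, Set.indicator_of_mem hmem, h2, capMap_sin_div hr hθ, ← Real.sqrt_eq_rpow,
    Real.enorm_eq_ofReal_abs, Real.enorm_eq_ofReal_abs, ← ENNReal.ofReal_pow (abs_nonneg _),
    ← ENNReal.ofReal_pow (abs_nonneg _), ← ENNReal.ofReal_mul (div_pos hc hr).le, sq_abs, sq_abs,
    div_pow, mul_pow, Real.sq_sqrt hr.le, Real.sq_sqrt hc.le]
  congr 1
  field_simp

lemma lintegral_rescaled_sq {z w : Plane} {r : ℝ} (hr : 0 < r) (f : Plane → ℝ) {A : Set ℝ}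
    (hA : MeasurableSet A) :
    ∫⁻ y in A, ‖rescaled z w r f y‖ₑ ^ 2 = ∫⁻ θ in halfAngles,
      A.indicator (fun _ => ‖f (frameCurve z w θ)‖ₑ ^ 2) (Real.sin θ / r) := by
  have h1 : ∫⁻ y in A, ‖rescaled z w r f y‖ₑ ^ 2 =
      ∫⁻ y in chartDomain r, A.indicator (fun y => ‖rescaled z w r f y‖ₑ ^ 2) y := by
    rw [← lintegral_indicator hA, ← lintegral_indicator (measurableSet_chartDomain r)]
    refine lintegral_congr fun y => ?_
    by_cases hy : y ∈ chartDomain r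
    · rw [Set.indicator_of_mem hy]
    · rw [Set.indicator_of_notMem hy]
      by_cases hyA : y ∈ A
      · rw [Set.indicator_of_mem hyA, rescaled, Set.indicator_of_notMem hy]
        simp
      · rw [Set.indicator_of_notMem hyA]
  rw [h1, lintegral_chartDomain hr]
  refine setLIntegral_congr_fun measurableSet_halfAngles fun θ hθ => ?_
  by_cases hyA : Real.sin θ / r ∈ A
  · rw [Set.indicator_of_mem hyA, Set.indicator_of_mem hyA, enorm_rescaled_sq hr hθ]
  · rw [Set.indicator_of_notMem hyA, Set.indicator_of_notMem hyA, mul_zero]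

lemma lintegral_halfAngles_le {z w : Plane} (hz : ‖z‖ = 1) (hw : ‖w‖ = 1)
    (hzw : inner ℝ z w = 0) {f : Plane → ℝ} (hf : AEStronglyMeasurable f arcMeasure)
    {S : Set Plane} (hS : NullMeasurableSet S arcMeasure) :
    ∫⁻ θ in halfAngles, S.indicator (fun x => ‖f x‖ₑ ^ 2) (frameCurve z w θ) ≤
      ∫⁻ x in S, ‖f x‖ₑ ^ 2 ∂arcMeasure := by
  rw [← lintegral_indicator₀ hS, lintegral_arcMeasure_eq hz hw hzw
    ((hf.enorm.pow_const 2).indicator₀ hS)]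
  exact lintegral_mono_set halfAngles_subset

/-- The cap lies in the open hemisphere $\cos\theta>0$, so nothing is lost outside the chart; the
two endpoints $\pm\pi/2$ are a null set. -/
lemma lintegral_rescaled_sq_eq {z w : Plane} (hz : ‖z‖ = 1) (hw : ‖w‖ = 1)
    (hzw : inner ℝ z w = 0) {r ρ : ℝ} (hr : 0 < r) {f : Plane → ℝ}
    (hf : AEStronglyMeasurable f arcMeasure)
    (hsupp : ∀ᵐ x ∂arcMeasure, x ∉ cap z ρ → f x = 0) :
    ∫⁻ y, ‖rescaled z w r f y‖ₑ ^ 2 = ∫⁻ x, ‖f x‖ₑ ^ 2 ∂arcMeasure := by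
  have h1 := lintegral_rescaled_sq (z := z) (w := w) hr f MeasurableSet.univ
  rw [Measure.restrict_univ] at h1
  simp only [Set.indicator_univ] at h1
  rw [h1, lintegral_arcMeasure_eq hz hw hzw (hf.enorm.pow_const 2),
    ← lintegral_indicator measurableSet_halfAngles, ← lintegral_indicator measurableSet_Ioc]
  rw [← map_frameCurve hz hw hzw] at hsupp
  have h2 := ae_of_ae_map (measurable_frameCurve z w).aemeasurable hsupp
  rw [ae_restrict_iff' measurableSet_Ioc] at h2
  refine lintegral_congr_ae ?_
  have h3 : ∀ᵐ θ : ℝ, θ ≠ Real.pi / 2 := by simp [ae_iff]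
  have h4 : ∀ᵐ θ : ℝ, θ ≠ -(Real.pi / 2) := by simp [ae_iff]
  filter_upwards [h2, h3, h4] with θ hθ hθ3 hθ4
  by_cases hh : θ ∈ halfAngles
  · rw [Set.indicator_of_mem hh, Set.indicator_of_mem (halfAngles_subset hh)]
  · rw [Set.indicator_of_notMem hh]
    by_cases hI : θ ∈ Set.Ioc (-Real.pi) Real.pi
    · rw [Set.indicator_of_mem hI, hθ hI]
      · simp
      · rintro ⟨-, hpos, -⟩
        have h5 : inner ℝ z (frameCurve z w θ) = Real.cos θ := by
          unfold frameCurve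
          rw [inner_add_right, inner_smul_right, inner_smul_right, hzw,
            real_inner_self_eq_norm_sq, hz]
          ring
        rw [h5] at hpos
        refine not_le.2 hpos ?_
        rcases le_or_gt θ 0 with h6 | h6
        · have h7 : θ < -(Real.pi / 2) := by
            by_contra h8
            exact hh ⟨lt_of_le_of_ne (not_lt.1 h8) hθ4.symm, by linarith [Real.pi_pos]⟩
          rw [← Real.cos_neg]
          exact Real.cos_nonpos_of_pi_div_two_le_of_le (by linarith)
            (by linarith [hI.1, Real.pi_pos])
        · have h7 : Real.pi / 2 < θ := by
            by_contra h8
            exact hh ⟨by linarith [Real.pi_pos], lt_of_le_of_ne (not_lt.1 h8) hθ3⟩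
          exact Real.cos_nonpos_of_pi_div_two_le_of_le h7.le (by linarith [hI.2, Real.pi_pos])
    · rw [Set.indicator_of_notMem hI]

lemma setLIntegral_sq_le_of_setIntegral_le {f : Plane → ℝ} (hf : MemLp f 2 arcMeasure)
    {S : Set Plane} {T : ℝ} (h : ∫ x in S, |f x| ^ 2 ∂arcMeasure ≤ T) :
    ∫⁻ x in S, ‖f x‖ₑ ^ 2 ∂arcMeasure ≤ ENNReal.ofReal T := by
  have hi : Integrable (fun x => |f x| ^ 2) arcMeasure := by
    have := hf.integrable_norm_pow (by norm_num)
    simpa using this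
  refine le_trans (le_of_eq ?_) (ENNReal.ofReal_le_ofReal h)
  rw [ofReal_integral_eq_lintegral_ofReal hi.integrableOn
    (Eventually.of_forall fun x => sq_nonneg _)]
  refine lintegral_congr fun x => ?_
  rw [Real.enorm_eq_ofReal_abs, ENNReal.ofReal_pow (abs_nonneg _)]

/-- At angle $\theta$ one has $r|y|=|\sin\theta|=|\langle w,x-z\rangle|\le|x-z|$, so a tail in $y$
lies in a tail on the circle. -/
lemma lintegral_rescaled_tail_le {z w : Plane} (hz : ‖z‖ = 1) (hw : ‖w‖ = 1)
    (hzw : inner ℝ z w = 0) {C : ℝ} {Θ : ℝ → ℝ} {r : ℝ} (hr : 0 < r) {f : Plane → ℝ}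
    (hf : UpperNormalized C Θ z r f) {N : ℝ} (hN : 1 ≤ N) :
    ∫⁻ y in {y | N ≤ |y|}, ‖rescaled z w r f y‖ₑ ^ 2 ≤ ENNReal.ofReal (Θ N) := by
  have hS : MeasurableSet {x : Plane | N * r ≤ ‖x - z‖} :=
    measurableSet_le measurable_const (by fun_prop)
  rw [lintegral_rescaled_sq hr f (measurableSet_le measurable_const (by fun_prop))]
  refine le_trans ?_ ((lintegral_halfAngles_le hz hw hzw hf.memLp.aestronglyMeasurable
    hS.nullMeasurableSet).trans (setLIntegral_sq_le_of_setIntegral_le hf.memLp (hf.tail N hN)))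
  refine lintegral_mono fun θ => ?_
  by_cases hθ : Real.sin θ / r ∈ {y | N ≤ |y|}
  · have h1 : N * r ≤ |Real.sin θ| := by
      have h2 : N ≤ |Real.sin θ / r| := hθ
      rwa [abs_div, abs_of_pos hr, le_div_iff₀ hr] at h2
    have h3 : |Real.sin θ| ≤ ‖frameCurve z w θ - z‖ := by
      have h4 : inner ℝ w (frameCurve z w θ - z) = Real.sin θ := by
        unfold frameCurve
        rw [inner_sub_right, inner_add_right, inner_smul_right, inner_smul_right,
          real_inner_comm, hzw, real_inner_self_eq_norm_sq, hw]
        ring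
      rw [← h4]
      refine (abs_real_inner_le_norm _ _).trans ?_
      rw [hw, one_mul]
    have h5 : frameCurve z w θ ∈ {x : Plane | N * r ≤ ‖x - z‖} := h1.trans h3
    rw [Set.indicator_of_mem hθ, Set.indicator_of_mem h5]
  · rw [Set.indicator_of_notMem hθ]
    exact zero_le

/-- The part with $|f|>Rr^{-1/2}$ is controlled by the height condition. Elsewhere $|f|^2\le
R^2/r\le2R^2\cos\theta/r$, because $rN\le1/2$ forces $\cos\theta\ge1/2$, and this is $2R^2$ times
the Jacobian of the chart. -/
lemma lintegral_rescaled_short_le {z w : Plane} (hz : ‖z‖ = 1) (hw : ‖w‖ = 1)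
    (hzw : inner ℝ z w = 0) {C : ℝ} {Θ : ℝ → ℝ} {r : ℝ} (hr : 0 < r) {f : Plane → ℝ}
    (hf : UpperNormalized C Θ z r f) {N R : ℝ} (hR : 1 ≤ R) (hrN : r * N ≤ 1 / 2) {A : Set ℝ}
    (hA : MeasurableSet A) (hAN : A ⊆ Set.Icc (-N) N) :
    ∫⁻ y in A, ‖rescaled z w r f y‖ₑ ^ 2 ≤
      ENNReal.ofReal (Θ R) + ENNReal.ofReal (2 * R ^ 2) * volume A := by
  let S : Set Plane := {x | R * r ^ (-(1 / 2) : ℝ) < |f x|}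
  have hfm := hf.memLp.aestronglyMeasurable
  have hS : NullMeasurableSet S arcMeasure :=
    nullMeasurableSet_lt aemeasurable_const hfm.norm.aemeasurable
  have hmS := (lintegral_halfAngles_le hz hw hzw hfm hS).trans
    (setLIntegral_sq_le_of_setIntegral_le hf.memLp (hf.height R hR))
  have hA' : ∫⁻ θ in halfAngles, ENNReal.ofReal (2 * R ^ 2) * (ENNReal.ofReal (Real.cos θ / r) *
      A.indicator (fun _ => 1) (Real.sin θ / r)) ≤ ENNReal.ofReal (2 * R ^ 2) * volume A := by
    rw [lintegral_const_mul' _ _ ENNReal.ofReal_ne_top, ← lintegral_chartDomain hr]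
    refine mul_le_mul_right ((setLIntegral_le_lintegral _ _).trans (le_of_eq ?_)) _
    rw [lintegral_indicator hA]
    simp
  have hm2 : Measurable fun θ => ENNReal.ofReal (2 * R ^ 2) * (ENNReal.ofReal (Real.cos θ / r) *
      A.indicator (fun _ => (1 : ℝ≥0∞)) (Real.sin θ / r)) := by
    have : Measurable (A.indicator fun _ => (1 : ℝ≥0∞)) := measurable_const.indicator hA
    exact measurable_const.mul (Measurable.mul (by fun_prop) (this.comp (by fun_prop)))
  rw [lintegral_rescaled_sq hr f hA]
  refine le_trans ?_ (add_le_add hmS hA')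
  rw [← lintegral_add_right _ hm2]
  refine setLIntegral_mono' measurableSet_halfAngles fun θ hθ => ?_
  by_cases hmem : Real.sin θ / r ∈ A
  · rw [Set.indicator_of_mem hmem, Set.indicator_of_mem hmem, mul_one]
    by_cases hmS : frameCurve z w θ ∈ S
    · rw [Set.indicator_of_mem hmS]
      exact le_self_add
    · rw [Set.indicator_of_notMem hmS, zero_add]
      have h1 : |f (frameCurve z w θ)| ≤ R * r ^ (-(1 / 2) : ℝ) := not_lt.1 hmS
      have h2 := one_sub_pos (hAN hmem) hr hrN
      rw [one_sub_sin_div_sq hr] at h2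
      have h3 : 1 / 2 ≤ Real.cos θ := by
        have := cos_pos_of_mem_halfAngles hθ
        nlinarith
      have h4 : (r ^ (-(1 / 2) : ℝ)) ^ 2 = r⁻¹ := by
        rw [← Real.rpow_natCast, ← Real.rpow_mul hr.le]
        norm_num
        exact Real.rpow_neg_one r
      rw [← ENNReal.ofReal_mul (by positivity), Real.enorm_eq_ofReal_abs,
        ← ENNReal.ofReal_pow (abs_nonneg _)]
      refine ENNReal.ofReal_le_ofReal ?_
      calc |f (frameCurve z w θ)| ^ 2 ≤ (R * r ^ (-(1 / 2) : ℝ)) ^ 2 :=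
            pow_le_pow_left₀ (abs_nonneg _) h1 2
        _ = R ^ 2 * r⁻¹ * 1 := by rw [mul_pow, h4, mul_one]
        _ ≤ R ^ 2 * r⁻¹ * (2 * Real.cos θ) :=
            mul_le_mul_of_nonneg_left (by linarith) (by positivity)
        _ = 2 * R ^ 2 * (Real.cos θ / r) := by ring
  · rw [Set.indicator_of_notMem hmem]
    exact zero_le

/-! ### The sixth power bound for functions with small pairings -/

lemma lintegral_enorm_sq (f : L2) : ∫⁻ y, ‖f y‖ₑ ^ 2 = ENNReal.ofReal (‖f‖ ^ 2) := by
  rw [norm_sq_eq_integral, ofReal_integral_eq_lintegral_ofReal (integrable_norm_sq f)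
    (Eventually.of_forall fun y => sq_nonneg _)]
  refine lintegral_congr fun y => ?_
  rw [← ofReal_norm, ENNReal.ofReal_pow (norm_nonneg _)]

lemma lintegral_enorm_sq_restrictOp {A : Set ℝ} (hA : MeasurableSet A) (f : L2) :
    ∫⁻ y in A, ‖f y‖ₑ ^ 2 = ENNReal.ofReal (‖restrictOp A hA f‖ ^ 2) := by
  rw [← lintegral_enorm_sq, ← lintegral_indicator hA]
  refine lintegral_congr_ae ?_
  filter_upwards [coeFn_restrictOp hA f] with y hy
  rw [hy]
  by_cases h : y ∈ A <;> simp [h]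

/-- The weight `(1 - r² y²)^{-1/4}` on the interval `[-N, N]`. -/
noncomputable def chartWeight (r N : ℝ) : ℝ → ℂ :=
  (Set.Icc (-N) N).indicator fun y => ((((1 - r ^ 2 * y ^ 2) ^ (1 / 4 : ℝ))⁻¹ : ℝ) : ℂ)

lemma measurable_chartWeight (r N : ℝ) : Measurable (chartWeight r N) :=
  Measurable.indicator (by fun_prop) measurableSet_Icc

lemma chartWeight_zero (N : ℝ) : chartWeight 0 N = (Set.Icc (-N) N).indicator fun _ => 1 := by
  unfold chartWeight
  simp

lemma norm_chartWeight_sub_le {r N : ℝ} (hr : 0 < r) (hrN : r * N ≤ 1 / 2) (y : ℝ) :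
    ‖chartWeight r N y - chartWeight 0 N y‖ ≤ 2 * (r * N) ^ 2 * ‖chartWeight 0 N y‖ := by
  rw [chartWeight_zero]
  by_cases hy : y ∈ Set.Icc (-N) N
  · have h1 := one_sub_pos hy hr hrN
    have h2 : 0 ≤ r ^ 2 * y ^ 2 := by positivity
    have h3 : r ^ 2 * y ^ 2 ≤ (r * N) ^ 2 := by
      rw [mul_pow]
      exact mul_le_mul_of_nonneg_left (sq_le_sq' hy.1 hy.2) (sq_nonneg r)
    have h4 : (1 - r ^ 2 * y ^ 2) ^ (1 / 4 : ℝ) ≤ 1 :=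
      Real.rpow_le_one (by linarith) (by linarith) (by norm_num)
    have h5 : 1 - r ^ 2 * y ^ 2 ≤ (1 - r ^ 2 * y ^ 2) ^ (1 / 4 : ℝ) := by
      have := Real.rpow_le_rpow_of_exponent_ge (x := 1 - r ^ 2 * y ^ 2) (by linarith)
        (by linarith) (show (1 / 4 : ℝ) ≤ 1 by norm_num)
      rwa [Real.rpow_one] at this
    set c := (1 - r ^ 2 * y ^ 2) ^ (1 / 4 : ℝ) with hc
    have hc0 : 0 < c := by linarith
    rw [chartWeight, Set.indicator_of_mem hy, Set.indicator_of_mem hy, norm_one, mul_one, ← hc]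
    rw [← Complex.ofReal_one, ← Complex.ofReal_sub, Complex.norm_real, Real.norm_eq_abs,
      abs_of_nonneg (sub_nonneg.2 (one_le_inv_iff₀.2 ⟨hc0, h4⟩)), sub_le_iff_le_add,
      inv_le_iff_one_le_mul₀ hc0]
    nlinarith
  · rw [chartWeight, Set.indicator_of_notMem hy, Set.indicator_of_notMem hy]
    simp

lemma memLp_chartWeight {r N : ℝ} (hr : 0 ≤ r) (hrN : r * N ≤ 1 / 2) :
    MemLp (chartWeight r N) 2 volume := by
  have h0 : MemLp (chartWeight 0 N) 2 volume := by
    rw [chartWeight_zero]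
    exact memLp_indicator_const 2 measurableSet_Icc 1 (Or.inr (by simp))
  rcases eq_or_lt_of_le hr with rfl | hr
  · exact h0
  refine h0.of_le_mul (c := 1 + 2 * (r * N) ^ 2)
    (measurable_chartWeight r N).aestronglyMeasurable (Eventually.of_forall fun y => ?_)
  have h1 := norm_chartWeight_sub_le hr hrN y
  have h2 := norm_sub_norm_le (chartWeight r N y) (chartWeight 0 N y)
  linarith

/-- The moving weight converges in $L^2$, so pairings with it can be compared with pairings against
one fixed vector. -/
lemma norm_toLp_chartWeight_sub_le {r N : ℝ} (hr : 0 < r) (hrN : r * N ≤ 1 / 2) :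
    ‖(memLp_chartWeight hr.le hrN).toLp _ - (memLp_chartWeight le_rfl (by simp)).toLp
      (chartWeight 0 N)‖ ≤ 2 * (r * N) ^ 2 *
        ‖(memLp_chartWeight le_rfl (by simp)).toLp (chartWeight 0 N)‖ := by
  refine Lp.norm_le_mul_norm_of_ae_le_mul ?_
  filter_upwards [Lp.coeFn_sub ((memLp_chartWeight hr.le hrN).toLp _)
      ((memLp_chartWeight le_rfl (by simp)).toLp (chartWeight 0 N)),
    (memLp_chartWeight hr.le hrN).coeFn_toLp,
    (memLp_chartWeight le_rfl (by simp)).coeFn_toLp (f := chartWeight 0 N)] with y h1 h2 h3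
  rw [h1, Pi.sub_apply, h2, h3]
  exact norm_chartWeight_sub_le hr hrN y

/-- Evaluation at a point is a pairing of the modulated function with the chart weight. This links
the supremum of the evolution to weak limits over all frames. -/
lemma norm_modifiedEvolution_indicator {r N : ℝ} (hr : 0 < r) (hrN : r * N ≤ 1 / 2) (e : L2)
    (p : ℝ × ℝ) :
    ‖modifiedEvolution r ((Set.Icc (-N) N).indicator e) p‖ =
      √r * ‖inner ℂ (mulOp (mult r (r * p.2, r ^ 2 * p.1)) (continuous_mult _ _).measurable
        (fun y => (norm_mult _ _ y).le) e) ((memLp_chartWeight hr.le hrN).toLp _)‖ := by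
  rw [modifiedEvolution_eq_integral, norm_mul, Complex.norm_real, ← Real.sqrt_eq_rpow,
    Real.norm_eq_abs, abs_of_nonneg (Real.sqrt_nonneg _), inner_mulOp]
  congr 1
  rw [← RCLike.norm_conj (∫ y, _), ← integral_conj,
    ← integral_indicator (measurableSet_chartDomain r)]
  congr 1
  refine integral_congr_ae ?_
  filter_upwards [(memLp_chartWeight hr.le hrN).coeFn_toLp] with y hy
  rw [hy]
  by_cases h : y ∈ Set.Icc (-N) N
  · have hc : y ∈ chartDomain r := by
      have h1 := one_sub_pos h hr hrN
      change |r * y| < 1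
      rw [← sq_lt_one_iff_abs_lt_one, mul_pow]
      linarith
    rw [Set.indicator_of_mem hc, Set.indicator_of_mem h, chartWeight, Set.indicator_of_mem h,
      RCLike.inner_apply]
    simp only [map_mul, Complex.conj_ofReal, RingHomCompTriple.comp_apply,
      RingHom.id_apply]
    rw [div_eq_mul_inv, Complex.ofReal_inv]
    ring
  · rw [chartWeight, Set.indicator_of_notMem h]
    by_cases hc : y ∈ chartDomain r
    · rw [Set.indicator_of_mem hc, Set.indicator_of_notMem h]
      simp
    · rw [Set.indicator_of_notMem hc]
      simp

/-- The part on $[-N,N]$ is handled by the refined inequality and the tail by the plain one. -/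
lemma exists_lintegral_modifiedEvolution_split_le : ∃ C : ℝ, 0 ≤ C ∧
    ∀ (r N δ : ℝ) (hr : 0 < r) (hrN : r * N ≤ 1 / 2), 0 < δ → ∀ (e : L2) (E T m β : ℝ), 0 ≤ β →
    ‖e‖ ^ 2 ≤ E →
    ∫⁻ y in (Set.Icc (-N) N)ᶜ, ‖e y‖ₑ ^ 2 ≤ ENNReal.ofReal T →
    (∀ a, ∫⁻ y in Set.Ioo (a - δ) (a + δ) ∩ Set.Icc (-N) N, ‖e y‖ₑ ^ 2 ≤ ENNReal.ofReal m) →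
    (∀ p, ‖inner ℂ (mulOp (mult r p) (continuous_mult _ _).measurable
        (fun y => (norm_mult _ _ y).le) e) ((memLp_chartWeight hr.le hrN).toLp _)‖ ≤ β) →
    ∫⁻ p, ‖modifiedEvolution r e p‖ₑ ^ 6 ≤ ENNReal.ofReal C *
      (ENNReal.ofReal E ^ 2 * (ENNReal.ofReal m + ENNReal.ofReal β ^ 2 * ENNReal.ofReal (1 / δ)) +
        ENNReal.ofReal T ^ 3) := by
  obtain ⟨C₁, hC₁, h1⟩ := exists_lintegral_modifiedEvolution_le_of_support
  obtain ⟨C₂, hC₂, h2⟩ := exists_lintegral_modifiedEvolution_le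
  refine ⟨(64 * (C₁ + C₂)).toReal, ENNReal.toReal_nonneg, ?_⟩
  rw [ENNReal.ofReal_toReal (ENNReal.mul_ne_top (by simp) (ENNReal.add_ne_top.2 ⟨hC₁, hC₂⟩))]
  intro r N δ hr hrN hδ e E T m β hβ hE hT hm hp
  have hI : MeasurableSet (Set.Icc (-N) N) := measurableSet_Icc
  have he : Measurable (e : ℝ → ℂ) := (Lp.stronglyMeasurable e).measurable
  have hsq : ∀ A : Set ℝ, MeasurableSet A → ∫⁻ y, ‖A.indicator e y‖ₑ ^ 2 =
      ∫⁻ y in A, ‖e y‖ₑ ^ 2 := fun A hA => by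
    rw [← lintegral_indicator hA]
    refine lintegral_congr fun y => ?_
    by_cases h : y ∈ A <;> simp [h]
  have hle : ∀ A : Set ℝ, MeasurableSet A → ∫⁻ y, ‖A.indicator e y‖ₑ ^ 2 ≤ ENNReal.ofReal E :=
    fun A hA => by
      rw [hsq A hA]
      refine (setLIntegral_le_lintegral _ _).trans ?_
      rw [lintegral_enorm_sq]
      exact ENNReal.ofReal_le_ofReal hE
  have hfin : ∀ A : Set ℝ, MeasurableSet A → ∫⁻ y, ‖A.indicator e y‖ₑ ^ 2 < ⊤ :=
    fun A hA => (hle A hA).trans_lt ENNReal.ofReal_lt_top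
  have hmain : ∫⁻ p, ‖modifiedEvolution r ((Set.Icc (-N) N).indicator e) p‖ₑ ^ 6 ≤
      C₁ * ENNReal.ofReal E ^ 2 *
        (ENNReal.ofReal m + ENNReal.ofReal β ^ 2 * ENNReal.ofReal (1 / δ)) := by
    refine (h1 r N δ hr hrN hδ _ (he.indicator hI) (hfin _ hI) (fun y hy => ?_)
      (ENNReal.ofReal m) (ENNReal.ofReal β) (fun a => ?_) fun p => ?_).trans ?_
    · exact Set.indicator_of_notMem (s := Set.Icc (-N) N)
        (fun h => absurd (abs_le.2 h) (not_le.2 hy)) (e : ℝ → ℂ)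
    · refine le_trans (le_of_eq ?_) (hm a)
      rw [← lintegral_indicator measurableSet_Ioo,
        ← lintegral_indicator (measurableSet_Ioo.inter hI)]
      refine lintegral_congr fun y => ?_
      by_cases h : y ∈ Set.Icc (-N) N <;> by_cases h' : y ∈ Set.Ioo (a - δ) (a + δ) <;>
        simp only [Set.indicator, Set.mem_inter_iff, h, h', and_self, and_true, and_false,
          if_true, if_false, enorm_zero, ne_eq, OfNat.ofNat_ne_zero, not_false_eq_true, zero_pow]
    · rw [← ofReal_norm, norm_modifiedEvolution_indicator hr hrN,
        ← ENNReal.ofReal_mul (Real.sqrt_nonneg _)]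
      exact ENNReal.ofReal_le_ofReal (mul_le_mul_of_nonneg_left (hp _) (Real.sqrt_nonneg _))
    · gcongr
      exact hle _ hI
  have htail : ∫⁻ p, ‖modifiedEvolution r ((Set.Icc (-N) N)ᶜ.indicator e) p‖ₑ ^ 6 ≤
      C₂ * ENNReal.ofReal T ^ 3 := by
    refine (h2 r hr _ (he.indicator hI.compl) (hfin _ hI.compl)).trans ?_
    gcongr
    rw [hsq _ hI.compl]
    exact hT
  have hsum : (e : ℝ → ℂ) = fun y => (Set.Icc (-N) N).indicator e y +
      (Set.Icc (-N) N)ᶜ.indicator e y := by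
    funext y
    exact (congrFun (Set.indicator_self_add_compl (Set.Icc (-N) N) e) y).symm
  calc ∫⁻ p, ‖modifiedEvolution r e p‖ₑ ^ 6
      = ∫⁻ p, ‖modifiedEvolution r (fun y => (Set.Icc (-N) N).indicator e y +
          (Set.Icc (-N) N)ᶜ.indicator e y) p‖ₑ ^ 6 := by rw [← hsum]
    _ ≤ 64 * (C₁ * ENNReal.ofReal E ^ 2 *
        (ENNReal.ofReal m + ENNReal.ofReal β ^ 2 * ENNReal.ofReal (1 / δ)) +
          C₂ * ENNReal.ofReal T ^ 3) :=
        (lintegral_modifiedEvolution_add_le hr (he.indicator hI) (he.indicator hI.compl)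
          (hfin _ hI) (hfin _ hI.compl)).trans (mul_le_mul_right (add_le_add hmain htail) _)
    _ ≤ 64 * ((C₁ + C₂) * ENNReal.ofReal E ^ 2 *
        (ENNReal.ofReal m + ENNReal.ofReal β ^ 2 * ENNReal.ofReal (1 / δ)) +
          (C₁ + C₂) * ENNReal.ofReal T ^ 3) := by
        gcongr
        · exact le_self_add
        · exact le_add_self
    _ = _ := by ring

/-! ### Vanishing of the remainders in the sixth power norm -/

lemma exists_pos_mul_pow_le {a ε : ℝ} (ha : 0 ≤ a) (hε : 0 < ε) {n : ℕ} (hn : n ≠ 0) :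
    ∃ b, 0 < b ∧ a * b ^ n ≤ ε := by
  obtain ⟨c, hc, h⟩ := exists_pos_mul_lt hε a
  refine ⟨min c 1, lt_min hc one_pos, ?_⟩
  calc a * min c 1 ^ n ≤ a * min c 1 := by
        gcongr
        exact pow_le_of_le_one (le_min hc.le zero_le_one) (min_le_right _ _) hn
    _ ≤ a * c := by gcongr; exact min_le_left _ _
    _ ≤ ε := h.le

/-- Restriction to `A` is a commuting projection, so mass bounds on a fixed set survive every
extraction step, up to a factor 2. -/
lemma exists_eventually_setLIntegral_le_of_proj {r : ℕ → ℝ} {hr : ∀ ν, 0 < r ν}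
    {hr0 : Tendsto r atTop (𝓝 0)} {U : Ultrafilter ℕ} (hU : (U : Filter ℕ) ≤ atTop) {G : ℕ → L2}
    {B : ℝ} (hB : ∀ ν, ‖G ν‖ ≤ B) {A : Set ℝ} (hA : MeasurableSet A) {η : ℝ} (hη : 0 < η)
    (h : ∀ᶠ ν in (U : Filter ℕ), ∫⁻ y in A, ‖G ν y‖ₑ ^ 2 ≤ ENNReal.ofReal η) (l : ℕ) :
    ∀ᶠ ν in (U : Filter ℕ), ∫⁻ y in A, ‖((modulations r hr hr0).state U G l).seq ν y‖ₑ ^ 2 ≤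
      ENNReal.ofReal (2 * η) := by
  filter_upwards [UnitaryFamily.eventually_norm_proj_sq_le hU hB
    (isCommutingProj_restrictOp hr hr0 hA) l hη, h] with ν h1 h2
  rw [lintegral_enorm_sq_restrictOp hA] at h2 ⊢
  have h3 := (ENNReal.ofReal_le_ofReal_iff hη.le).1 h2
  exact ENNReal.ofReal_le_ofReal (by linarith)

/-- Mass bounds on fixed sets cannot be intersected over uncountably many centres `a`. Each interval
of radius $\delta$ lies in one of the intervals $[(k-1)\delta,(k+2)\delta]$, and only finitely many
`k` matter inside $[-N,N]$; their length explains the $3\delta$. -/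
lemma eventually_forall_setLIntegral_le {r : ℕ → ℝ} {hr : ∀ ν, 0 < r ν}
    {hr0 : Tendsto r atTop (𝓝 0)} {U : Ultrafilter ℕ} (hU : (U : Filter ℕ) ≤ atTop) {G : ℕ → L2}
    {B : ℝ} (hB : ∀ ν, ‖G ν‖ ≤ B) {N δ η : ℝ} (hδ : 0 < δ) (hη : 0 < η)
    (h : ∀ᶠ ν in atTop, ∀ A, MeasurableSet A → A ⊆ Set.Icc (-N) N →
      volume A ≤ ENNReal.ofReal (3 * δ) → ∫⁻ y in A, ‖G ν y‖ₑ ^ 2 ≤ ENNReal.ofReal η) (l : ℕ) :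
    ∀ᶠ ν in (U : Filter ℕ), ∀ a, ∫⁻ y in Set.Ioo (a - δ) (a + δ) ∩ Set.Icc (-N) N,
      ‖((modulations r hr hr0).state U G l).seq ν y‖ₑ ^ 2 ≤ ENNReal.ofReal (2 * η) := by
  let J : ℤ → Set ℝ := fun k => Set.Icc ((k - 1) * δ) ((k + 2) * δ) ∩ Set.Icc (-N) N
  have hJ : ∀ k, MeasurableSet (J k) := fun k => measurableSet_Icc.inter measurableSet_Icc
  have hvol : ∀ k, volume (J k) ≤ ENNReal.ofReal (3 * δ) := fun k => by
    refine (measure_mono Set.inter_subset_left).trans (le_of_eq ?_)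
    rw [Real.volume_Icc]
    congr 1
    ring
  have h1 : ∀ k : ℤ, ∀ᶠ ν in (U : Filter ℕ), ∫⁻ y in J k,
      ‖((modulations r hr hr0).state U G l).seq ν y‖ₑ ^ 2 ≤ ENNReal.ofReal (2 * η) := fun k =>
    exists_eventually_setLIntegral_le_of_proj hU hB (hJ k) hη
      ((h.filter_mono hU).mono fun ν hν => hν _ (hJ k) Set.inter_subset_right (hvol k)) l
  have h2 := (Filter.eventually_all_finset (Finset.Icc (-⌈N / δ + 2⌉) ⌈N / δ + 2⌉)).2
    fun k _ => h1 k
  filter_upwards [h2] with ν hν a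
  have hsub : Set.Ioo (a - δ) (a + δ) ∩ Set.Icc (-N) N ⊆ J ⌊a / δ⌋ := by
    rintro y ⟨hy, hyN⟩
    have h3 := (le_div_iff₀ hδ).1 (Int.floor_le (a / δ))
    have h4 := (div_lt_iff₀ hδ).1 (Int.lt_floor_add_one (a / δ))
    exact ⟨⟨by nlinarith [hy.1], by nlinarith [hy.2]⟩, hyN⟩
  by_cases hk : ⌊a / δ⌋ ∈ Finset.Icc (-⌈N / δ + 2⌉) ⌈N / δ + 2⌉
  · exact (lintegral_mono_set hsub).trans (hν _ hk)
  · have hempty : Set.Ioo (a - δ) (a + δ) ∩ Set.Icc (-N) N = ∅ := by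
      refine Set.eq_empty_iff_forall_notMem.2 ?_
      rintro y ⟨hy, hyN⟩
      refine hk (Finset.mem_Icc.2 ⟨?_, ?_⟩)
      · rw [neg_le, ← Int.ceil_neg]
        refine Int.ceil_mono ?_
        rw [← neg_div, div_add' _ _ _ hδ.ne', div_le_div_iff_of_pos_right hδ]
        linarith [hy.1, hy.2, hyN.1, hyN.2]
      · refine (Int.floor_le_ceil _).trans (Int.ceil_mono ?_)
        rw [div_add' _ _ _ hδ.ne', div_le_div_iff_of_pos_right hδ]
        linarith [hy.1, hy.2, hyN.1, hyN.2]
    rw [hempty]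
    simp

/-- For late `l` the pairing with the limiting weight is small because the next profile is;
replacing that weight by the moving one costs a term that vanishes with $r_\nu$. The budget is
$\beta/2$ for the profile and $\beta/4$ for each of the two errors. -/
lemma eventually_forall_norm_inner_chartWeight_le {r : ℕ → ℝ} (hr : ∀ ν, 0 < r ν)
    (hr0 : Tendsto r atTop (𝓝 0)) {U : Ultrafilter ℕ} (hU : (U : Filter ℕ) ≤ atTop) {G : ℕ → L2}
    {B : ℝ} (hB : ∀ ν, ‖G ν‖ ≤ B) (N : ℝ) {β : ℝ} (hβ : 0 < β) :
    ∃ l₀, ∀ l ≥ l₀, ∀ᶠ ν in (U : Filter ℕ), ∀ (hrN : r ν * N ≤ 1 / 2) (p : ℝ × ℝ),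
      ‖inner ℂ (mulOp (mult (r ν) p) (continuous_mult _ _).measurable
        (fun y => (norm_mult _ _ y).le) (((modulations r hr hr0).state U G l).seq ν))
        ((memLp_chartWeight (hr ν).le hrN).toLp _)‖ ≤ β := by
  let k : L2 := (memLp_chartWeight le_rfl (by simp)).toLp (chartWeight 0 N)
  have h1 := ((UnitaryFamily.tendsto_norm_next (M := modulations r hr hr0) hU hB).const_mul
    2).mul_const ‖k‖
  rw [mul_zero, zero_mul] at h1
  obtain ⟨l₀, hl₀⟩ := eventually_atTop.1 (h1.eventually_le_const (half_pos hβ))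
  refine ⟨l₀, fun l hl => ?_⟩
  obtain ⟨B', hB'⟩ := UnitaryFamily.state_seq_bounded (M := modulations r hr hr0) (U := U) hB l
  have h2 : Tendsto (fun ν => B' * (2 * (r ν * N) ^ 2 * ‖k‖)) atTop (𝓝 0) := by
    have := ((((hr0.mul_const N).pow 2).const_mul 2).mul_const ‖k‖).const_mul B'
    simpa using this
  have h3 := (h2.mono_left hU).eventually_le_const (show (0 : ℝ) < β / 4 by linarith)
  filter_upwards [UnitaryFamily.eventually_norm_inner_le (M := modulations r hr hr0) hU hB l k
    (show (0 : ℝ) < β / 4 by linarith), h3] with ν h4 h5 hrN p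
  set e := ((modulations r hr hr0).state U G l).seq ν
  set k' : L2 := (memLp_chartWeight (hr ν).le hrN).toLp _
  let e' : L2 := (modulations r hr hr0).act ν p e
  have h6 : ‖e'‖ ≤ B' := ((modulations r hr hr0).norm_act ν p e).le.trans (hB' ν)
  have h7 : ‖k' - k‖ ≤ 2 * (r ν * N) ^ 2 * ‖k‖ := norm_toLp_chartWeight_sub_le (hr ν) hrN
  have h8 : inner ℂ e' k' = inner ℂ e' k + inner ℂ e' (k' - k) := by
    rw [← inner_add_right, add_sub_cancel]
  change ‖inner ℂ e' k'‖ ≤ β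
  have h9 : ‖inner ℂ e' (k' - k)‖ ≤ B' * (2 * (r ν * N) ^ 2 * ‖k‖) :=
    (norm_inner_le_norm _ _).trans
      (mul_le_mul h6 h7 (norm_nonneg _) ((norm_nonneg _).trans h6))
  have h10 := h4 p
  have h11 := hl₀ l hl
  rw [h8]
  refine (norm_add_le _ _).trans ?_
  have h12 : ‖inner ℂ e' k‖ ≤ _ := h10
  linarith

lemma exists_forall_eventually_lintegral_modifiedEvolution_le {r : ℕ → ℝ} (hr : ∀ ν, 0 < r ν)
    (hr0 : Tendsto r atTop (𝓝 0)) {U : Ultrafilter ℕ} (hU : (U : Filter ℕ) ≤ atTop) {G : ℕ → L2}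
    {B : ℝ} (hB : ∀ ν, ‖G ν‖ ≤ B)
    (htail : ∀ η > 0, ∃ N, ∀ ν, ∫⁻ y in (Set.Icc (-N) N)ᶜ, ‖G ν y‖ₑ ^ 2 ≤ ENNReal.ofReal η)
    (hshort : ∀ η > 0, ∃ δ > 0, ∀ N, ∀ᶠ ν in atTop, ∀ A, MeasurableSet A → A ⊆ Set.Icc (-N) N →
      volume A ≤ ENNReal.ofReal (3 * δ) → ∫⁻ y in A, ‖G ν y‖ₑ ^ 2 ≤ ENNReal.ofReal η)
    {ε : ℝ} (hε : 0 < ε) :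
    ∃ l₀, ∀ l ≥ l₀, ∀ᶠ ν in (U : Filter ℕ),
      ∫⁻ p, ‖modifiedEvolution (r ν) (((modulations r hr hr0).state U G l).seq ν) p‖ₑ ^ 6 ≤
        ENNReal.ofReal ε := by
  obtain ⟨C, hC, hmain⟩ := exists_lintegral_modifiedEvolution_split_le
  let E := B ^ 2 + 1
  have hE : 0 ≤ E := by positivity
  -- The order of choices matters: `T` and `m` first, then `N` and `δ` from them, then `β` depending
  -- on `δ`, and `l₀` last. The constants 8 and 2 absorb the doubling of `T` and `m` for the
  -- remainders.
  obtain ⟨T, hT, hT'⟩ := exists_pos_mul_pow_le (a := 8 * C) (by positivity)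
    (show (0 : ℝ) < ε / 3 by linarith) (n := 3) (by norm_num)
  obtain ⟨m, hm, hm'⟩ := exists_pos_mul_pow_le (a := 2 * C * E ^ 2) (by positivity)
    (show (0 : ℝ) < ε / 3 by linarith) (n := 1) (by norm_num)
  obtain ⟨N, hN⟩ := htail T hT
  obtain ⟨δ, hδ, hδ'⟩ := hshort m hm
  obtain ⟨β, hβ, hβ'⟩ := exists_pos_mul_pow_le (a := C * E ^ 2 * (1 / δ)) (by positivity)
    (show (0 : ℝ) < ε / 3 by linarith) (n := 2) (by norm_num)
  obtain ⟨l₀, hl₀⟩ := eventually_forall_norm_inner_chartWeight_le hr hr0 hU hB N hβ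
  refine ⟨l₀, fun l hl => ?_⟩
  have hrN : Tendsto (fun ν => r ν * N) atTop (𝓝 0) := by simpa using hr0.mul_const N
  filter_upwards [hl₀ l hl,
    eventually_forall_setLIntegral_le (hr := hr) (hr0 := hr0) hU hB hδ hm (hδ' N) l,
    exists_eventually_setLIntegral_le_of_proj (hr := hr) (hr0 := hr0) hU hB
      (A := (Set.Icc (-N) N)ᶜ) measurableSet_Icc.compl hT (Eventually.of_forall hN) l,
    UnitaryFamily.eventually_norm_proj_sq_le hU hB
      (modulations r hr hr0).isCommutingProj_id l one_pos,
    (hrN.mono_left hU).eventually_le_const (show (0 : ℝ) < 1 / 2 by norm_num)]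
    with ν h1 h2 h3 h4 h5
  refine (hmain (r ν) N δ (hr ν) h5 hδ _ E (2 * T) (2 * m) β hβ.le ?_ h3 h2 (h1 h5)).trans ?_
  · have : ‖G ν‖ ^ 2 ≤ B ^ 2 := pow_le_pow_left₀ (norm_nonneg _) (hB ν) 2
    simp only [ContinuousLinearMap.id_apply] at h4
    simp only [E]
    linarith
  · rw [← ENNReal.ofReal_pow hE, ← ENNReal.ofReal_pow hβ.le, ← ENNReal.ofReal_pow (by positivity),
      ← ENNReal.ofReal_mul (by positivity), ← ENNReal.ofReal_add (by positivity) (by positivity),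
      ← ENNReal.ofReal_mul (by positivity), ← ENNReal.ofReal_add (by positivity) (by positivity),
      ← ENNReal.ofReal_mul hC]
    refine ENNReal.ofReal_le_ofReal ?_
    calc _ = 2 * C * E ^ 2 * m ^ 1 + C * E ^ 2 * (1 / δ) * β ^ 2 + 8 * C * T ^ 3 := by ring
      _ ≤ ε := by linarith

/-! ### Extraction of the profiles -/

lemma lintegral_enorm_sq_eq_l2Norm {α F : Type*} [MeasurableSpace α] [NormedAddCommGroup F]
    {μ : Measure α} {f : α → F} (hf : MemLp f 2 μ) :
    ∫⁻ x, ‖f x‖ₑ ^ 2 ∂μ = ENNReal.ofReal (l2Norm μ f ^ 2) := by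
  have h := eLpNorm_nnreal_pow_eq_lintegral (f := f) (μ := μ) (p := 2) (by norm_num)
  rw [l2Norm, ENNReal.ofReal_pow ENNReal.toReal_nonneg, ENNReal.ofReal_toReal hf.eLpNorm_ne_top]
  simpa using h.symm

lemma eLpNorm_six_le {α F : Type*} [MeasurableSpace α] [NormedAddCommGroup F]
    {μ : Measure α} {f : α → F} {c : ℝ≥0∞} (h : ∫⁻ x, ‖f x‖ₑ ^ 6 ∂μ ≤ c ^ 6) :
    eLpNorm f 6 μ ≤ c := by
  have h1 := eLpNorm_nnreal_pow_eq_lintegral (f := f) (μ := μ) (p := 6) (by norm_num)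
  have h2 : eLpNorm f 6 μ ^ 6 = ∫⁻ x, ‖f x‖ₑ ^ 6 ∂μ := by simpa using h1
  rw [← h2] at h
  exact le_of_not_gt fun hlt => not_lt.2 h (ENNReal.pow_lt_pow_left (by norm_num) hlt)

/-- Modulation, translation and $h^{-1}$ merge into the inverse of one unitary modulation, so the
profiles are those of the abstract extraction. -/
lemma profile_eq_mult_mul (r x t : ℝ) (φ : ℝ → ℂ) (y : ℝ) :
    profile r x t φ y = mult r (-(x, t)) y * φ y := by
  unfold profile hFactor mult
  rw [← Complex.exp_neg, ← Complex.exp_add, ← Complex.exp_add]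
  congr 2
  simp only [phase, Prod.neg_mk]
  push_cast
  ring

lemma memLp_rescaled {C : ℝ} {Θ : ℝ → ℝ} {z w : Plane} (hz : ‖z‖ = 1) (hw : ‖w‖ = 1)
    (hzw : inner ℝ z w = 0) {r ρ : ℝ} (hr : 0 < r) {f : Plane → ℝ}
    (hf : UpperNormalized C Θ z r f) (hsupp : ∀ᵐ x ∂arcMeasure, x ∉ cap z ρ → f x = 0) :
    MemLp (fun y => (rescaled z w r f y : ℂ)) 2 volume := by
  have hm := hf.memLp.aestronglyMeasurable
  refine memLp_two_of_lintegral_lt_top (Complex.continuous_ofReal.comp_aestronglyMeasurable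
    (aestronglyMeasurable_rescaled hz hw hzw hr hm)) ?_
  have : ∀ y, ‖(rescaled z w r f y : ℂ)‖ₑ = ‖rescaled z w r f y‖ₑ := fun y => by
    rw [← ofReal_norm, Complex.norm_real, ofReal_norm]
  simp_rw [this]
  rw [lintegral_rescaled_sq_eq hz hw hzw hr hm hsupp]
  exact lintegral_lt_top_of_memLp_two hf.memLp

lemma setLIntegral_toLp_rescaled {z w : Plane} {r : ℝ} {f : Plane → ℝ}
    (h : MemLp (fun y => (rescaled z w r f y : ℂ)) 2 volume) (A : Set ℝ) :
    ∫⁻ y in A, ‖h.toLp _ y‖ₑ ^ 2 = ∫⁻ y in A, ‖rescaled z w r f y‖ₑ ^ 2 := by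
  refine lintegral_congr_ae (ae_restrict_of_ae ?_)
  filter_upwards [h.coeFn_toLp] with y hy
  rw [hy, ← ofReal_norm, Complex.norm_real, ofReal_norm]

lemma norm_toLp_rescaled {C : ℝ} {Θ : ℝ → ℝ} {z w : Plane} (hz : ‖z‖ = 1) (hw : ‖w‖ = 1)
    (hzw : inner ℝ z w = 0) {r ρ : ℝ} (hr : 0 < r) {f : Plane → ℝ}
    (hf : UpperNormalized C Θ z r f) (hsupp : ∀ᵐ x ∂arcMeasure, x ∉ cap z ρ → f x = 0)
    (h : MemLp (fun y => (rescaled z w r f y : ℂ)) 2 volume) :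
    ‖h.toLp _‖ = l2Norm arcMeasure f := by
  have h1 := setLIntegral_toLp_rescaled h Set.univ
  rw [Measure.restrict_univ, lintegral_enorm_sq,
    lintegral_rescaled_sq_eq hz hw hzw hr hf.memLp.aestronglyMeasurable hsupp,
    lintegral_enorm_sq_eq_l2Norm hf.memLp,
    ENNReal.ofReal_eq_ofReal_iff (sq_nonneg _) (sq_nonneg _)] at h1
  exact (sq_eq_sq₀ (norm_nonneg _) ENNReal.toReal_nonneg).1 h1

/-- The remainder after `l` steps of the greedy algorithm. -/
noncomputable def remainder (r : ℕ → ℝ) (g : ℕ → ℝ → ℂ) (p : ℕ → ℕ → ℝ × ℝ) (φ : ℕ → ℝ → ℂ)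
    (l ν : ℕ) (y : ℝ) : ℂ :=
  g ν y - ∑ j ∈ Finset.range l, profile (r ν) (p j ν).1 (p j ν).2 (φ j) y

/-- The decomposition is claimed at every point, whereas the extraction works with classes in $L^2$;
the pointwise remainder represents the abstract one. -/
lemma state_seq_ae_eq_remainder {r : ℕ → ℝ} (hr : ∀ ν, 0 < r ν) (hr0 : Tendsto r atTop (𝓝 0))
    (U : Filter ℕ) {g : ℕ → ℝ → ℂ} (hg : ∀ ν, MemLp (g ν) 2 volume) (l ν : ℕ) :
    let M := modulations r hr hr0
    let G : ℕ → L2 := fun ν => (hg ν).toLp _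
    (M.state U G l).seq ν =ᵐ[volume] remainder r g (fun j => (M.next U (M.state U G j)).1)
      (fun j => (M.next U (M.state U G j)).2) l ν := by
  intro M G
  induction l with
  | zero =>
    filter_upwards [(hg ν).coeFn_toLp] with y hy
    simp only [remainder, Finset.range_zero, Finset.sum_empty, sub_zero]
    exact hy
  | succ l ih =>
    have h1 : (M.state U G (l + 1)).seq ν = (M.state U G l).seq ν -
      M.act ν (-(M.next U (M.state U G l)).1 ν) (M.next U (M.state U G l)).2 := rfl
    rw [h1]
    filter_upwards [ih, Lp.coeFn_sub ((M.state U G l).seq ν)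
      (M.act ν (-(M.next U (M.state U G l)).1 ν) (M.next U (M.state U G l)).2),
      coeFn_mulOp (continuous_mult (r ν) (-(M.next U (M.state U G l)).1 ν)).measurable
        (fun y => (norm_mult _ _ y).le) (M.next U (M.state U G l)).2] with y h2 h3 h4
    rw [h3, Pi.sub_apply, h2]
    simp only [remainder, Finset.sum_range_succ]
    rw [← sub_sub, profile_eq_mult_mul]
    congr 1

lemma tendsto_abs_add_abs_of_diverge {U : Filter ℕ} {p q : ℕ → ℝ × ℝ}
    (h : UnitaryFamily.Diverge U p q) :
    Tendsto (fun ν => |(p ν).1 - (q ν).1| + |(p ν).2 - (q ν).2|) U atTop := by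
  refine tendsto_atTop_mono (fun ν => ?_) (tendsto_norm_cobounded_atTop.comp h)
  change ‖p ν - q ν‖ ≤ _
  rw [Prod.norm_def]
  exact max_le (le_add_of_nonneg_right (abs_nonneg _)) (le_add_of_nonneg_left (abs_nonneg _))

lemma exists_forall_setLIntegral_rescaled_tail_le {C : ℝ} {Θ : ℝ → ℝ}
    (hΘ : Tendsto Θ atTop (𝓝 0)) {z w : ℕ → Plane} (hz : ∀ ν, ‖z ν‖ = 1) (hw : ∀ ν, ‖w ν‖ = 1)
    (hzw : ∀ ν, inner ℝ (z ν) (w ν) = 0) {r : ℕ → ℝ} (hr : ∀ ν, 0 < r ν) {f : ℕ → Plane → ℝ}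
    (hf : ∀ ν, UpperNormalized C Θ (z ν) (r ν) (f ν)) {η : ℝ} (hη : 0 < η) :
    ∃ N : ℝ, ∀ ν, ∫⁻ y in (Set.Icc (-N) N)ᶜ, ‖rescaled (z ν) (w ν) (r ν) (f ν) y‖ₑ ^ 2 ≤
      ENNReal.ofReal η := by
  obtain ⟨N, hN, hN1⟩ := ((hΘ.eventually_le_const hη).and (eventually_ge_atTop 1)).exists
  refine ⟨N, fun ν => (lintegral_mono_set fun y hy => ?_).trans
    ((lintegral_rescaled_tail_le (hz ν) (hw ν) (hzw ν) (hr ν) (hf ν) hN1).trans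
      (ENNReal.ofReal_le_ofReal hN))⟩
  exact (not_le.1 fun h => hy (abs_le.1 h)).le

lemma exists_eventually_setLIntegral_rescaled_short_le {C : ℝ} {Θ : ℝ → ℝ}
    (hΘpos : ∀ R : ℝ, 1 ≤ R → 0 < Θ R)
    (hΘ : Tendsto Θ atTop (𝓝 0)) {z w : ℕ → Plane} (hz : ∀ ν, ‖z ν‖ = 1) (hw : ∀ ν, ‖w ν‖ = 1)
    (hzw : ∀ ν, inner ℝ (z ν) (w ν) = 0) {r : ℕ → ℝ} (hr : ∀ ν, 0 < r ν)
    (hr0 : Tendsto r atTop (𝓝 0)) {f : ℕ → Plane → ℝ}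
    (hf : ∀ ν, UpperNormalized C Θ (z ν) (r ν) (f ν)) {η : ℝ} (hη : 0 < η) :
    ∃ δ > 0, ∀ N, ∀ᶠ ν in atTop, ∀ A, MeasurableSet A → A ⊆ Set.Icc (-N) N →
      volume A ≤ ENNReal.ofReal (3 * δ) →
      ∫⁻ y in A, ‖rescaled (z ν) (w ν) (r ν) (f ν) y‖ₑ ^ 2 ≤ ENNReal.ofReal η := by
  obtain ⟨R, hR, hR1⟩ :=
    ((hΘ.eventually_le_const (half_pos hη)).and (eventually_ge_atTop 1)).exists
  have hR0 : 0 < R := by linarith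
  -- With this $\delta$ the density term $2R^2\cdot3\delta$ equals $\eta/2$, the other half being
  -- the height term.
  refine ⟨η / (12 * R ^ 2), by positivity, fun N => ?_⟩
  have hrN : Tendsto (fun ν => r ν * N) atTop (𝓝 0) := by simpa using hr0.mul_const N
  filter_upwards [hrN.eventually_le_const (show (0 : ℝ) < 1 / 2 by norm_num)]
    with ν hν A hA hAN hvol
  refine (lintegral_rescaled_short_le (hz ν) (hw ν) (hzw ν) (hr ν) (hf ν) hR1 hν hA hAN).trans ?_
  refine (add_le_add le_rfl (mul_le_mul_right hvol _)).trans ?_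
  rw [← ENNReal.ofReal_mul (by positivity),
    ← ENNReal.ofReal_add (hΘpos R hR1).le (by positivity)]
  refine ENNReal.ofReal_le_ofReal ?_
  have : 2 * R ^ 2 * (3 * (η / (12 * R ^ 2))) = η / 2 := by field_simp; norm_num
  linarith

end CapProfile

/-! ### Assembly of the decomposition -/

open CapProfile in
theorem proposition6p2
    (C : ℝ) (Θ : ℝ → ℝ)
    (hΘpos : ∀ R : ℝ, 1 ≤ R → 0 < Θ R) (hΘ : Tendsto Θ atTop (𝓝 0))
    (z w : ℕ → CapProfile.Plane)
    (hz : ∀ ν, ‖z ν‖ = 1) (hw : ∀ ν, ‖w ν‖ = 1) (hzw : ∀ ν, inner ℝ (z ν) (w ν) = 0)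
    (r : ℕ → ℝ) (hr_pos : ∀ ν, 0 < r ν) (hr_le : ∀ ν, r ν ≤ 1) (hr : Tendsto r atTop (𝓝 0))
    (f : ℕ → CapProfile.Plane → ℝ)
    (hf_nonneg : ∀ ν, ∀ᵐ x ∂CapProfile.arcMeasure, 0 ≤ f ν x)
    (hf_normalized : ∀ ν, CapProfile.UpperNormalized C Θ (z ν) (r ν) (f ν))
    (hf_supp : ∀ ν, ∀ᵐ x ∂CapProfile.arcMeasure,
      x ∉ CapProfile.cap (z ν) (r ν ^ (1 / 2 : ℝ)) → f ν x = 0)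
    (hf_norm : Tendsto (fun ν => CapProfile.l2Norm CapProfile.arcMeasure (f ν)) atTop (𝓝 1)) :
    -- a subsequence `ν ↦ n ν`, profiles `φ j`, parameters `x j ν`, `t j ν`, remainders `e l ν`
    ∃ (n : ℕ → ℕ) (φ : ℕ → ℝ → ℂ) (x t : ℕ → ℕ → ℝ) (e : ℕ → ℕ → ℝ → ℂ),
      StrictMono n ∧
      (∀ j, MemLp (φ j) 2 volume) ∧
      (∀ l ν, MemLp (e l ν) 2 volume) ∧
      (∀ l ν y,
        ((CapProfile.rescaled (z (n ν)) (w (n ν)) (r (n ν)) (f (n ν)) y : ℝ) : ℂ) =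
          (∑ j ∈ Finset.range l, CapProfile.profile (r (n ν)) (x j ν) (t j ν) (φ j) y)
            + e l ν y) ∧
      (∀ j k, j ≠ k →
        Tendsto (fun ν => |x k ν - x j ν| + |t k ν - t j ν|) atTop atTop) ∧
      (∀ l, Tendsto
        (fun ν => CapProfile.l2Norm CapProfile.arcMeasure (f (n ν)) ^ 2
          - ((∑ j ∈ Finset.range l, CapProfile.l2Norm volume (φ j) ^ 2)
            + CapProfile.l2Norm volume (e l ν) ^ 2))
        atTop (𝓝 0)) ∧
      limsup (fun l => limsup (fun ν =>
          eLpNorm (CapProfile.modifiedEvolution (r (n ν)) (e l ν)) 6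
            (volume : Measure (ℝ × ℝ))) atTop) atTop = 0 := by
  -- All limits are first taken along one ultrafilter finer than `atTop`; the subsequence is chosen
  -- only at the end.
  let U : Ultrafilter ℕ := Ultrafilter.of atTop
  have hU : (U : Filter ℕ) ≤ atTop := Ultrafilter.of_le atTop
  have hg : ∀ ν, MemLp (fun y => (rescaled (z ν) (w ν) (r ν) (f ν) y : ℂ)) 2 volume := fun ν =>
    memLp_rescaled (hz ν) (hw ν) (hzw ν) (hr_pos ν) (hf_normalized ν) (hf_supp ν)
  let G : ℕ → L2 := fun ν => (hg ν).toLp _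
  have hGnorm : ∀ ν, ‖G ν‖ = l2Norm arcMeasure (f ν) := fun ν =>
    norm_toLp_rescaled (hz ν) (hw ν) (hzw ν) (hr_pos ν) (hf_normalized ν) (hf_supp ν) (hg ν)
  have hB : ∀ ν, ‖G ν‖ ≤ C := fun ν => (hGnorm ν).trans_le (hf_normalized ν).norm_le
  let M := modulations r hr_pos hr
  let p : ℕ → ℕ → ℝ × ℝ := fun j => (M.next U (M.state U G j)).1
  let φ : ℕ → L2 := fun j => (M.next U (M.state U G j)).2
  let e : ℕ → ℕ → ℝ → ℂ := remainder r
    (fun ν y => (rescaled (z ν) (w ν) (r ν) (f ν) y : ℂ)) p (fun j => φ j)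
  have he : ∀ l ν, (M.state U G l).seq ν =ᵐ[volume] e l ν := fun l ν =>
    state_seq_ae_eq_remainder hr_pos hr U hg l ν
  have hdiv : ∀ j k, j ≠ k → Tendsto (fun ν => |(p k ν).1 - (p j ν).1| + |(p k ν).2 - (p j ν).2|)
      U atTop := fun j k hjk => by
    refine tendsto_abs_add_abs_of_diverge ?_
    rcases lt_or_gt_of_ne hjk with h | h
    · exact UnitaryFamily.state_diverge hU hB h
    · exact (UnitaryFamily.state_diverge hU hB h).symm
  have hpyth : ∀ l, Tendsto (fun ν => l2Norm arcMeasure (f ν) ^ 2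
      - ((∑ j ∈ Finset.range l, l2Norm volume (φ j) ^ 2) + l2Norm volume (e l ν) ^ 2))
      U (𝓝 0) := fun l => by
    refine (UnitaryFamily.tendsto_norm_sq_state hU hB M.isCommutingProj_id l).congr fun ν => ?_
    have h1 : l2Norm volume (e l ν) = ‖(M.state U G l).seq ν‖ := by
      rw [l2Norm, ← eLpNorm_congr_ae (he l ν)]
      rfl
    rw [h1, ← hGnorm]
    rfl
  have hsix : ∀ m : ℕ, ∃ l₀, ∀ l ≥ l₀, ∀ᶠ ν in (U : Filter ℕ),
      eLpNorm (modifiedEvolution (r ν) (e l ν)) 6 volume ≤ ENNReal.ofReal (1 / ((m : ℝ) + 1)) :=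
    fun m => by
      have hm : (0 : ℝ) < 1 / ((m : ℝ) + 1) := by positivity
      obtain ⟨l₀, hl₀⟩ := exists_forall_eventually_lintegral_modifiedEvolution_le hr_pos hr hU hB
        (fun η hη => by
          obtain ⟨N, hN⟩ := exists_forall_setLIntegral_rescaled_tail_le hΘ hz hw hzw hr_pos
            hf_normalized hη
          exact ⟨N, fun ν => (setLIntegral_toLp_rescaled (hg ν) _).trans_le (hN ν)⟩)
        (fun η hη => by
          obtain ⟨δ, hδ, h⟩ := exists_eventually_setLIntegral_rescaled_short_le hΘpos hΘ hz hw hzw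
            hr_pos hr hf_normalized hη
          exact ⟨δ, hδ, fun N => (h N).mono fun ν hν A hA hAN hvol =>
            (setLIntegral_toLp_rescaled (hg ν) _).trans_le (hν A hA hAN hvol)⟩)
        (pow_pos hm 6)
      refine ⟨l₀, fun l hl => (hl₀ l hl).mono fun ν hν => eLpNorm_six_le ?_⟩
      rw [← ENNReal.ofReal_pow hm.le]
      refine le_trans (le_of_eq (lintegral_congr fun q => ?_)) hν
      rw [modifiedEvolution_congr_ae (he l ν)]
  choose l₀ hl₀ using hsix
  -- The three limit statements become countably many eventual inequalities. In a triple, the first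
  -- entry serves both as an index of a frame and as the number of profiles, the second is the other
  -- frame, and the third is the accuracy.
  obtain ⟨n, hn, hP⟩ := exists_strictMono_of_eventually hU
    (fun (i : ℕ × ℕ × ℕ) ν =>
      (i.1 ≠ i.2.1 → (i.2.2 : ℝ) ≤ |(p i.2.1 ν).1 - (p i.1 ν).1| + |(p i.2.1 ν).2 - (p i.1 ν).2|) ∧
      |l2Norm arcMeasure (f ν) ^ 2 - ((∑ j ∈ Finset.range i.1, l2Norm volume (φ j) ^ 2)
        + l2Norm volume (e i.1 ν) ^ 2)| < 1 / ((i.2.2 : ℝ) + 1) ∧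
      (l₀ i.2.2 ≤ i.1 → eLpNorm (modifiedEvolution (r ν) (e i.1 ν)) 6 volume ≤
        ENNReal.ofReal (1 / ((i.2.2 : ℝ) + 1)))) fun i => by
    obtain ⟨j, k, m⟩ := i
    refine Eventually.and ?_ (Eventually.and ?_ ?_)
    · by_cases hjk : j = k
      · exact Eventually.of_forall fun ν h => absurd hjk h
      · exact ((hdiv j k hjk).eventually_ge_atTop (m : ℝ)).mono fun ν hν _ => hν
    · have h := Metric.tendsto_nhds.1 (hpyth j) (1 / ((m : ℝ) + 1)) (by positivity)
      refine h.mono fun ν hν => ?_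
      rwa [Real.dist_eq, sub_zero] at hν
    · by_cases hl : l₀ m ≤ j
      · exact (hl₀ m j hl).mono fun ν hν _ => hν
      · exact Eventually.of_forall fun ν h => absurd h hl
  refine ⟨n, fun j => φ j, fun j ν => (p j (n ν)).1, fun j ν => (p j (n ν)).2,
    fun l ν => e l (n ν), hn, fun j => Lp.memLp _,
    fun l ν => (memLp_congr_ae (he l (n ν))).1 (Lp.memLp _), fun l ν y => ?_, fun j k hjk => ?_,
    fun l => ?_, ?_⟩
  · simp only [e, remainder]
    ring
  · refine tendsto_atTop.2 fun b => ?_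
    obtain ⟨m, hm⟩ := exists_nat_ge b
    exact (hP (j, k, m)).mono fun ν hν => hm.trans (hν.1 hjk)
  · refine Metric.tendsto_nhds.2 fun ε hε => ?_
    obtain ⟨m, hm⟩ := exists_nat_one_div_lt hε
    refine (hP (l, 0, m)).mono fun ν hν => ?_
    rw [Real.dist_eq, sub_zero]
    exact hν.2.1.trans hm
  · refine le_antisymm ?_ zero_le
    have hlim : Tendsto (fun m : ℕ => ENNReal.ofReal (1 / ((m : ℝ) + 1))) atTop (𝓝 0) := by
      have := ENNReal.tendsto_ofReal (tendsto_one_div_add_atTop_nhds_zero_nat (𝕜 := ℝ))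
      rwa [ENNReal.ofReal_zero] at this
    -- For each accuracy `m`, both limits superior are bounded using only $l\ge l_0(m)$.
    refine ge_of_tendsto' hlim fun m => ?_
    refine limsup_le_of_le (h := (eventually_ge_atTop (l₀ m)).mono fun l hl => ?_)
    exact limsup_le_of_le (h := (hP (l, 0, m)).mono fun ν hν => hν.2.2 hl)
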